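/- **Setting.** Let $W$ be the Riemann surface of $\sqrt t$: its points are the $t\neq0$ with $\arg t$ taken modulo $4\pi$, and $\sqrt t$ is a single-valued coordinate on it. For $a<b$ and $r>0$ the set $\{t\in W: 0<|t|<r,\ \arg t\in(a,b) \bmod 4\pi\}$ is called a sector of opening $b-a$, and $S(d,\alpha,r)$ is the one with $(a,b)=(d-\frac\alpha2,d+\frac\alpha2)$ (it is empty if $\alpha\le 0$). Put $W_r=\{t\in W:0<|t|<r\}$, $D_\rho=\{z\in\mathbb C:|z|<\rho\}$ and $\mathcal L_\phi=\{t\in W:\arg t=\phi \bmod 4\pi\}$; $\mathcal O(\Omega)$ denotes the holomorphic functions on $\Omega$. Consider the Cauchy problem for the heat equation $$\partial_tu=\partial_z^2u,\qquad u(0,z)=\varphi(z),\tag{1}$$ with formal solution $\hat u(t,z)=\sum_{n\ge0}c_n(z)t^n$, $c_n=\varphi^{(2n)}/n!$. An actual solution on $S\times D_\rho$, where $S$ is a sector, is a function $u\in\mathcal O(S\times D_\rho)$ that satisfies the equation there, with $\lim_{t\to0,\,t\in S}u(t,z)=\varphi(z)$ for every $z\in D_\rho$. *Summability.* $\hat u$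 is 1-summable in the direction $d\in\mathbb R$ if for some $\varepsilon,\rho>0$: (A) the $c_n$ are holomorphic on $D_\rho$ and $|c_n(z)|\le AB^n\,n!$ there for some $A,B>0$; (B) the modified Borel transform $g(s,z)=\sum_n c_n(z)\frac{n!}{(2n)!}s^n$ extends holomorphically from a neighbourhood of $s=0$ to the sector $\{|\arg s-d|<\varepsilon/2\}$, for $z\in D_\rho$, and satisfies $|g(s,z)|\le C_1e^{C_2|s|}$ on every smaller sector $\{|\arg s-d|<\varepsilon'/2\}$, $\varepsilon'<\varepsilon$ (with $C_1,C_2>0$ depending on $\varepsilon'$). Its 1-sum in the direction $d$ is then $$t^{-1/2}\int_{e^{id}\mathbb R_+}g(s,z)\,C_2\big((s/t)^{1/2}\big)\,ds^{1/2},\qquad C_2(\tau)=\sum_{n\ge0}\frac{(-\tau)^n}{n!\,\Gamma(1-\frac{n+1}2)},$$ for $t$ near $0$ with $\arg t$ near $d$ and $z$ near $0$, together with its analytic continuation. Otherwise $d$ is a singular direction. $\hat u$ is 1-summable if it has only finitely many singular directions modulo $2\pi$. *Stokes lines.* If $\phi$ is an isolated singular direction, then $\mathcal L_\phi$ is a Stokes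 line and $\mathcal L_{\phi\pm\pi/2}$ are anti-Stokes lines for $\hat u$; the jump across $\mathcal L_\phi$ is $u^{\phi^+}-u^{\phi^-}$, the difference of the 1-sums in the directions close to $\phi$ that are greater, respectively less, than $\phi$. *Maximal family.* Let $V$ be a sector of opening greater than $\pi$ and $\hat u$ be 1-summable. A finite family $\{u_i\}$, $u_i\in\mathcal O(V_i\times D_\rho)$, is a maximal family of solutions of (1) on $V\times D_\rho$ if * every $V_i\subseteq V$ is a sector of opening greater than $\pi$, and the $V_i$ cover $V$; * every $u_i$ is an actual solution of (1) on $V_i\times D_\rho$; * if $i\neq j$ and $V_i\cap V_j\neq\emptyset$, then $u_i\not\equiv u_j$ on $(V_i\cap V_j)\times D_\rho$; * whenever $\tilde u$ is an actual solution of (1) on $\tilde V\times D_\rho$, where $\tilde V\subseteq V$ is a sector, and $\tilde u$ is the 1-sum of $\hat u$ in some nonsingular direction $d$ with $\mathcal L_d\cap\tilde V\ne\emptyset$, there is $i$ with $\tilde V\cap V_i\ne\emptyset$ and $\tilde u\equiv u_i$ on $(\tilde V\cap V_i)\times D_\rho$. **Corollary.** Let $n\ge1$, $m_1,\dots,m_n\ge1$,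 and let $$\varphi(z)=\sum_{l=1}^n\sum_{j=1}^{m_l}\frac{a_{lj}}{z-z_{lj}}+\tilde\varphi(z),$$ where $a_{lj},z_{lj}\in\mathbb C\setminus\{0\}$, the poles $z_{lj}$ are pairwise distinct, $\tilde\varphi$ is entire with $|\tilde\varphi(z)|\le C_1e^{C_2|z|^2}$ for some $C_1,C_2>0$, and, with $\arg z_{lj}\in[0,\pi)$, $2\arg z_{lj}=\delta_l$ for all $j$, where $0\le\delta_1<\dots<\delta_n<2\pi$. Put $\delta_{l+n}=\delta_l+2\pi$ for $l=1,\dots,n$ and $\delta_{2n+1}=\delta_1+4\pi$. Then: 1. The Stokes lines for $\hat u$ are exactly the $\mathcal L_{\delta_k}$, and the anti-Stokes lines are exactly the $\mathcal L_{\delta_k\pm\pi/2}$, $k=1,\dots,2n$. 2. There are functions $u_1,\dots,u_{2n}$ such that, for every $k$ and every $\theta\in(\delta_k,\delta_{k+1})\bmod 4\pi$, $u_k$ is the 1-sum of $\hat u$ in the direction $\theta$, and for every $\varepsilon>0$ there are $r,\rho>0$ such that $$u_k(t,z)=u^\theta(t,z):=\frac1{\sqrt{4\pi t}}\int_{e^{i\theta/2}\mathbb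 R_+}\big(\varphi(z+s)+\varphi(z-s)\big)e^{-s^2/(4t)}\,ds$$ for $(t,z)\in S(\theta,\pi-\varepsilon,r)\times D_\rho$, the integral being absolutely convergent. Moreover, for every $\varepsilon>0$ there are $r_0,\rho_0>0$ such that for all $r\in(0,r_0]$ and $\rho\in(0,\rho_0]$ the following hold. * With $V_k(\varepsilon,r)=\{t\in W:0<|t|<r,\ \arg t\in(\delta_k-\frac\pi2+\frac\varepsilon2,\ \delta_{k+1}+\frac\pi2-\frac\varepsilon2)\bmod4\pi\}$ one has $u_k\in\mathcal O(V_k(\varepsilon,r)\times D_\rho)$ for $k=1,\dots,2n$. * If $\varepsilon<\pi$ and $\varepsilon<\delta_{k+1}-\delta_k$ for all $k=1,\dots,2n$, then $\{u_1,\dots,u_{2n}\}$, with $u_k$ on $V_k(\varepsilon,r)\times D_\rho$, is a maximal family of solutions of (1) on $W_r\times D_\rho$. * For $l=1,\dots,n$, with $u_0:=u_{2n}$, the jumps across $\mathcal L_{\delta_l}$ and $\mathcal L_{\delta_{l+n}}$ are $$u_l-u_{l-1}=u^{\delta_l^+}-u^{\delta_l^-}=-i\sqrt{\pi/t}\,\sum_{j=1}^{m_l}a_{lj}\,e^{-\frac{(z_{lj}-z)^2}{4t}}\quad\text{on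 }S(\delta_l,\pi-\varepsilon,r)\times D_\rho,$$ $$u_{l+n}-u_{l-1+n}=u^{\delta_{l+n}^+}-u^{\delta_{l+n}^-}=i\sqrt{\pi/t}\,\sum_{j=1}^{m_l}a_{lj}\,e^{-\frac{(z_{lj}-z)^2}{4t}}\quad\text{on }S(\delta_{l+n},\pi-\varepsilon,r)\times D_\rho.$$ -/

import Mathlib

noncomputable section

namespace HeatStokes

/-! The Riemann surface `W` of the square root is modelled by its global coordinate `w = √t`:
a point of `W` is a complex number `w ≠ 0`, lying over `t = w ^ 2`; its argument `arg t` is twice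
the argument of `w`, hence is defined modulo `4π`.  A function on a subset of `W` (and of a disc in
the variable `z`) is a function `u : ℂ → ℂ → ℂ` of `w` and `z`. -/

/-- The point of `W` with `|t| = R` and `arg t = ψ`. -/
def pt (R ψ : ℝ) : ℂ := (Real.sqrt R : ℂ) * Complex.exp (Complex.I * ψ / 2)

/-- The points of `W` with `0 < |t| < r` and `arg t ∈ (a, b)` (modulo `4π`). -/
def arcSector (a b r : ℝ) : Set ℂ :=
  {w | ∃ R ∈ Set.Ioo 0 r, ∃ ψ ∈ Set.Ioo a b, w = pt R ψ}

/-- The sector `S(d, α, r)` in the direction `d` with opening `α` and radius `r`, on `W`. -/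
def sector (d α r : ℝ) : Set ℂ := arcSector (d - α / 2) (d + α / 2) r

/-- The half-line `arg t = d` (modulo `4π`) on `W`. -/
def ray (d : ℝ) : Set ℂ := {w | ∃ R : ℝ, 0 < R ∧ w = pt R d}

/-- `W_r`, the points of `W` with `0 < |t| < r`. -/
def puncturedDisc (r : ℝ) : Set ℂ := {w | w ≠ 0 ∧ ‖w‖ ^ 2 < r}

/-- `u ∈ 𝒪(S × D_ρ)`.  Holomorphy in `t` is holomorphy in the coordinate `w = √t`. -/
def Holo (u : ℂ → ℂ → ℂ) (S : Set ℂ) (ρ : ℝ) : Prop :=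
  DifferentiableOn ℂ (Function.uncurry u) (S ×ˢ Metric.ball (0 : ℂ) ρ)

/-- `f ∈ 𝒪²(ℂ)`: entire of exponential growth of order at most `2`. -/
def EntireGrowthTwo (f : ℂ → ℂ) : Prop :=
  Differentiable ℂ f ∧
    ∃ C₁ C₂ : ℝ, 0 < C₁ ∧ 0 < C₂ ∧ ∀ x, ‖f x‖ ≤ C₁ * Real.exp (C₂ * ‖x‖ ^ 2)

/-! ### Summability of formal series `∑ c n z * t ^ n` with coefficients holomorphic near `z = 0` -/

/-- The unbounded sector `{s : arg s ∈ (d - ε / 2, d + ε / 2)}` of the plane of the Borel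
variable. -/
def borelSector (d ε : ℝ) : Set ℂ :=
  {s | ∃ R : ℝ, 0 < R ∧ ∃ ψ ∈ Set.Ioo (d - ε / 2) (d + ε / 2), s = R * Complex.exp (Complex.I * ψ)}

/-- The series `∑ c n z * t ^ n` belongs to `𝒪(D_ρ)[[t]]₁` (Gevrey order `1`). -/
def GevreyOne (c : ℕ → ℂ → ℂ) (ρ : ℝ) : Prop :=
  (∀ n, DifferentiableOn ℂ (c n) (Metric.ball 0 ρ)) ∧
    ∃ A B : ℝ, 0 < A ∧ 0 < B ∧
      ∀ n, ∀ z ∈ Metric.ball (0 : ℂ) ρ, ‖c n z‖ ≤ A * B ^ n * (n.factorial : ℝ)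

/-- `g` is the analytic continuation of the modified Borel transform of order `1`,
`∑ c n z * n! / Γ(1 + 2 n) * s ^ n`, from a neighbourhood of `s = 0` to the sector `S(d, ε)`, for
`z ∈ D_ρ`, and there `g` has exponential growth of order at most `1`. -/
structure IsBorelTransform (c : ℕ → ℂ → ℂ) (d ε ρ : ℝ) (g : ℂ → ℂ → ℂ) : Prop where
  continuation : ∃ η : ℝ, 0 < η ∧
    Holo g (Metric.ball 0 η ∪ borelSector d ε) ρ ∧
    ∀ s ∈ Metric.ball (0 : ℂ) η, ∀ z ∈ Metric.ball (0 : ℂ) ρ,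
      HasSum (fun n : ℕ => c n z * (n.factorial : ℂ) / ((2 * n).factorial : ℂ) * s ^ n) (g s z)
  growth : ∀ ε' : ℝ, 0 < ε' → ε' < ε → ∃ C₁ C₂ : ℝ, 0 < C₁ ∧ 0 < C₂ ∧
    ∀ s ∈ borelSector d ε', ∀ z ∈ Metric.ball (0 : ℂ) ρ, ‖g s z‖ ≤ C₁ * Real.exp (C₂ * ‖s‖)

/-- The series is `1`-summable in the direction `d` (the disc in `z` may be taken small). -/
def SummableIn (c : ℕ → ℂ → ℂ) (d : ℝ) : Prop :=
  ∃ ε ρ : ℝ, 0 < ε ∧ 0 < ρ ∧ GevreyOne c ρ ∧ ∃ g, IsBorelTransform c d ε ρ g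

/-- The series is `1`-summable: there are only finitely many singular directions modulo `2π`. -/
def OneSummable (c : ℕ → ℂ → ℂ) : Prop :=
  {d ∈ Set.Ico (0 : ℝ) (2 * Real.pi) | ¬ SummableIn c d}.Finite

/-- The function `C_α(τ) = ∑ (-τ)^n / (n! Γ(1 - (n + 1) / α))`; at the poles of `Γ` the term is
`0`. -/
def kernelC (α : ℝ) (τ : ℂ) : ℂ :=
  ∑' n : ℕ, (-τ) ^ n / ((n.factorial : ℂ) * Complex.Gamma (1 - ((n : ℂ) + 1) / (α : ℂ)))

/-- The Ecalle operator of order `1` along the ray `arg s = θ`,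
`t^(-1/2) ∫ g(s) C₂((s/t)^(1/2)) d(s^(1/2))`, at the point `w = t^(1/2)`; the ray is parametrized
by `s^(1/2) = y * exp (i θ / 2)`, `y > 0`. -/
def ecalle (g : ℂ → ℂ) (θ : ℝ) (w : ℂ) : ℂ :=
  w⁻¹ * (Complex.exp (Complex.I * θ / 2) *
    ∫ y in Set.Ioi (0 : ℝ), g ((y : ℂ) ^ 2 * Complex.exp (Complex.I * θ)) *
      kernelC 2 ((y : ℂ) * Complex.exp (Complex.I * θ / 2) / w))

/-- `u` is the `1`-sum of the series in the direction `d`: it coincides with the Ecalle transform of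
the Borel transform for `t` close to `0` in a sector bisected by `arg t = d` and `z` close to `0`.
A function holomorphic in a sector containing that half-line and in a disc in `z` is determined by
this. -/
def IsOneSum (c : ℕ → ℂ → ℂ) (d : ℝ) (u : ℂ → ℂ → ℂ) : Prop :=
  ∃ ε ρ r : ℝ, 0 < ε ∧ 0 < ρ ∧ 0 < r ∧ GevreyOne c ρ ∧ ∃ g, IsBorelTransform c d ε ρ g ∧
    ∀ w ∈ sector d ε r, ∀ z ∈ Metric.ball (0 : ℂ) ρ, u w z = ecalle (fun s => g s z) d w

/-! ### Stokes lines and jumps -/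

/-- `φ` is the direction of a Stokes line: an isolated singular direction. -/
def IsStokesDirection (c : ℕ → ℂ → ℂ) (φ : ℝ) : Prop :=
  ¬ SummableIn c φ ∧ ∃ ε : ℝ, 0 < ε ∧ ∀ d ∈ Set.Ioo (φ - ε) (φ + ε), d ≠ φ → SummableIn c d

/-- Stokes lines, as subsets of `W`. -/
def IsStokesLine (c : ℕ → ℂ → ℂ) (L : Set ℂ) : Prop :=
  ∃ φ : ℝ, IsStokesDirection c φ ∧ L = ray φ

/-- Anti-Stokes lines, as subsets of `W`. -/
def IsAntiStokesLine (c : ℕ → ℂ → ℂ) (L : Set ℂ) : Prop :=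
  ∃ φ : ℝ, IsStokesDirection c φ ∧ (L = ray (φ + Real.pi / 2) ∨ L = ray (φ - Real.pi / 2))

/-- On `S × D_ρ` the function `J` is the jump across the line `arg t = φ`: the difference of the
`1`-sums in directions close to `φ`, greater and less than `φ` respectively. -/
def IsJump (c : ℕ → ℂ → ℂ) (φ : ℝ) (S : Set ℂ) (ρ : ℝ) (J : ℂ → ℂ → ℂ) : Prop :=
  ∃ uplus uminus : ℂ → ℂ → ℂ, Holo uplus S ρ ∧ Holo uminus S ρ ∧
    (∃ η : ℝ, 0 < η ∧ (∀ θ ∈ Set.Ioo φ (φ + η), IsOneSum c θ uplus) ∧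
      ∀ θ ∈ Set.Ioo (φ - η) φ, IsOneSum c θ uminus) ∧
    ∀ w ∈ S, ∀ z ∈ Metric.ball (0 : ℂ) ρ, J w z = uplus w z - uminus w z

/-! ### The heat equation -/

/-- The coefficients `φ^(2n)(z) / n!` of the formal solution of `∂_t u = ∂_z² u`, `u(0, z) = φ(z)`. -/
def formalSolution (φ : ℂ → ℂ) (n : ℕ) (z : ℂ) : ℂ :=
  iteratedDeriv (2 * n) φ z / (n.factorial : ℂ)

/-- `u` is an actual solution on `S × D_ρ` of `∂_t u = ∂_z² u`, `u(0, z) = φ(z)`.  In the coordinate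
`w = √t` one has `∂_t = (2 w)⁻¹ ∂_w`. -/
structure IsActualSolution (φ : ℂ → ℂ) (S : Set ℂ) (ρ : ℝ) (u : ℂ → ℂ → ℂ) : Prop where
  holo : Holo u S ρ
  heat : ∀ w ∈ S, ∀ z ∈ Metric.ball (0 : ℂ) ρ,
    (2 * w)⁻¹ * deriv (fun w' => u w' z) w = iteratedDeriv 2 (u w) z
  initial : ∀ z ∈ Metric.ball (0 : ℂ) ρ,
    Filter.Tendsto (fun w => u w z) (nhdsWithin 0 S) (nhds (φ z))

/-- `{u i}`, `u i ∈ 𝒪(V i × D_ρ)`, is a maximal family of solutions of the Cauchy problem of the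
heat equation with datum `φ` on `Vtot × D_ρ`, where `Vtot ⊆ W`.  In the last condition `Vt` is a
sector containing the half-line `arg t = d` near `0`, as do the sectors on which the `1`-sum in
the direction `d` lives. -/
structure IsMaximalFamily {ι : Type} (φ : ℂ → ℂ) (Vtot : Set ℂ) (ρ : ℝ)
    (V : ι → Set ℂ) (u : ι → ℂ → ℂ → ℂ) : Prop where
  summable : OneSummable (formalSolution φ)
  finite : Finite ι
  total_sector : ∃ d α r : ℝ, Real.pi < α ∧ 0 < r ∧ Vtot = sector d α r
  sub : ∀ i, V i ⊆ Vtot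
  is_sector : ∀ i, ∃ d α r : ℝ, Real.pi < α ∧ 0 < r ∧ V i = sector d α r
  cover : ⋃ i, V i = Vtot
  solution : ∀ i, IsActualSolution φ (V i) ρ (u i)
  distinct : ∀ i j, i ≠ j → (V i ∩ V j).Nonempty →
    ¬ ∀ w ∈ V i ∩ V j, ∀ z ∈ Metric.ball (0 : ℂ) ρ, u i w z = u j w z
  maximal : ∀ (d₀ α r : ℝ) (Vt : Set ℂ) (ut : ℂ → ℂ → ℂ) (d : ℝ),
    0 < α → 0 < r → Vt = sector d₀ α r → Vt ⊆ Vtot → IsActualSolution φ Vt ρ ut →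
    SummableIn (formalSolution φ) d → (ray d ∩ Vt).Nonempty → IsOneSum (formalSolution φ) d ut →
    ∃ i, (Vt ∩ V i).Nonempty ∧
      ∀ w ∈ Vt ∩ V i, ∀ z ∈ Metric.ball (0 : ℂ) ρ, ut w z = u i w z

/-- The integrand of the integral representation of `u^θ`, on the ray `s = y * exp (i θ / 2)`. -/
def heatIntegrand (φ : ℂ → ℂ) (θ : ℝ) (w z : ℂ) (y : ℝ) : ℂ :=
  (φ (z + y * Complex.exp (Complex.I * θ / 2)) + φ (z - y * Complex.exp (Complex.I * θ / 2))) *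
    Complex.exp (-(y * Complex.exp (Complex.I * θ / 2)) ^ 2 / (4 * w ^ 2))

/-- `u^θ(t, z) = (4 π t)^(-1/2) ∫ (φ(z + s) + φ(z - s)) exp (-s² / (4 t)) ds` over the ray
`s ∈ exp (i θ / 2) ℝ₊`, at the point `w = √t`. -/
def heatIntegral (φ : ℂ → ℂ) (θ : ℝ) (w z : ℂ) : ℂ :=
  ((Real.sqrt (4 * Real.pi) : ℂ) * w)⁻¹ *
    (Complex.exp (Complex.I * θ / 2) * ∫ y in Set.Ioi (0 : ℝ), heatIntegrand φ θ w z y)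

/-- The datum `φ(x) = ∑_l ∑_j a l j / (x - p l j) + f x`. -/
def meroDatum {n : ℕ} {m : Fin n → ℕ} (a p : (l : Fin n) → Fin (m l) → ℂ) (f : ℂ → ℂ) (x : ℂ) : ℂ :=
  (∑ l, ∑ j, a l j / (x - p l j)) + f x

/-- The directions `δ_0 < ... < δ_{n-1}` continued by `δ_{k+n} = δ_k + 2π` (indices from `0`). -/
def dir {n : ℕ} [NeZero n] (δ : Fin n → ℝ) (k : ℕ) : ℝ :=
  δ (Fin.ofNat n k) + 2 * Real.pi * ((k / n : ℕ) : ℝ)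

/-- The set `V_k(ε, r)` on `W`. -/
def V {n : ℕ} [NeZero n] (δ : Fin n → ℝ) (ε r : ℝ) (k : Fin (2 * n)) : Set ℂ :=
  arcSector (dir δ k - Real.pi / 2 + ε / 2) (dir δ (k + 1) + Real.pi / 2 - ε / 2) r

/-- The index `l` among the `2n` indices. -/
def lo {n : ℕ} (l : Fin n) : Fin (2 * n) := ⟨l, by omega⟩

/-- The index `l + n` among the `2n` indices. -/
def hi {n : ℕ} (l : Fin n) : Fin (2 * n) := ⟨l + n, by omega⟩

/-- The function `√(π/t) ∑_j a_j exp (-(p_j - z)² / (4 t))` at the point `w = √t`. -/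
def gaussSum {m : ℕ} (a p : Fin m → ℂ) (w z : ℂ) : ℂ :=
  (Real.sqrt Real.pi : ℂ) / w * ∑ j, a j * Complex.exp (-(p j - z) ^ 2 / (4 * w ^ 2))

end HeatStokes

end

namespace HeatStokes

open MeasureTheory Set Filter Topology
open scoped Real

/-! ### Holomorphic dependence of integrals on parameters -/

/-! Everything is made explicit in the coordinate `w = √t`. The weights `n!/(2n)!` turn the
coefficients of the formal solution into even Taylor coefficients, so the modified Borel transform
is `(φ(z+√s) + φ(z-√s))/2`. For the entire part of the datum this is entire in `s`, of exponential
order one. A pole `a/(x-p)` contributes `a(z-p)/((z-p)²-s)`, singular only at `s = (z-p)²`. At `z =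
0` the singularities are the points `p²`, so a direction `d` is singular exactly when some pole lies
on the line of direction `d/2` through `0` (`summableIn_of_side_ne_zero`,
`not_summableIn_of_side_eq_zero`). The squares `p²` are distinct because all arguments lie in `[0,
π)`, so no two singularities cancel.

The Ecalle kernel is a Gaussian, `C₂(τ) = π^(-1/2) exp(-τ²/4)` (`kernelC_two`), hence the 1-sum is
the heat integral. On the ray `arg t = θ` the substitution `s = w x` splits it. The entire part
becomes `heatFlow`, holomorphic near `w = 0` and independent of `θ`. Each pole becomes a Cauchy
integral of a Gaussian, which equals `σ/w * plasma(σ(p-z)/w)`, where `plasma` is entire and the sign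
`σ` tells on which side of the path the pole lies. So the 1-sum depends on `θ` only through the
vector of signs, is continued explicitly by `stokesSum`, and is constant as `θ` moves between
consecutive singular directions.

Three properties of `plasma` give the rest. Its differential equation `plasma' = -(1 + ζ plasma)/2`
yields the heat equation. The asymptotics `ζ plasma(ζ) → -1`, valid beyond the upper half-plane
after a rotation of the path, yields the initial values on the sectors `V_k`. The identity
`plasma(ζ) + plasma(-ζ) = i√π exp(-ζ²/4)` yields the jumps: crossing a Stokes line flips exactly the
signs of the poles of that direction.

Distinct sums have distinct sign vectors, and their difference is a combination of exponentials in
`z` with distinct exponents, hence not zero (`stokesSum_ne`). Maximality follows from the uniqueness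
of 1-sums (`IsOneSum.eqOn`), by the identity theorem for the Borel transform and then for the sums.
-/

theorem hasFDerivAt_integral_of_bounded {E α : Type*} [NormedAddCommGroup E] [NormedSpace ℂ E]
    [MeasurableSpace α] {μ : Measure α} {F : E → α → ℂ} {F' : E → α → E →L[ℂ] ℂ} {x₀ : E} {r : ℝ}
    {bound : α → ℝ} (hr : 0 < r)
    (hF : ∀ x ∈ Metric.ball x₀ r, AEStronglyMeasurable (F x) μ)
    (hF' : AEStronglyMeasurable (F' x₀) μ)
    (hb : ∀ᵐ a ∂μ, ∀ x ∈ Metric.ball x₀ r, ‖F x a‖ ≤ bound a) (hbi : Integrable bound μ)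
    (hd : ∀ᵐ a ∂μ, ∀ x ∈ Metric.ball x₀ r, HasFDerivAt (F · a) (F' x a) x) :
    HasFDerivAt (fun x => ∫ a, F x a ∂μ) (∫ a, F' x₀ a ∂μ) x₀ := by
  have hsub : ∀ x ∈ Metric.ball x₀ (r / 2), Metric.ball x (r / 2) ⊆ Metric.ball x₀ r := by
    intro x hx
    apply Metric.ball_subset_ball'
    have := Metric.mem_ball.1 hx
    linarith
  -- Cauchy's estimate on balls of half the radius bounds the derivative by the integrand itself, so
  -- only `F` has to be dominated, never `F'`.
  refine hasFDerivAt_integral_of_dominated_of_fderiv_le (F' := F')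
    (bound := fun a => (2 * bound a) / (r / 2))
    (Metric.ball_mem_nhds x₀ (half_pos hr)) ?_ ?_ hF' ?_ ?_ ?_
  · filter_upwards [Metric.ball_mem_nhds x₀ hr] with x hx using hF x hx
  · exact hbi.mono' (hF x₀ (Metric.mem_ball_self hr))
      (hb.mono fun a h => h x₀ (Metric.mem_ball_self hr))
  · filter_upwards [hb, hd] with a hba hda x hx
    have hx' : x ∈ Metric.ball x₀ r := hsub x hx (Metric.mem_ball_self (half_pos hr))
    rw [← (hda x hx').fderiv]
    apply Complex.norm_fderiv_le_div_of_mapsTo_ball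
    · intro y hy
      exact (hda y (hsub x hx hy)).differentiableAt.differentiableWithinAt
    · intro y hy
      rw [Metric.mem_closedBall, dist_eq_norm]
      calc ‖F y a - F x a‖ ≤ ‖F y a‖ + ‖F x a‖ := norm_sub_le _ _
        _ ≤ 2 * bound a := by linarith [hba y (hsub x hx hy), hba x hx']
    · exact half_pos hr
  · exact (hbi.const_mul 2).div_const _
  · filter_upwards [hd] with a hda x hx
    exact hda x (hsub x hx (Metric.mem_ball_self (half_pos hr)))

/-- The same Cauchy estimate in one variable. The integrability of the derivative is kept, because
later integrations by parts need it. -/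
theorem hasDerivAt_integral_of_bounded {α : Type*}
    [MeasurableSpace α] {μ : Measure α} {F : ℂ → α → ℂ} {F' : ℂ → α → ℂ} {x₀ : ℂ} {r : ℝ}
    {bound : α → ℝ} (hr : 0 < r)
    (hF : ∀ x ∈ Metric.ball x₀ r, AEStronglyMeasurable (F x) μ)
    (hF' : AEStronglyMeasurable (F' x₀) μ)
    (hb : ∀ᵐ a ∂μ, ∀ x ∈ Metric.ball x₀ r, ‖F x a‖ ≤ bound a) (hbi : Integrable bound μ)
    (hd : ∀ᵐ a ∂μ, ∀ x ∈ Metric.ball x₀ r, HasDerivAt (F · a) (F' x a) x) :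
    Integrable (F' x₀) μ ∧ HasDerivAt (fun x => ∫ a, F x a ∂μ) (∫ a, F' x₀ a ∂μ) x₀ := by
  have hsub : ∀ x ∈ Metric.ball x₀ (r / 2), Metric.ball x (r / 2) ⊆ Metric.ball x₀ r := by
    intro x hx
    apply Metric.ball_subset_ball'
    have := Metric.mem_ball.1 hx
    linarith
  refine hasDerivAt_integral_of_dominated_loc_of_deriv_le (F' := F')
    (bound := fun a => (2 * bound a) / (r / 2))
    (Metric.ball_mem_nhds x₀ (half_pos hr)) ?_ ?_ hF' ?_ ?_ ?_
  · filter_upwards [Metric.ball_mem_nhds x₀ hr] with x hx using hF x hx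
  · exact hbi.mono' (hF x₀ (Metric.mem_ball_self hr))
      (hb.mono fun a h => h x₀ (Metric.mem_ball_self hr))
  · filter_upwards [hb, hd] with a hba hda x hx
    have hx' : x ∈ Metric.ball x₀ r := hsub x hx (Metric.mem_ball_self (half_pos hr))
    rw [← (hda x hx').deriv]
    apply Complex.norm_deriv_le_div_of_mapsTo_ball
    · intro y hy
      exact (hda y (hsub x hx hy)).differentiableAt.differentiableWithinAt
    · intro y hy
      rw [Metric.mem_closedBall, dist_eq_norm]
      calc ‖F y a - F x a‖ ≤ ‖F y a‖ + ‖F x a‖ := norm_sub_le _ _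
        _ ≤ 2 * bound a := by linarith [hba y (hsub x hx hy), hba x hx']
    · exact half_pos hr
  · exact (hbi.const_mul 2).div_const _
  · filter_upwards [hd] with a hda x hx
    exact hda x (hsub x hx (Metric.mem_ball_self (half_pos hr)))

/-! ### Gaussian integrals over the half-line -/

theorem integrable_exp_linear_sub_sq (M : ℝ) {b : ℝ} (hb : 0 < b) :
    Integrable (fun x : ℝ => Real.exp (M * x - b * x ^ 2)) := by
  have h := (integrable_cexp_quadratic (b := (b : ℂ)) (by simpa using hb) (M : ℂ) 0).norm
  refine h.congr (Eventually.of_forall fun x => ?_)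
  simp only [Complex.norm_exp]
  congr 1
  have : (-(b : ℂ) * (x : ℂ) ^ 2 + (M : ℂ) * (x : ℂ) + 0) = ((-b * x ^ 2 + M * x : ℝ) : ℂ) := by
    push_cast; ring
  rw [this, Complex.ofReal_re]; ring

/-- The integrand `exp (-A τ - B τ²)`. -/
noncomputable def gaussExp (A B : ℂ) (τ : ℝ) : ℂ := Complex.exp (-A * τ - B * τ ^ 2)

theorem norm_gaussExp (A B : ℂ) (τ : ℝ) :
    ‖gaussExp A B τ‖ = Real.exp (-A.re * τ - B.re * τ ^ 2) := by
  rw [gaussExp, Complex.norm_exp]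
  congr 1
  have : ((τ : ℂ) ^ 2) = ((τ ^ 2 : ℝ) : ℂ) := by push_cast; ring
  rw [this, Complex.sub_re, Complex.re_mul_ofReal, Complex.re_mul_ofReal, Complex.neg_re]

theorem continuous_gaussExp (A B : ℂ) : Continuous (gaussExp A B) := by
  unfold gaussExp; fun_prop

theorem integrableOn_pow_mul_gaussExp (k : ℕ) (A : ℂ) {B : ℂ} (hB : 0 < B.re) :
    IntegrableOn (fun τ : ℝ => (τ : ℂ) ^ k * gaussExp A B τ) (Ioi 0) := by
  have h1 := ((integrable_exp_linear_sub_sq (1 - A.re) hB).const_mul (k.factorial : ℝ)).integrableOn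
    (s := Ioi 0)
  refine Integrable.mono' h1 (by have := continuous_gaussExp A B; fun_prop) ?_
  filter_upwards [self_mem_ae_restrict measurableSet_Ioi] with τ hτ
  have hτ : 0 < τ := hτ
  rw [norm_mul, norm_pow, norm_gaussExp, Complex.norm_real, Real.norm_of_nonneg hτ.le]
  -- The polynomial factor is absorbed by raising the linear coefficient of the exponent by one.
  have h2 : τ ^ k ≤ k.factorial * Real.exp τ := by
    have := Real.pow_div_factorial_le_exp τ hτ.le k
    rw [div_le_iff₀ (by positivity)] at this
    linarith
  calc τ ^ k * Real.exp (-A.re * τ - B.re * τ ^ 2)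
      ≤ (k.factorial * Real.exp τ) * Real.exp (-A.re * τ - B.re * τ ^ 2) := by gcongr
    _ = _ := by rw [mul_assoc, ← Real.exp_add]; ring_nf

theorem integrableOn_gaussExp (A : ℂ) {B : ℂ} (hB : 0 < B.re) :
    IntegrableOn (gaussExp A B) (Ioi 0) := by
  simpa using integrableOn_pow_mul_gaussExp 0 A hB

theorem hasDerivAt_gaussExp (A B : ℂ) (τ : ℝ) :
    HasDerivAt (gaussExp A B) ((-A - 2 * B * τ) * gaussExp A B τ) τ := by
  have h : HasDerivAt (fun z : ℂ => Complex.exp (-A * z - B * z ^ 2))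
      (Complex.exp (-A * τ - B * (τ : ℂ) ^ 2) * (-A * 1 - B * (2 * (τ : ℂ) ^ 1))) (τ : ℂ) := by
    have := (((hasDerivAt_id (τ : ℂ)).const_mul (-A)).sub
      (((hasDerivAt_id (τ : ℂ)).pow 2).const_mul B)).cexp
    simpa using this
  have := h.comp_ofReal
  unfold gaussExp
  convert! this using 1
  ring

/-- `∫ τ exp (-A τ - B τ²) dτ` in terms of `∫ exp (-A τ - B τ²) dτ`. -/
theorem integral_mul_gaussExp (A : ℂ) {B : ℂ} (hB : 0 < B.re) :
    2 * B * ∫ τ in Ioi (0 : ℝ), (τ : ℂ) * gaussExp A B τ =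
      1 - A * ∫ τ in Ioi (0 : ℝ), gaussExp A B τ := by
  have hi1 : IntegrableOn (fun τ : ℝ => (τ : ℂ) * gaussExp A B τ) (Ioi 0) := by
    simpa using integrableOn_pow_mul_gaussExp 1 A hB
  have hi0 := integrableOn_gaussExp A hB
  have hi : IntegrableOn (fun τ : ℝ => (-A - 2 * B * τ) * gaussExp A B τ) (Ioi 0) := by
    refine ((hi0.const_mul (-A)).sub (hi1.const_mul (2 * B))).congr
      (Eventually.of_forall fun τ => ?_)
    simp; ring
  have hlim := tendsto_zero_of_hasDerivAt_of_integrableOn_Ioi (a := 0)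
    (fun x _ => hasDerivAt_gaussExp A B x) hi hi0
  have := integral_Ioi_of_hasDerivAt_of_tendsto' (a := 0)
    (fun x _ => hasDerivAt_gaussExp A B x) hi hlim
  have h2 : ∫ τ in Ioi (0 : ℝ), (-A - 2 * B * τ) * gaussExp A B τ =
      -A * (∫ τ in Ioi (0 : ℝ), gaussExp A B τ) -
        2 * B * ∫ τ in Ioi (0 : ℝ), (τ : ℂ) * gaussExp A B τ := by
    rw [← integral_const_mul, ← integral_const_mul, ← integral_sub (hi0.const_mul _)
      (hi1.const_mul _)]
    congr 1; ext τ; ring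
  rw [h2] at this
  have h0 : gaussExp A B 0 = 1 := by simp [gaussExp]
  rw [h0] at this
  linear_combination -this

theorem hasDerivAt_integral_gaussExp (A : ℂ) {B : ℂ} (hB : 0 < B.re) :
    HasDerivAt (fun A => ∫ τ in Ioi (0 : ℝ), gaussExp A B τ)
      (-∫ τ in Ioi (0 : ℝ), (τ : ℂ) * gaussExp A B τ) A := by
  rw [← integral_neg]
  refine (hasDerivAt_integral_of_bounded (F := fun A τ => gaussExp A B τ) (F' := fun A τ => -(τ * gaussExp A B τ)) (r := 1)
    (bound := fun τ => Real.exp ((‖A‖ + 1) * τ - B.re * τ ^ 2)) one_pos ?_ ?_ ?_ ?_ ?_).2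
  · intro x _; exact (continuous_gaussExp x B).aestronglyMeasurable
  · have := continuous_gaussExp A B
    fun_prop
  · filter_upwards [self_mem_ae_restrict measurableSet_Ioi] with τ hτ x hx
    have hτ : 0 < τ := hτ
    rw [norm_gaussExp]
    have h1 : -x.re ≤ ‖A‖ + 1 := by
      have h2 := Metric.mem_ball.1 hx
      rw [dist_eq_norm] at h2
      have h3 := Complex.abs_re_le_norm x
      have h4 : ‖x‖ ≤ ‖A‖ + ‖x - A‖ := by simpa using norm_add_le A (x - A)
      linarith [neg_abs_le x.re]
    gcongr
  · exact (integrable_exp_linear_sub_sq _ hB).integrableOn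
  · refine Eventually.of_forall fun τ x _ => ?_
    have := (((hasDerivAt_id x).neg.mul_const (τ : ℂ)).sub_const (B * τ ^ 2)).cexp
    unfold gaussExp
    convert! this using 1
    simp only [Pi.neg_apply, id]
    ring

/-! ### The function `i ∫ exp (i ζ τ - τ²) dτ` -/

/-- The entire function `i ∫_0^∞ exp (i ζ τ - τ²) dτ`, which for `Im ζ > 0` is a Cauchy integral of
a Gaussian function. -/
noncomputable def plasma (ζ : ℂ) : ℂ :=
  Complex.I * ∫ τ in Ioi (0 : ℝ), gaussExp (-Complex.I * ζ) 1 τ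

/-- Differentiating under the integral produces a factor `τ`, which the integration by parts
`integral_mul_gaussExp` removes. This differential equation is what makes the pole contributions
solve the heat equation. -/
theorem hasDerivAt_plasma (ζ : ℂ) : HasDerivAt plasma (-(1 + ζ * plasma ζ) / 2) ζ := by
  have h1 := hasDerivAt_integral_gaussExp (-Complex.I * ζ) (B := 1) (by simp)
  have h2 := (h1.comp ζ ((hasDerivAt_id ζ).const_mul (-Complex.I))).const_mul Complex.I
  have h3 := integral_mul_gaussExp (-Complex.I * ζ) (B := 1) (by simp)
  unfold plasma
  convert! h2 using 1
  linear_combination (1 / 2 : ℂ) * h3 - (∫ τ in Ioi (0 : ℝ), (τ : ℂ) * gaussExp (-Complex.I * ζ) 1 τ) * Complex.I_mul_I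

theorem differentiable_plasma : Differentiable ℂ plasma :=
  fun ζ => (hasDerivAt_plasma ζ).differentiableAt

/-- Changing the sign of `ζ` reflects the half-line, so the two integrals glue to a full Gaussian
integral. This is the source of every jump. -/
theorem plasma_add_plasma_neg (ζ : ℂ) :
    plasma ζ + plasma (-ζ) = Complex.I * (Real.sqrt π : ℂ) * Complex.exp (-ζ ^ 2 / 4) := by
  have hI : ∫ τ : ℝ, gaussExp (-Complex.I * ζ) 1 τ =
      (Real.sqrt π : ℂ) * Complex.exp (-ζ ^ 2 / 4) := by
    have := integral_cexp_quadratic (b := -1) (by simp) (Complex.I * ζ) 0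
    simp only [neg_neg, div_one, gaussExp] at this ⊢
    rw [show (Real.sqrt π : ℂ) = (π : ℂ) ^ (1 / 2 : ℂ) by
      rw [Real.sqrt_eq_rpow, Complex.ofReal_cpow Real.pi_pos.le]; push_cast; rfl]
    convert! this using 2
    · ext x; congr 1; ring
    · congr 1; rw [mul_pow, Complex.I_sq]; ring
  have hint : Integrable (gaussExp (-Complex.I * ζ) 1) := by
    have := integrable_cexp_quadratic (b := 1) (by simp) (Complex.I * ζ) 0
    refine this.congr (Eventually.of_forall fun x => ?_)
    simp only [gaussExp]; congr 1; ring
  have hneg : ∫ τ in Ioi (0 : ℝ), gaussExp (-Complex.I * -ζ) 1 τ =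
      ∫ τ in Iic (0 : ℝ), gaussExp (-Complex.I * ζ) 1 τ := by
    rw [← neg_zero, ← integral_comp_neg_Iic]
    simp only [neg_zero]
    congr 1; ext τ; simp [gaussExp]
  rw [plasma, plasma, hneg, ← mul_add, add_comm, intervalIntegral.integral_Iic_add_Ioi
    hint.integrableOn hint.integrableOn, hI]
  ring

/-- Rotation of the path of integration. -/
theorem plasma_eq_rotate (ζ : ℂ) {c : ℂ} (hc : |c.im| < c.re) :
    plasma ζ = Complex.I * (c * ∫ τ in Ioi (0 : ℝ), gaussExp (-Complex.I * ζ * c) (c ^ 2) τ) := by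
  -- The rotated integral is studied as a function of `c` on the convex sector `|arg c| < π/4`,
  -- where `Re c² > 0` ensures convergence. Its derivative is shown to vanish, which replaces a
  -- contour argument.
  set Φ : ℂ → ℂ := fun c => ∫ τ in Ioi (0 : ℝ), c * gaussExp (-Complex.I * ζ * c) (c ^ 2) τ with hΦ
  set S : Set ℂ := {c | |c.im| < c.re} with hS
  have hre : ∀ c ∈ S, 0 < (c ^ 2).re := by
    intro c hc
    have hc : |c.im| < c.re := hc
    rw [pow_two, Complex.mul_re]
    have := abs_lt.1 hc
    nlinarith
  have hopen : IsOpen S := isOpen_lt (by fun_prop) (by fun_prop)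
  have hconv : Convex ℝ S := by
    intro x hx y hy a b ha hb hab
    have hx : |x.im| < x.re := hx
    have hy : |y.im| < y.re := hy
    change |(a • x + b • y).im| < (a • x + b • y).re
    simp only [Complex.add_im, Complex.add_re, Complex.real_smul, Complex.re_ofReal_mul,
      Complex.im_ofReal_mul]
    rw [abs_lt] at *
    rcases eq_or_lt_of_le ha with h0 | h0
    · have : b = 1 := by linarith
      subst this; subst h0; constructor <;> linarith
    · constructor <;> nlinarith
  have hderiv : ∀ c ∈ S, HasDerivAt Φ 0 c := by
    intro c hc
    have hcont : Continuous fun c : ℂ => (c ^ 2).re := by fun_prop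
    have h2 : ∀ᶠ c' in 𝓝 c, (c ^ 2).re / 2 < (c' ^ 2).re :=
      hcont.continuousAt.eventually (lt_mem_nhds (by linarith [hre c hc]))
    obtain ⟨r, hr, hball⟩ := Metric.eventually_nhds_iff_ball.1 h2
    have hfd : ∀ (τ : ℝ) (x : ℂ), HasDerivAt (fun x => x * gaussExp (-Complex.I * ζ * x) (x ^ 2) τ)
        ((1 + τ * (Complex.I * ζ * x - 2 * x ^ 2 * τ)) * gaussExp (-Complex.I * ζ * x) (x ^ 2) τ)
        x := by
      intro τ x
      have h1 := (((hasDerivAt_id x).const_mul (-Complex.I * ζ)).neg.mul_const (τ : ℂ)).sub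
        (((hasDerivAt_id x).pow 2).mul_const ((τ : ℂ) ^ 2))
      have h2 := (hasDerivAt_id x).mul h1.cexp
      unfold gaussExp
      convert! h2 using 1
      simp
      ring
    have hcg := continuous_gaussExp
    have key := hasDerivAt_integral_of_bounded
      (μ := volume.restrict (Ioi (0 : ℝ)))
      (F := fun x τ => x * gaussExp (-Complex.I * ζ * x) (x ^ 2) τ)
      (F' := fun x τ => (1 + τ * (Complex.I * ζ * x - 2 * x ^ 2 * τ)) *
        gaussExp (-Complex.I * ζ * x) (x ^ 2) τ) (x₀ := c) hr
      (bound := fun τ => (‖c‖ + r) *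
        Real.exp ((‖ζ‖ * (‖c‖ + r)) * τ - (c ^ 2).re / 2 * τ ^ 2))
      (fun x _ => by have := hcg (-Complex.I * ζ * x) (x ^ 2); fun_prop)
      (by have := hcg (-Complex.I * ζ * c) (c ^ 2); fun_prop)
      (by
        filter_upwards [self_mem_ae_restrict measurableSet_Ioi] with τ hτ x hx
        have hτ : 0 < τ := hτ
        have hxn : ‖x‖ ≤ ‖c‖ + r := by
          have h2 := Metric.mem_ball.1 hx
          rw [dist_eq_norm] at h2
          have h4 : ‖x‖ ≤ ‖c‖ + ‖x - c‖ := by simpa using norm_add_le c (x - c)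
          linarith
        rw [norm_mul, norm_gaussExp]
        have h1 : -(-Complex.I * ζ * x).re ≤ ‖ζ‖ * (‖c‖ + r) := by
          have h3 := Complex.abs_re_le_norm (-Complex.I * ζ * x)
          rw [norm_mul, norm_mul, norm_neg, Complex.norm_I, one_mul] at h3
          have : ‖ζ‖ * ‖x‖ ≤ ‖ζ‖ * (‖c‖ + r) := by gcongr
          linarith [neg_abs_le (-Complex.I * ζ * x).re]
        have h5 := (hball x hx).le
        gcongr)
      (((integrable_exp_linear_sub_sq _ (by linarith [hre c hc])).integrableOn).const_mul _)
      (Eventually.of_forall fun τ x _ => hfd τ x)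
    -- The derivative in `c` of `c * G(cτ)` is also the derivative in `τ` of `τ * G(cτ)`, so its
    -- integral is a boundary term, zero at both ends.
    have hprim : ∀ τ : ℝ, HasDerivAt (fun τ : ℝ => (τ : ℂ) * gaussExp (-Complex.I * ζ * c) (c ^ 2) τ)
        ((1 + τ * (Complex.I * ζ * c - 2 * c ^ 2 * τ)) * gaussExp (-Complex.I * ζ * c) (c ^ 2) τ)
        τ := by
      intro τ
      have h2 := (hasDerivAt_id (τ : ℂ)).comp_ofReal.mul
        (hasDerivAt_gaussExp (-Complex.I * ζ * c) (c ^ 2) τ)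
      convert! h2 using 1
      simp
      ring
    have hi1 : IntegrableOn (fun τ : ℝ => (τ : ℂ) * gaussExp (-Complex.I * ζ * c) (c ^ 2) τ)
        (Ioi 0) := by
      simpa using integrableOn_pow_mul_gaussExp 1 (-Complex.I * ζ * c) (hre c hc)
    have hlim := tendsto_zero_of_hasDerivAt_of_integrableOn_Ioi (a := 0)
      (fun x _ => hprim x) key.1 hi1
    have h0 := integral_Ioi_of_hasDerivAt_of_tendsto' (a := 0) (fun x _ => hprim x) key.1 hlim
    have := key.2
    simp only [Complex.ofReal_zero, zero_mul, sub_zero] at h0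
    rwa [h0] at this
  have hconst : Φ c = Φ 1 := by
    refine hconv.is_const_of_fderivWithin_eq_zero (𝕜 := ℂ)
      (fun x hx => (hderiv x hx).differentiableAt.differentiableWithinAt) ?_ hc
      (by simp [hS])
    intro x hx
    rw [fderivWithin_of_isOpen hopen hx]
    ext
    simp [(hderiv x hx).deriv]
  rw [← integral_const_mul]
  change _ = Complex.I * Φ c
  rw [hconst]
  simp [hΦ, plasma]

/-- On the rotated path, dropping the quadratic term of the exponent leaves a Laplace integral whose
contribution is exactly `-1`. The error is governed by `|exp(-c²τ²) - 1| ≤ τ²` and `∫ τ² exp(-Aτ) dτ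
= 2/A³` for real `A > 0`. The freedom in `c` extends the estimate beyond the upper half-plane, as
needed for sectors in `t` of opening greater than `π`. -/
theorem plasma_asymptotics {ζ c : ℂ} (hc1 : ‖c‖ = 1) (hc : |c.im| < c.re) (hζ : 0 < (ζ * c).im) :
    ‖ζ * plasma ζ + 1‖ ≤ 2 * ‖ζ‖ / (ζ * c).im ^ 3 := by
  set A : ℂ := -Complex.I * ζ * c with hA
  have hAre : A.re = (ζ * c).im := by
    rw [hA, mul_assoc]; simp [Complex.mul_re, Complex.mul_im]
  have hAn : ‖A‖ = ‖ζ‖ := by rw [hA]; simp [hc1]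
  have hB : 0 < (c ^ 2).re := by
    rw [pow_two, Complex.mul_re]
    have := abs_lt.1 hc
    nlinarith
  have hA0 : 0 < A.re := by rw [hAre]; exact hζ
  have e1 : ζ * plasma ζ = -A * ∫ τ in Ioi (0 : ℝ), gaussExp A (c ^ 2) τ := by
    rw [plasma_eq_rotate ζ hc, hA]; ring
  have hexp : ∫ τ in Ioi (0 : ℝ), Complex.exp (-A * τ) = 1 / A := by
    rw [integral_exp_mul_complex_Ioi (by simpa using hA0)]; simp
  have hAne : A ≠ 0 := by rintro h; rw [h] at hA0; simp at hA0
  have hint : IntegrableOn (fun τ : ℝ => Complex.exp (-A * τ)) (Ioi 0) :=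
    integrableOn_exp_mul_complex_Ioi (by simpa using hA0) 0
  have e2 : ζ * plasma ζ + 1 =
      -A * ∫ τ in Ioi (0 : ℝ), (gaussExp A (c ^ 2) τ - Complex.exp (-A * τ)) := by
    rw [integral_sub (integrableOn_gaussExp A hB) hint, hexp, e1]
    field_simp
    ring
  have hc2 : ‖c ^ 2‖ = 1 := by simp [hc1]
  have hbound : ‖∫ τ in Ioi (0 : ℝ), (gaussExp A (c ^ 2) τ - Complex.exp (-A * τ))‖ ≤
      ∫ τ in Ioi (0 : ℝ), τ ^ (2 : ℕ) * Real.exp (-(A.re * τ)) := by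
    have hgi : IntegrableOn (fun τ : ℝ => τ ^ (2 : ℕ) * Real.exp (-(A.re * τ))) (Ioi 0) := by
      have := integrableOn_rpow_mul_exp_neg_mul_rpow (s := 2) (p := 1) (by norm_num) one_pos hA0
      refine this.congr_fun (fun τ _ => ?_) measurableSet_Ioi
      simp
    refine norm_integral_le_of_norm_le hgi ?_
    filter_upwards [self_mem_ae_restrict measurableSet_Ioi] with τ hτ
    have hτ : 0 < τ := hτ
    have e3 : gaussExp A (c ^ 2) τ - Complex.exp (-A * τ) =
        Complex.exp (-A * τ) * (Complex.exp (-(c ^ 2 * τ ^ 2)) - 1) := by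
      rw [mul_sub, ← Complex.exp_add, gaussExp, mul_one]; ring_nf
    rw [e3, norm_mul, Complex.norm_exp]
    have e4 : (-A * (τ : ℂ)).re = -(A.re * τ) := by simp
    have hre2 : (-(c ^ 2 * (τ : ℂ) ^ 2)).re ≤ 0 := by
      rw [show (τ : ℂ) ^ 2 = ((τ ^ 2 : ℝ) : ℂ) by push_cast; ring]
      simp only [Complex.neg_re, Complex.re_mul_ofReal]
      have := mul_pos hB (pow_pos hτ 2)
      linarith
    have e5 : ‖Complex.exp (-(c ^ 2 * (τ : ℂ) ^ 2)) - 1‖ ≤ τ ^ 2 := by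
      -- Mean value inequality on the half-plane `Re ≤ 0`, where the exponential is 1-Lipschitz.
      have h := (convex_halfSpace_re_le 0).norm_image_sub_le_of_norm_deriv_le (𝕜 := ℂ)
        (f := Complex.exp) (C := 1) (x := 0) (y := -(c ^ 2 * (τ : ℂ) ^ 2))
        (fun x _ => Complex.differentiableAt_exp) (fun x hx => by
          rw [Complex.deriv_exp, Complex.norm_exp]
          exact Real.exp_le_one_iff.2 hx) (by simp) hre2
      rw [Complex.exp_zero, sub_zero, norm_neg, norm_mul, hc2] at h
      simpa using h
    rw [e4, mul_comm]
    gcongr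
  have hval : ∫ τ in Ioi (0 : ℝ), τ ^ (2 : ℕ) * Real.exp (-(A.re * τ)) = 2 / A.re ^ 3 := by
    have := Real.integral_rpow_mul_exp_neg_mul_Ioi (a := 3) (r := A.re) (by norm_num) hA0
    rw [show (3 : ℝ) = (2 : ℕ) + 1 by norm_num, Real.Gamma_nat_eq_factorial] at this
    simp only [add_sub_cancel_right, Real.rpow_natCast] at this
    rw [this, show ((2 : ℕ) + 1 : ℝ) = ((3 : ℕ) : ℝ) by norm_num, Real.rpow_natCast]
    norm_num; field_simp
  rw [e2, norm_mul, norm_neg, hAn, ← hAre]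
  calc ‖ζ‖ * _ ≤ ‖ζ‖ * (2 / A.re ^ 3) := by rw [← hval]; gcongr
    _ = _ := by ring

/-- For `Im ζ > 0` the function `plasma` is a Cauchy integral. -/
theorem plasma_eq_cauchy {ζ : ℂ} (hζ : 0 < ζ.im) :
    (Real.sqrt (4 * π) : ℂ) * plasma ζ =
      ∫ x : ℝ, Complex.exp (-(x : ℂ) ^ 2 / 4) / (x - ζ) := by
  -- Since `Im ζ > 0`, the Cauchy kernel is a Laplace integral, `1/(x-ζ) = i ∫ exp(i(ζ-x)τ) dτ` over
  -- `τ > 0`. After Fubini the integral in `x` is the Fourier transform of a Gaussian.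
  have hpt : ∀ x : ℝ, Complex.exp (-(x : ℂ) ^ 2 / 4) / (x - ζ) =
      ∫ τ in Ioi (0 : ℝ), Complex.I * (Complex.exp (-(x : ℂ) ^ 2 / 4) *
        Complex.exp (Complex.I * (ζ - x) * τ)) := by
    intro x
    rw [integral_const_mul, integral_const_mul,
      integral_exp_mul_complex_Ioi (by simp [Complex.mul_re]; exact hζ)]
    have h1 : (x : ℂ) - ζ ≠ 0 := by
      intro h
      have := congrArg Complex.im h
      simp at this; linarith
    have h2 : ζ - (x : ℂ) ≠ 0 := by rw [← neg_sub]; exact neg_ne_zero.2 h1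
    simp only [Complex.ofReal_zero, mul_zero, Complex.exp_zero]
    rw [show (x : ℂ) - ζ = -(ζ - x) by ring]
    field_simp [Complex.I_ne_zero]
  have hinner : ∀ τ : ℝ, ∫ x : ℝ, Complex.I * (Complex.exp (-(x : ℂ) ^ 2 / 4) *
        Complex.exp (Complex.I * (ζ - x) * τ)) =
      (Real.sqrt (4 * π) : ℂ) * (Complex.I * gaussExp (-Complex.I * ζ) 1 τ) := by
    intro τ
    have := integral_cexp_quadratic (b := -(1 / 4)) (by norm_num) (-Complex.I * τ)
      (Complex.I * ζ * τ)
    rw [integral_const_mul]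
    have e1 : ∀ x : ℝ, Complex.exp (-(x : ℂ) ^ 2 / 4) * Complex.exp (Complex.I * (ζ - x) * τ) =
        Complex.exp (-(1 / 4) * (x : ℂ) ^ 2 + -Complex.I * τ * x + Complex.I * ζ * τ) := by
      intro x; rw [← Complex.exp_add]; congr 1; ring
    simp_rw [e1]
    rw [this, show (Real.sqrt (4 * π) : ℂ) = (π / - -(1 / 4) : ℂ) ^ (1 / 2 : ℂ) by
      rw [Real.sqrt_eq_rpow, Complex.ofReal_cpow (by positivity)]; push_cast; congr 1
      ring]
    have e2 : Complex.I * ζ * τ - (-Complex.I * τ) ^ 2 / (4 * -(1 / 4)) =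
        -(-Complex.I * ζ) * τ - 1 * (τ : ℂ) ^ 2 := by
      rw [mul_pow, neg_sq, Complex.I_sq]; ring
    rw [e2, gaussExp]; ring
  have hprod : Integrable (Function.uncurry fun (x τ : ℝ) => Complex.I *
      (Complex.exp (-(x : ℂ) ^ 2 / 4) * Complex.exp (Complex.I * (ζ - x) * τ)))
      (volume.prod (volume.restrict (Ioi 0))) := by
    have h1 : Integrable (fun x : ℝ => Real.exp (-(1 / 4) * x ^ 2)) :=
      integrable_exp_neg_mul_sq (by norm_num)
    have h2 : Integrable (fun τ : ℝ => Real.exp (-ζ.im * τ)) (volume.restrict (Ioi 0)) :=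
      integrableOn_exp_mul_Ioi (by linarith) 0
    refine (h1.mul_prod h2).mono' ?_ (Eventually.of_forall fun q => ?_)
    · apply Continuous.aestronglyMeasurable
      unfold Function.uncurry
      fun_prop
    · simp only [Function.uncurry, norm_mul, Complex.norm_I, one_mul, Complex.norm_exp]
      refine le_of_eq ?_
      congr 2
      · rw [show -(q.1 : ℂ) ^ 2 / 4 = ((-(1 / 4) * q.1 ^ 2 : ℝ) : ℂ) by push_cast; ring,
          Complex.ofReal_re]
      · simp [Complex.mul_re]
  simp_rw [hpt]
  rw [integral_integral_swap hprod]
  simp_rw [hinner]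
  rw [integral_const_mul, integral_const_mul, plasma]

/-! ### The heat flow of an entire function of order two -/

/-- Cauchy's estimate on unit circles, with `(|x|+1)² ≤ 2|x|² + 2`. It lets the derivatives of a
heat flow in `z` be heat flows again. -/
theorem EntireGrowthTwo.deriv {f : ℂ → ℂ} (hf : EntireGrowthTwo f) : EntireGrowthTwo (deriv f) := by
  obtain ⟨hd, C₁, C₂, h1, h2, hb⟩ := hf
  refine ⟨hd.deriv, C₁ * Real.exp (2 * C₂), 2 * C₂, by positivity, by positivity, fun x => ?_⟩
  have := Complex.norm_deriv_le_of_forall_mem_sphere_norm_le (f := f) (c := x) (R := 1)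
    (C := C₁ * Real.exp (C₂ * (‖x‖ + 1) ^ 2)) one_pos hd.diffContOnCl (fun z hz => by
      refine (hb z).trans ?_
      have h3 : ‖z‖ ≤ ‖x‖ + 1 := by
        have h4 := mem_sphere_iff_norm.1 hz
        have h5 : ‖z‖ ≤ ‖x‖ + ‖z - x‖ := by simpa using norm_add_le x (z - x)
        linarith
      gcongr)
  refine this.trans ?_
  rw [div_one, mul_assoc, ← Real.exp_add]
  gcongr
  nlinarith [sq_nonneg (‖x‖ - 1), h2]

/-- The solution `(4 π t)^(-1/2) ∫ f(z + s) exp (-s² / (4 t)) ds` of the heat equation, at the point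
`w = √t`, after the substitution `s = w x`. -/
noncomputable def heatFlow (f : ℂ → ℂ) (w z : ℂ) : ℂ :=
  (Real.sqrt (4 * π) : ℂ)⁻¹ * ∫ x : ℝ, Complex.exp (-(x : ℂ) ^ 2 / 4) * f (z + w * x)

theorem norm_exp_neg_sq_div_four (x : ℝ) :
    ‖Complex.exp (-(x : ℂ) ^ 2 / 4)‖ = Real.exp (-(1 / 4) * x ^ 2) := by
  rw [Complex.norm_exp, show -(x : ℂ) ^ 2 / 4 = ((-(1 / 4) * x ^ 2 : ℝ) : ℂ) by push_cast; ring,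
    Complex.ofReal_re]

/-- By `|z+wx|² ≤ 2Z² + 2|w|²x²`, the condition on `w` lets the growth of `f` consume at most half
of the Gaussian exponent. The remaining bound is uniform in `w` and `z`, as domination requires. -/
theorem norm_heatFlow_integrand_le {f : ℂ → ℂ} {C₁ C₂ Z : ℝ} (h1 : 0 < C₁) (h2 : 0 < C₂)
    (hb : ∀ x, ‖f x‖ ≤ C₁ * Real.exp (C₂ * ‖x‖ ^ 2)) {w z : ℂ} (hw : 16 * C₂ * ‖w‖ ^ 2 < 1)
    (hz : ‖z‖ ≤ Z) (x : ℝ) :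
    ‖Complex.exp (-(x : ℂ) ^ 2 / 4) * f (z + w * x)‖ ≤
      C₁ * Real.exp (2 * C₂ * Z ^ 2) * Real.exp (-(1 / 8) * x ^ 2) := by
  rw [norm_mul, norm_exp_neg_sq_div_four]
  have h3 : ‖z + w * x‖ ≤ Z + ‖w‖ * |x| := by
    refine (norm_add_le _ _).trans ?_
    rw [norm_mul, Complex.norm_real, Real.norm_eq_abs]
    gcongr
  have h4 : ‖z + w * x‖ ^ 2 ≤ (Z + ‖w‖ * |x|) ^ 2 := by gcongr
  have h5 : (Z + ‖w‖ * |x|) ^ 2 ≤ 2 * Z ^ 2 + 2 * (‖w‖ ^ 2 * x ^ 2) := by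
    rw [← sq_abs x]
    nlinarith [sq_nonneg (Z - ‖w‖ * |x|)]
  calc _ ≤ Real.exp (-(1 / 4) * x ^ 2) * (C₁ * Real.exp (C₂ * ‖z + w * x‖ ^ 2)) := by
        gcongr; exact hb _
    _ = C₁ * Real.exp (-(1 / 4) * x ^ 2 + C₂ * ‖z + w * x‖ ^ 2) := by rw [Real.exp_add]; ring
    _ ≤ C₁ * Real.exp (2 * C₂ * Z ^ 2 + -(1 / 8) * x ^ 2) := by
        refine mul_le_mul_of_nonneg_left (Real.exp_le_exp.2 ?_) h1.le
        have h6 : C₂ * ‖z + w * x‖ ^ 2 ≤ C₂ * (2 * Z ^ 2 + 2 * (‖w‖ ^ 2 * x ^ 2)) := by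
          gcongr; exact h4.trans h5
        have h7 : 16 * C₂ * ‖w‖ ^ 2 * x ^ 2 ≤ 1 * x ^ 2 := by gcongr
        linarith
    _ = _ := by rw [Real.exp_add]; ring

section

variable {f : ℂ → ℂ} {C₁ C₂ : ℝ} (hf : Differentiable ℂ f) (h1 : 0 < C₁) (h2 : 0 < C₂)
  (hb : ∀ x, ‖f x‖ ≤ C₁ * Real.exp (C₂ * ‖x‖ ^ 2)) {w : ℂ} (hw : 16 * C₂ * ‖w‖ ^ 2 < 1) (z : ℂ)
include hf h1 h2 hb hw

theorem integrable_heatFlow_integrand :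
    Integrable (fun x : ℝ => Complex.exp (-(x : ℂ) ^ 2 / 4) * f (z + w * x)) := by
  refine ((integrable_exp_neg_mul_sq (b := 1 / 8) (by norm_num)).const_mul
    (C₁ * Real.exp (2 * C₂ * ‖z‖ ^ 2))).mono' ?_ (Eventually.of_forall fun x =>
      norm_heatFlow_integrand_le h1 h2 hb hw le_rfl x)
  have := hf.continuous
  fun_prop

theorem differentiableAt_heatFlow :
    DifferentiableAt ℂ (Function.uncurry (heatFlow f)) (w, z) := by
  have hc := hf.continuous
  have hc' := hf.contDiff.continuous_deriv (n := 1) le_rfl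
  have hev : ∀ᶠ q : ℂ × ℂ in 𝓝 (w, z), 16 * C₂ * ‖q.1‖ ^ 2 < 1 ∧ ‖q.2‖ < ‖z‖ + 1 := by
    apply Filter.Eventually.and
    · have : Continuous fun q : ℂ × ℂ => 16 * C₂ * ‖q.1‖ ^ 2 := by fun_prop
      exact this.continuousAt.eventually (gt_mem_nhds hw)
    · have : Continuous fun q : ℂ × ℂ => ‖q.2‖ := by fun_prop
      exact this.continuousAt.eventually (gt_mem_nhds (by simp))
  obtain ⟨r, hr, hball⟩ := Metric.eventually_nhds_iff_ball.1 hev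
  refine (DifferentiableAt.const_mul ?_ _ : DifferentiableAt ℂ (fun q : ℂ × ℂ =>
    (Real.sqrt (4 * π) : ℂ)⁻¹ * ∫ x : ℝ, Complex.exp (-(x : ℂ) ^ 2 / 4) * f (q.2 + q.1 * x)) (w, z))
  refine (hasFDerivAt_integral_of_bounded (E := ℂ × ℂ)
    (F := fun q (x : ℝ) => Complex.exp (-(x : ℂ) ^ 2 / 4) * f (q.2 + q.1 * x))
    (F' := fun q (x : ℝ) => (Complex.exp (-(x : ℂ) ^ 2 / 4) * _root_.deriv f (q.2 + q.1 * x)) •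
      (ContinuousLinearMap.snd ℂ ℂ ℂ + (x : ℂ) • ContinuousLinearMap.fst ℂ ℂ ℂ)) hr
    (bound := fun x : ℝ => C₁ * Real.exp (2 * C₂ * (‖z‖ + 1) ^ 2) * Real.exp (-(1 / 8) * x ^ 2))
    ?_ ?_ ?_ ?_ ?_).differentiableAt
  · intro q _; fun_prop
  · fun_prop
  · refine Eventually.of_forall fun x q hq => ?_
    exact norm_heatFlow_integrand_le h1 h2 hb (hball q hq).1 (hball q hq).2.le x
  · exact (integrable_exp_neg_mul_sq (by norm_num)).const_mul _
  · refine Eventually.of_forall fun x q _ => ?_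
    have hl : HasFDerivAt (fun q : ℂ × ℂ => q.2 + q.1 * (x : ℂ))
        (ContinuousLinearMap.snd ℂ ℂ ℂ + (x : ℂ) • ContinuousLinearMap.fst ℂ ℂ ℂ) q := by
      refine hasFDerivAt_snd.add ?_
      exact hasFDerivAt_fst.mul_const (x : ℂ)
    have := (((hf (q.2 + q.1 * x)).hasDerivAt).comp_hasFDerivAt q hl).const_mul
      (Complex.exp (-(x : ℂ) ^ 2 / 4))
    convert! this using 1
    rw [smul_smul]

theorem hasDerivAt_heatFlow_snd :
    HasDerivAt (heatFlow f w) (heatFlow (deriv f) w z) z := by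
  have hc := hf.continuous
  have hc' := hf.contDiff.continuous_deriv (n := 1) le_rfl
  refine HasDerivAt.const_mul _ ?_
  refine (hasDerivAt_integral_of_bounded
    (F := fun z (x : ℝ) => Complex.exp (-(x : ℂ) ^ 2 / 4) * f (z + w * x))
    (F' := fun z (x : ℝ) => Complex.exp (-(x : ℂ) ^ 2 / 4) * _root_.deriv f (z + w * x)) one_pos
    (bound := fun x : ℝ => C₁ * Real.exp (2 * C₂ * (‖z‖ + 1) ^ 2) * Real.exp (-(1 / 8) * x ^ 2))
    ?_ ?_ ?_ ?_ ?_).2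
  · intro q _; fun_prop
  · fun_prop
  · refine Eventually.of_forall fun x q hq => ?_
    refine norm_heatFlow_integrand_le h1 h2 hb hw ?_ x
    have h4 := mem_ball_iff_norm.1 hq
    have h5 : ‖q‖ ≤ ‖z‖ + ‖q - z‖ := by simpa using norm_add_le z (q - z)
    linarith
  · exact (integrable_exp_neg_mul_sq (by norm_num)).const_mul _
  · refine Eventually.of_forall fun x q _ => ?_
    exact ((hf (q + w * x)).hasDerivAt.comp_add_const q (w * x)).const_mul _

theorem hasDerivAt_heatFlow_fst :
    Integrable (fun x : ℝ => Complex.exp (-(x : ℂ) ^ 2 / 4) * (deriv f (z + w * x) * x)) ∧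
    HasDerivAt (fun w => heatFlow f w z) ((Real.sqrt (4 * π) : ℂ)⁻¹ *
      ∫ x : ℝ, Complex.exp (-(x : ℂ) ^ 2 / 4) * (deriv f (z + w * x) * x)) w := by
  have hc := hf.continuous
  have hc' := hf.contDiff.continuous_deriv (n := 1) le_rfl
  have hev : ∀ᶠ q : ℂ in 𝓝 w, 16 * C₂ * ‖q‖ ^ 2 < 1 := by
    have : Continuous fun q : ℂ => 16 * C₂ * ‖q‖ ^ 2 := by fun_prop
    exact this.continuousAt.eventually (gt_mem_nhds hw)
  obtain ⟨r, hr, hball⟩ := Metric.eventually_nhds_iff_ball.1 hev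
  have key := hasDerivAt_integral_of_bounded
    (F := fun w (x : ℝ) => Complex.exp (-(x : ℂ) ^ 2 / 4) * f (z + w * x))
    (F' := fun w (x : ℝ) => Complex.exp (-(x : ℂ) ^ 2 / 4) * (_root_.deriv f (z + w * x) * x)) hr
    (bound := fun x : ℝ => C₁ * Real.exp (2 * C₂ * ‖z‖ ^ 2) * Real.exp (-(1 / 8) * x ^ 2))
    (μ := volume) (x₀ := w)
    (by intro q _; fun_prop) (by fun_prop)
    (Eventually.of_forall fun x q hq => norm_heatFlow_integrand_le h1 h2 hb (hball q hq) le_rfl x)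
    ((integrable_exp_neg_mul_sq (by norm_num)).const_mul _)
    (Eventually.of_forall fun x q _ => by
      have hl : HasDerivAt (fun w : ℂ => z + w * (x : ℂ)) x q := by
        simpa using ((hasDerivAt_id q).mul_const (x : ℂ)).const_add z
      exact ((hf (z + q * x)).hasDerivAt.comp q hl).const_mul _)
  exact ⟨key.1, key.2.const_mul _⟩

end

/-- The derivative in `w` brings down a factor `x`, and `x exp(-x²/4)` is the derivative of `-2
exp(-x²/4)`; one integration by parts gives `∂_w = 2w ∂_z²`, the heat equation in the coordinate
`w`. The disc includes `w = 0`, which later supplies the initial value. -/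
theorem heatFlow_regular {f : ℂ → ℂ} (hf : EntireGrowthTwo f) : ∃ r > 0, ∀ w : ℂ, ‖w‖ ^ 2 < r →
    ∀ z : ℂ, DifferentiableAt ℂ (Function.uncurry (heatFlow f)) (w, z) ∧
      HasDerivAt (heatFlow f w) (heatFlow (deriv f) w z) z ∧
      HasDerivAt (heatFlow (deriv f) w) (heatFlow (deriv (deriv f)) w z) z ∧
      HasDerivAt (fun w => heatFlow f w z) (2 * w * heatFlow (deriv (deriv f)) w z) w ∧
      Integrable (fun x : ℝ => Complex.exp (-(x : ℂ) ^ 2 / 4) * f (z + w * x)) := by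
  obtain ⟨hd, A₁, A₂, ha1, ha2, ha⟩ := hf
  obtain ⟨hd', B₁, B₂, hb1, hb2, hb⟩ := EntireGrowthTwo.deriv ⟨hd, A₁, A₂, ha1, ha2, ha⟩
  obtain ⟨hd'', D₁, D₂, hd1, hd2, hdb⟩ := EntireGrowthTwo.deriv ⟨hd', B₁, B₂, hb1, hb2, hb⟩
  -- The sum of the three growth constants serves `f`, `f'` and `f''` at once, independently of `z`.
  refine ⟨1 / (16 * (A₂ + B₂ + D₂)), by positivity, fun w hw z => ?_⟩
  rw [lt_div_iff₀ (by positivity)] at hw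
  have hw0 : 0 ≤ ‖w‖ ^ 2 := by positivity
  have wa : 16 * A₂ * ‖w‖ ^ 2 < 1 := by nlinarith [mul_nonneg hb2.le hw0, mul_nonneg hd2.le hw0]
  have wb : 16 * B₂ * ‖w‖ ^ 2 < 1 := by nlinarith [mul_nonneg ha2.le hw0, mul_nonneg hd2.le hw0]
  have wd : 16 * D₂ * ‖w‖ ^ 2 < 1 := by nlinarith [mul_nonneg ha2.le hw0, mul_nonneg hb2.le hw0]
  refine ⟨differentiableAt_heatFlow hd ha1 ha2 ha wa z, hasDerivAt_heatFlow_snd hd ha1 ha2 ha wa z,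
    hasDerivAt_heatFlow_snd hd' hb1 hb2 hb wb z, ?_, integrable_heatFlow_integrand hd ha1 ha2 ha wa z⟩
  obtain ⟨hi, h⟩ := hasDerivAt_heatFlow_fst hd ha1 ha2 ha wa z
  convert! h using 1
  have hi1 := integrable_heatFlow_integrand hd' hb1 hb2 hb wb z
  have hi2 := integrable_heatFlow_integrand hd'' hd1 hd2 hdb wd z
  have hu : ∀ x : ℝ, HasDerivAt (fun x : ℝ => -2 * Complex.exp (-(x : ℂ) ^ 2 / 4))
      (Complex.exp (-(x : ℂ) ^ 2 / 4) * x) x := by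
    intro x
    have := ((((hasDerivAt_id (x : ℂ)).pow 2).neg.div_const 4).cexp.const_mul (-2)).comp_ofReal
    convert! this using 1
    simp
    ring
  have hv : ∀ x : ℝ, HasDerivAt (fun x : ℝ => deriv f (z + w * x))
      (w * deriv (deriv f) (z + w * x)) x := by
    intro x
    have hl : HasDerivAt (fun x : ℂ => z + w * x) w (x : ℂ) := by
      simpa using ((hasDerivAt_id (x : ℂ)).const_mul w).const_add z
    have := ((hd' (z + w * x)).hasDerivAt.comp (x : ℂ) hl).comp_ofReal
    convert! this using 1
    ring
  have hparts := integral_mul_deriv_eq_deriv_mul_of_integrable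
    (u := fun x : ℝ => -2 * Complex.exp (-(x : ℂ) ^ 2 / 4))
    (v := fun x : ℝ => deriv f (z + w * x)) (fun x _ => hu x) (fun x _ => hv x)
    ((hi2.const_mul (-2 * w)).congr (Eventually.of_forall fun x => by simp; ring))
    (hi.congr (Eventually.of_forall fun x => by simp; ring))
    ((hi1.const_mul (-2)).congr (Eventually.of_forall fun x => by simp; ring))
  have e1 : ∫ x : ℝ, -2 * Complex.exp (-(x : ℂ) ^ 2 / 4) * (w * deriv (deriv f) (z + w * x)) =
      -2 * w * ∫ x : ℝ, Complex.exp (-(x : ℂ) ^ 2 / 4) * deriv (deriv f) (z + w * x) := by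
    rw [← integral_const_mul]; congr 1; ext x; ring
  have e2 : ∫ x : ℝ, Complex.exp (-(x : ℂ) ^ 2 / 4) * x * deriv f (z + w * x) =
      ∫ x : ℝ, Complex.exp (-(x : ℂ) ^ 2 / 4) * (deriv f (z + w * x) * x) := by
    congr 1; ext x; ring
  rw [e1, e2] at hparts
  rw [heatFlow]
  linear_combination (-(Real.sqrt (4 * π) : ℂ)⁻¹) * hparts

theorem integral_exp_neg_sq_div_four :
    ∫ x : ℝ, Complex.exp (-(x : ℂ) ^ 2 / 4) = (Real.sqrt (4 * π) : ℂ) := by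
  have := integral_gaussian_complex (b := 1 / 4) (by norm_num)
  rw [show (Real.sqrt (4 * π) : ℂ) = (π / (1 / 4) : ℂ) ^ (1 / 2 : ℂ) by
      rw [Real.sqrt_eq_rpow, Complex.ofReal_cpow (by positivity)]; push_cast; congr 1
      ring, ← this]
  congr 1; ext x; congr 1; ring

theorem sqrt_four_pi_ne_zero : (Real.sqrt (4 * π) : ℂ) ≠ 0 := by
  have : 0 < Real.sqrt (4 * π) := by positivity
  exact_mod_cast this.ne'

theorem heatFlow_zero (f : ℂ → ℂ) (z : ℂ) : heatFlow f 0 z = f z := by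
  simp only [heatFlow, zero_mul, add_zero]
  rw [integral_mul_const, integral_exp_neg_sq_div_four, inv_mul_cancel_left₀ sqrt_four_pi_ne_zero]

/-! ### The contribution of a pole -/

/-- The function `(4 π t)^(-1/2) ∫ exp (-s² / (4 t)) / (z + s - p) ds`, continued analytically in
`w = √t ≠ 0`; the sign `σ` says on which side of the pole the path of integration passes. -/
noncomputable def poleFlow (σ p w z : ℂ) : ℂ := σ / w * plasma (σ * (p - z) / w)

section

variable {σ w : ℂ} (hσ : σ ^ 2 = 1) (hw : w ≠ 0) (p z : ℂ)

include hw in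
theorem differentiableAt_poleFlow :
    DifferentiableAt ℂ (Function.uncurry (poleFlow σ p)) (w, z) := by
  have hp := differentiable_plasma
  have hinv : DifferentiableAt ℂ (fun q : ℂ × ℂ => q.1⁻¹) (w, z) :=
    (differentiableAt_fst (p := (w, z))).inv hw
  have h1 : DifferentiableAt ℂ (fun q : ℂ × ℂ => σ * q.1⁻¹) (w, z) := hinv.const_mul σ
  have h2 : DifferentiableAt ℂ (fun q : ℂ × ℂ => σ * (p - q.2) * q.1⁻¹) (w, z) :=
    DifferentiableAt.mul (by fun_prop) hinv
  exact h1.mul ((hp _).comp (w, z) h2)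

/-- The derivative of `poleFlow` in `z`. -/
noncomputable def poleFlowDeriv (σ p w z : ℂ) : ℂ :=
  (1 + σ * (p - z) / w * plasma (σ * (p - z) / w)) / (2 * w ^ 2)

/-- The second derivative of `poleFlow` in `z`. -/
noncomputable def poleFlowDeriv2 (σ p w z : ℂ) : ℂ :=
  -σ / (2 * w ^ 3) * (plasma (σ * (p - z) / w) - σ * (p - z) / w *
    ((1 + σ * (p - z) / w * plasma (σ * (p - z) / w)) / 2))

theorem hasDerivAt_pole_arg : HasDerivAt (fun z => σ * (p - z) / w) (-σ / w) z := by
  have := ((((hasDerivAt_id z).const_sub p).const_mul σ).div_const w)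
  simpa using this

include hσ hw in
theorem hasDerivAt_poleFlow_snd : HasDerivAt (poleFlow σ p w) (poleFlowDeriv σ p w z) z := by
  have h := ((hasDerivAt_plasma (σ * (p - z) / w)).comp z (hasDerivAt_pole_arg p z)).const_mul
    (σ / w)
  convert! h using 1
  rw [poleFlowDeriv]
  field_simp
  linear_combination (-(w + σ * (p - z) * plasma (σ * (p - z) / w))) * hσ

include hw in
theorem hasDerivAt_poleFlowDeriv : HasDerivAt (poleFlowDeriv σ p w) (poleFlowDeriv2 σ p w z) z := by
  have h := (((hasDerivAt_pole_arg (σ := σ) (w := w) p z).mul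
    ((hasDerivAt_plasma (σ * (p - z) / w)).comp z (hasDerivAt_pole_arg p z))).const_add 1).div_const
    (2 * w ^ 2)
  convert! h using 1
  rw [poleFlowDeriv2]
  simp only [Function.comp]
  field_simp
  ring

include hw in
-- The differential equation of `plasma` expresses both sides through the same value of `plasma`;
-- the result is the heat equation `∂_w = 2w ∂_z²` for a pole.
theorem hasDerivAt_poleFlow_fst :
    HasDerivAt (fun w => poleFlow σ p w z) (2 * w * poleFlowDeriv2 σ p w z) w := by
  have h1 : HasDerivAt (fun w : ℂ => σ / w) (-σ / w ^ 2) w := by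
    simpa [div_eq_mul_inv] using (hasDerivAt_inv hw).const_mul σ
  have h2 : HasDerivAt (fun w : ℂ => σ * (p - z) / w) (-(σ * (p - z)) / w ^ 2) w := by
    simpa [div_eq_mul_inv] using (hasDerivAt_inv hw).const_mul (σ * (p - z))
  have h := h1.mul ((hasDerivAt_plasma (σ * (p - z) / w)).comp w h2)
  convert! h using 1
  rw [poleFlowDeriv2]
  simp only [Function.comp]
  field_simp
  ring

end

/-- The Cauchy integral jumps across the real axis. The sign selects the half-plane, and the lower
one is reduced to the upper one by `x ↦ -x`. In each case the value continues to an entire function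
of `ζ`. -/
theorem sign_mul_plasma_eq_cauchy {σ ζ : ℂ} (hσ : σ = 1 ∨ σ = -1) (hζ : 0 < (σ * ζ).im) :
    (Real.sqrt (4 * π) : ℂ) * (σ * plasma (σ * ζ)) =
      ∫ x : ℝ, Complex.exp (-(x : ℂ) ^ 2 / 4) / (x - ζ) := by
  rcases hσ with rfl | rfl
  · simpa using plasma_eq_cauchy hζ
  · have h := plasma_eq_cauchy hζ
    rw [← integral_neg_eq_self]
    rw [mul_left_comm, h, neg_one_mul, neg_one_mul, ← integral_neg]
    congr 1; ext x
    push_cast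
    rw [neg_sq, show -(x : ℂ) - ζ = -(x - -ζ) by ring, div_neg]

/-! ### Sectors on the Riemann surface of the square root -/

theorem pt_eq_exp {R : ℝ} (hR : 0 < R) (ψ : ℝ) :
    pt R ψ = Complex.exp ((Real.log R / 2 : ℝ) + (ψ / 2 : ℝ) * Complex.I) := by
  rw [Complex.exp_add, ← Complex.ofReal_exp, pt, Real.exp_half, Real.exp_log hR]
  congr 2
  push_cast; ring

theorem pt_sq {R : ℝ} (hR : 0 ≤ R) (ψ : ℝ) : pt R ψ ^ 2 = R * Complex.exp (Complex.I * ψ) := by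
  rw [pt, mul_pow, ← Complex.ofReal_pow, Real.sq_sqrt hR, ← Complex.exp_nat_mul]
  congr 2; push_cast; ring

theorem pt_ne_zero {R : ℝ} (hR : 0 < R) (ψ : ℝ) : pt R ψ ≠ 0 := by
  rw [pt_eq_exp hR]; exact Complex.exp_ne_zero _

theorem norm_exp_I_mul_half (ψ : ℝ) : ‖Complex.exp (Complex.I * ψ / 2)‖ = 1 := by
  rw [show Complex.I * ψ / 2 = ((ψ / 2 : ℝ) : ℂ) * Complex.I by push_cast; ring,
    Complex.norm_exp_ofReal_mul_I]

theorem norm_exp_I_mul (ψ : ℝ) : ‖Complex.exp (Complex.I * ψ)‖ = 1 := by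
  rw [mul_comm, Complex.norm_exp_ofReal_mul_I]

theorem norm_pt (R ψ : ℝ) : ‖pt R ψ‖ = Real.sqrt R := by
  rw [pt, norm_mul, norm_exp_I_mul_half, mul_one, Complex.norm_real,
    Real.norm_of_nonneg (Real.sqrt_nonneg _)]

theorem norm_pt_sq {R : ℝ} (hR : 0 ≤ R) (ψ : ℝ) : ‖pt R ψ‖ ^ 2 = R := by
  rw [norm_pt, Real.sq_sqrt hR]

theorem exp_half_add_int (ψ : ℝ) (q : ℤ) :
    Complex.exp (Complex.I * (ψ + 4 * π * q : ℝ) / 2) = Complex.exp (Complex.I * ψ / 2) := by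
  rw [show Complex.I * (ψ + 4 * π * q : ℝ) / 2 = Complex.I * ψ / 2 + q * (2 * π * Complex.I) by
    push_cast; ring, Complex.exp_periodic.int_mul]

theorem pt_add_int (R ψ : ℝ) (q : ℤ) : pt R (ψ + 4 * π * q) = pt R ψ := by
  rw [pt, pt, exp_half_add_int]

theorem ray_add_int (ψ : ℝ) (q : ℤ) : ray (ψ + 4 * π * q) = ray ψ := by
  simp only [ray, pt_add_int]

theorem exists_pt_eq (w : ℂ) (ψ₀ : ℝ) :
    ∃ ψ ∈ Ico ψ₀ (ψ₀ + 4 * π), w = pt (‖w‖ ^ 2) ψ := by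
  obtain ⟨q, hq, -⟩ := existsUnique_add_zsmul_mem_Ico (by positivity : 0 < 4 * π) (2 * w.arg) ψ₀
  refine ⟨_, hq, ?_⟩
  have : (2 * w.arg + q • (4 * π)) = 2 * w.arg + 4 * π * q := by
    rw [zsmul_eq_mul]; ring
  rw [this, pt_add_int, pt, Real.sqrt_sq (norm_nonneg _)]
  rw [show Complex.I * (2 * w.arg : ℝ) / 2 = w.arg * Complex.I by push_cast; ring,
    Complex.norm_mul_exp_arg_mul_I]

/-- A sector is the exponential of a convex half-strip. Openness and connectedness are inherited
from there, even when the arc is so long that the sector overlaps itself. -/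
theorem arcSector_eq_image (a b : ℝ) {r : ℝ} (hr : 0 < r) : arcSector a b r =
    Complex.exp '' {ζ | ζ.re < Real.log r / 2 ∧ ζ.im ∈ Ioo (a / 2) (b / 2)} := by
  ext w
  constructor
  · rintro ⟨R, hR, ψ, hψ, rfl⟩
    refine ⟨_, ⟨?_, ?_⟩, (pt_eq_exp hR.1 ψ).symm⟩
    · have := Real.log_lt_log hR.1 hR.2
      simp
      linarith
    · simpa using ⟨by linarith [hψ.1], by linarith [hψ.2]⟩
  · rintro ⟨ζ, ⟨h1, h2⟩, rfl⟩
    refine ⟨Real.exp (2 * ζ.re), ⟨Real.exp_pos _, ?_⟩, 2 * ζ.im,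
      ⟨by linarith [h2.1], by linarith [h2.2]⟩, ?_⟩
    · rw [← Real.lt_log_iff_exp_lt hr]; linarith
    · rw [pt_eq_exp (Real.exp_pos _), Real.log_exp]
      congr 1
      rw [mul_div_cancel_left₀ _ two_ne_zero, mul_div_cancel_left₀ _ two_ne_zero, Complex.re_add_im]

theorem arcSector_empty_of_nonpos (a b : ℝ) {r : ℝ} (hr : r ≤ 0) : arcSector a b r = ∅ := by
  ext w
  refine iff_of_false ?_ (notMem_empty w)
  rintro ⟨R, hR, -⟩
  linarith [hR.1, hR.2]

theorem convex_strip (a b : ℝ) : Convex ℝ {ζ : ℂ | ζ.im ∈ Ioo a b} :=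
  (convex_Ioo a b).linear_preimage Complex.imLm

theorem isOpen_arcSector (a b r : ℝ) : IsOpen (arcSector a b r) := by
  rcases le_or_gt r 0 with hr | hr
  · rw [arcSector_empty_of_nonpos a b hr]; exact isOpen_empty
  · rw [arcSector_eq_image a b hr]
    apply Complex.isOpenMap_exp
    exact (isOpen_lt Complex.continuous_re continuous_const).inter
      (isOpen_Ioo.preimage Complex.continuous_im)

theorem isPreconnected_arcSector (a b r : ℝ) : IsPreconnected (arcSector a b r) := by
  rcases le_or_gt r 0 with hr | hr
  · rw [arcSector_empty_of_nonpos a b hr]; exact isPreconnected_empty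
  · rw [arcSector_eq_image a b hr]
    refine IsPreconnected.image ?_ _ Complex.continuous_exp.continuousOn
    exact ((convex_halfSpace_re_lt _).inter (convex_strip _ _)).isPreconnected

theorem borelSector_eq_image (d ε : ℝ) : borelSector d ε =
    Complex.exp '' {ζ | ζ.im ∈ Ioo (d - ε / 2) (d + ε / 2)} := by
  ext s
  constructor
  · rintro ⟨R, hR, ψ, hψ, rfl⟩
    refine ⟨Real.log R + ψ * Complex.I, ?_, ?_⟩
    · simpa using hψ
    · rw [Complex.exp_add, ← Complex.ofReal_exp, Real.exp_log hR, mul_comm (ψ : ℂ)]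
  · rintro ⟨ζ, h2, rfl⟩
    refine ⟨Real.exp ζ.re, Real.exp_pos _, ζ.im, h2, ?_⟩
    rw [Complex.ofReal_exp, ← Complex.exp_add, mul_comm Complex.I, Complex.re_add_im]

theorem isOpen_borelSector (d ε : ℝ) : IsOpen (borelSector d ε) := by
  rw [borelSector_eq_image]
  exact Complex.isOpenMap_exp _ (isOpen_Ioo.preimage Complex.continuous_im)

theorem borelSector_mono (d : ℝ) {ε ε' : ℝ} (h : ε ≤ ε') : borelSector d ε ⊆ borelSector d ε' := by
  rintro s ⟨R, hR, ψ, hψ, rfl⟩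
  exact ⟨R, hR, ψ, ⟨by linarith [hψ.1], by linarith [hψ.2]⟩, rfl⟩

theorem ray_mem_borelSector (d : ℝ) {ε : ℝ} (hε : 0 < ε) {R : ℝ} (hR : 0 < R) :
    (R : ℂ) * Complex.exp (Complex.I * d) ∈ borelSector d ε :=
  ⟨R, hR, d, ⟨by linarith, by linarith⟩, rfl⟩

/-- This connectedness lets the identity theorem propagate the Taylor germ at `s = 0` into the
unbounded sector. -/
theorem isPreconnected_ball_union_borelSector (d : ℝ) {ε η : ℝ} (hε : 0 < ε) (hη : 0 < η) :
    IsPreconnected (Metric.ball 0 η ∪ borelSector d ε) := by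
  refine IsPreconnected.union ((η / 2 : ℝ) * Complex.exp (Complex.I * d)) ?_
    (ray_mem_borelSector d hε (half_pos hη)) (convex_ball _ _).isPreconnected ?_
  · rw [mem_ball_zero_iff, norm_mul, norm_exp_I_mul, Complex.norm_real,
      Real.norm_of_nonneg (half_pos hη).le]
    linarith
  · rw [borelSector_eq_image]
    exact (convex_strip _ _).isPreconnected.image _ Complex.continuous_exp.continuousOn

theorem isOpen_ball_union_borelSector (d ε η : ℝ) :
    IsOpen (Metric.ball 0 η ∪ borelSector d ε) :=
  Metric.isOpen_ball.union (isOpen_borelSector d ε)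

theorem sector_mono (d : ℝ) {α α' r r' : ℝ} (hα : α ≤ α') (hr : r ≤ r') :
    sector d α r ⊆ sector d α' r' := by
  rintro w ⟨R, hR, ψ, hψ, rfl⟩
  exact ⟨R, ⟨hR.1, hR.2.trans_le hr⟩, ψ, ⟨by linarith [hψ.1], by linarith [hψ.2]⟩, rfl⟩

theorem pt_mem_sector {d α r R : ℝ} (hα : 0 < α) (hR : R ∈ Ioo 0 r) : pt R d ∈ sector d α r :=
  ⟨R, hR, d, ⟨by linarith, by linarith⟩, rfl⟩

theorem ne_zero_of_mem_arcSector {a b r : ℝ} {w : ℂ} (hw : w ∈ arcSector a b r) : w ≠ 0 := by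
  obtain ⟨R, hR, ψ, -, rfl⟩ := hw
  exact pt_ne_zero hR.1 ψ

theorem norm_sq_lt_of_mem_arcSector {a b r : ℝ} {w : ℂ} (hw : w ∈ arcSector a b r) :
    ‖w‖ ^ 2 < r := by
  obtain ⟨R, hR, ψ, -, rfl⟩ := hw
  rw [norm_pt_sq hR.1.le]; exact hR.2

/-! ### The even part of a translate as a function of the square -/

/-- The value at `√s` of the even part of `x ↦ f (z + x)`. -/
noncomputable def evenPart (f : ℂ → ℂ) (s z : ℂ) : ℂ :=
  (f (z + s ^ (((2 : ℕ) : ℂ)⁻¹)) + f (z - s ^ (((2 : ℕ) : ℂ)⁻¹))) / 2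

theorem exists_sq_eq (s : ℂ) : ∃ x : ℂ, x ^ 2 = s :=
  ⟨_, Complex.cpow_nat_inv_pow s two_ne_zero⟩

theorem evenPart_sq (f : ℂ → ℂ) (x z : ℂ) :
    evenPart f (x ^ 2) z = (f (z + x) + f (z - x)) / 2 := by
  have h := Complex.cpow_nat_inv_pow (x ^ 2) two_ne_zero
  rw [evenPart]
  rcases sq_eq_sq_iff_eq_or_eq_neg.1 h with h | h <;> rw [h]
  rw [sub_neg_eq_add, ← sub_eq_add_neg, add_comm]

/-- Averaging Cauchy's formula at `x` and `-x` gives the kernel `ζ/(ζ²-x²)`, which involves only `s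
= x²`. The branch of the square root in `evenPart` thereby becomes irrelevant. -/
theorem evenPart_eq_circleIntegral {f : ℂ → ℂ} (hf : Differentiable ℂ f) {R : ℝ} (hR : 0 < R)
    {s : ℂ} (hs : ‖s‖ < R ^ 2) (z : ℂ) : evenPart f s z =
      (2 * π * Complex.I : ℂ)⁻¹ * ∮ ζ in C(0, R), f (z + ζ) * (ζ / (ζ ^ 2 - s)) := by
  obtain ⟨x, rfl⟩ := exists_sq_eq s
  have hx : ‖x‖ < R := by
    rw [norm_pow] at hs
    exact lt_of_pow_lt_pow_left₀ 2 hR.le hs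
  have hd : DiffContOnCl ℂ (fun ζ => f (z + ζ)) (Metric.ball 0 R) :=
    (hf.comp (differentiable_id.const_add z)).diffContOnCl
  have h1 := hd.circleIntegral_sub_inv_smul (w := x) (by simpa using hx)
  have h2 := hd.circleIntegral_sub_inv_smul (w := -x) (by simpa using hx)
  have hne : ∀ y : ℂ, ‖y‖ < R → ∀ ζ ∈ Metric.sphere (0 : ℂ) R, ζ - y ≠ 0 := by
    intro y hy ζ hζ h0
    rw [sub_eq_zero] at h0
    subst h0
    rw [mem_sphere_zero_iff_norm] at hζ
    linarith
  have hci : ∀ y : ℂ, ‖y‖ < R → CircleIntegrable (fun ζ => (ζ - y)⁻¹ • f (z + ζ)) 0 R := by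
    intro y hy
    apply ContinuousOn.circleIntegrable hR.le
    refine ContinuousOn.mul (f := fun ζ => (ζ - y)⁻¹) ?_ ?_
    · exact ContinuousOn.inv₀ (by fun_prop) (hne y hy)
    · have := hf.continuous
      fun_prop
  have h3 : ∮ ζ in C(0, R), f (z + ζ) * (ζ / (ζ ^ 2 - x ^ 2)) =
      ∮ ζ in C(0, R), (1 / 2 : ℂ) • ((ζ - x)⁻¹ • f (z + ζ) + (ζ - -x)⁻¹ • f (z + ζ)) := by
    apply circleIntegral.integral_congr hR.le
    intro ζ hζ
    have e1 := hne x hx ζ hζ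
    have e2 := hne (-x) (by simpa using hx) ζ hζ
    have e3 : ζ ^ 2 - x ^ 2 ≠ 0 := by
      rw [show ζ ^ 2 - x ^ 2 = (ζ - x) * (ζ - -x) by ring]; exact mul_ne_zero e1 e2
    simp only [smul_eq_mul]
    rw [show ζ ^ 2 - x ^ 2 = (ζ - x) * (ζ - -x) by ring]
    field_simp
    ring
  rw [h3, circleIntegral.integral_smul, circleIntegral.integral_add (hci x hx)
    (hci (-x) (by simpa using hx)), h1, h2, evenPart_sq]
  have hpi : (2 * π * Complex.I : ℂ) ≠ 0 := by simp [Real.pi_ne_zero]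
  simp only [smul_eq_mul]
  field_simp
  rw [sub_eq_add_neg]

theorem differentiable_evenPart {f : ℂ → ℂ} (hf : Differentiable ℂ f) :
    Differentiable ℂ (Function.uncurry (evenPart f)) := by
  rintro ⟨s₀, z₀⟩
  -- With this radius `|ζ² - s| ≥ 1` on the circle for all `s` within distance one of `s₀`.
  set R : ℝ := ‖s₀‖ + 2 with hR
  have hR0 : 0 < R := by positivity
  have hR1 : ‖s₀‖ + 2 ≤ R ^ 2 := by nlinarith [norm_nonneg s₀]
  have hsR : ∀ q ∈ Metric.ball (s₀, z₀) 1, ‖q.1‖ ≤ R ^ 2 - 1 ∧ ‖q.2‖ ≤ ‖z₀‖ + 1 := by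
    intro q hq
    have h := mem_ball_iff_norm.1 hq
    have h1 : ‖q.1 - s₀‖ < 1 := lt_of_le_of_lt (norm_fst_le (q - (s₀, z₀))) h
    have h2 : ‖q.2 - z₀‖ < 1 := lt_of_le_of_lt (norm_snd_le (q - (s₀, z₀))) h
    have h3 : ‖q.1‖ ≤ ‖s₀‖ + ‖q.1 - s₀‖ := by simpa using norm_add_le s₀ (q.1 - s₀)
    have h4 : ‖q.2‖ ≤ ‖z₀‖ + ‖q.2 - z₀‖ := by simpa using norm_add_le z₀ (q.2 - z₀)
    constructor <;> linarith
  have hden : ∀ q ∈ Metric.ball (s₀, z₀) 1, ∀ θ : ℝ, 1 ≤ ‖circleMap 0 R θ ^ 2 - q.1‖ := by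
    intro q hq θ
    have h1 := norm_sub_norm_le (circleMap 0 R θ ^ 2) q.1
    rw [norm_pow, norm_circleMap_zero, sq_abs] at h1
    linarith [(hsR q hq).1]
  have hden0 : ∀ q ∈ Metric.ball (s₀, z₀) 1, ∀ θ : ℝ, circleMap 0 R θ ^ 2 - q.1 ≠ 0 := by
    intro q hq θ h0
    have := hden q hq θ
    rw [h0, norm_zero] at this
    linarith
  obtain ⟨M, hM⟩ := (isCompact_closedBall (0 : ℂ) (‖z₀‖ + 1 + R)).exists_bound_of_continuousOn
    hf.continuous.continuousOn
  have hcm : Continuous (circleMap 0 R) := continuous_circleMap 0 R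
  have hc := hf.continuous
  have hc' := hf.contDiff.continuous_deriv (n := 1) le_rfl
  have hmem0 : (s₀, z₀) ∈ Metric.ball (s₀, z₀) (1 : ℝ) := Metric.mem_ball_self one_pos
  have hd0 : ∀ q ∈ Metric.ball (s₀, z₀) 1, Continuous fun θ : ℝ => (circleMap 0 R θ ^ 2 - q.1)⁻¹ :=
    fun q hq => Continuous.inv₀ (by fun_prop) (hden0 q hq)
  have key := hasFDerivAt_integral_of_bounded (E := ℂ × ℂ) (μ := volume.restrict (Ioc 0 (2 * π)))
    (F := fun q θ => circleMap 0 R θ * Complex.I * (f (q.2 + circleMap 0 R θ) *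
      (circleMap 0 R θ * (circleMap 0 R θ ^ 2 - q.1)⁻¹)))
    (F' := fun q θ => (circleMap 0 R θ * Complex.I * circleMap 0 R θ) •
      ((f (q.2 + circleMap 0 R θ)) •
        (((circleMap 0 R θ ^ 2 - q.1)⁻¹) ^ 2 • ContinuousLinearMap.fst ℂ ℂ ℂ) +
        (circleMap 0 R θ ^ 2 - q.1)⁻¹ • (deriv f (q.2 + circleMap 0 R θ) •
          ContinuousLinearMap.snd ℂ ℂ ℂ)))
    (x₀ := (s₀, z₀)) one_pos (bound := fun _ => R * (M * (R * 1)))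
    (fun q hq => by have := hd0 q hq; fun_prop)
    (by have := hd0 _ hmem0; fun_prop)
    (Eventually.of_forall fun θ q hq => by
      rw [norm_mul, norm_mul, norm_mul, norm_mul, Complex.norm_I, mul_one, norm_circleMap_zero,
        abs_of_pos hR0, norm_inv]
      have h1 : ‖f (q.2 + circleMap 0 R θ)‖ ≤ M := by
        apply hM
        rw [mem_closedBall_zero_iff]
        refine (norm_add_le _ _).trans ?_
        rw [norm_circleMap_zero, abs_of_pos hR0]
        linarith [(hsR q hq).2]
      have h2 : ‖circleMap 0 R θ ^ 2 - q.1‖⁻¹ ≤ 1 := inv_le_one_of_one_le₀ (hden q hq θ)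
      have h3 : 0 ≤ M := (norm_nonneg _).trans h1
      gcongr)
    (integrable_const _)
    (Eventually.of_forall fun θ q hq => by
      have h1 : HasFDerivAt (fun q : ℂ × ℂ => f (q.2 + circleMap 0 R θ))
          (deriv f (q.2 + circleMap 0 R θ) • ContinuousLinearMap.snd ℂ ℂ ℂ) q :=
        (hf (q.2 + circleMap 0 R θ)).hasDerivAt.comp_hasFDerivAt q
          (hasFDerivAt_snd.add_const (circleMap 0 R θ))
      have h2 : HasFDerivAt (fun q : ℂ × ℂ => (circleMap 0 R θ ^ 2 - q.1)⁻¹)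
          (((circleMap 0 R θ ^ 2 - q.1)⁻¹) ^ 2 • ContinuousLinearMap.fst ℂ ℂ ℂ) q := by
        have := (hasDerivAt_inv (hden0 q hq θ)).comp_hasFDerivAt q
          ((hasFDerivAt_fst (𝕜 := ℂ) (p := q)).const_sub (circleMap 0 R θ ^ 2))
        convert! this using 1
        simp
      have h3 := (h1.mul h2).const_mul (circleMap 0 R θ * Complex.I * circleMap 0 R θ)
      convert! h3 using 1
      ext q
      simp only [Pi.mul_apply]
      ring)
  refine (key.differentiableAt.const_mul (2 * π * Complex.I : ℂ)⁻¹).congr_of_eventuallyEq ?_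
  filter_upwards [Metric.ball_mem_nhds (s₀, z₀) one_pos] with q hq
  rw [Function.uncurry, evenPart_eq_circleIntegral hf hR0 (by linarith [(hsR q hq).1]),
    circleIntegral, intervalIntegral.integral_of_le (by positivity)]
  congr 1
  refine integral_congr_ae (Eventually.of_forall fun θ => ?_)
  simp [div_eq_mul_inv]

variable {ι : Type*} [Fintype ι]

/-! ### The Borel transform of the formal solution -/

/-- A meromorphic datum with simple poles `p i` and residues `a i`. -/
noncomputable def poleDatum (a p : ι → ℂ) (f : ℂ → ℂ) (x : ℂ) : ℂ := (∑ i, a i / (x - p i)) + f x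

/-- The continuation of the modified Borel transform of the formal solution. -/
noncomputable def borelFun (a p : ι → ℂ) (f : ℂ → ℂ) (s z : ℂ) : ℂ :=
  (∑ i, a i * (z - p i) / ((z - p i) ^ 2 - s)) + evenPart f s z

/-- Partial fractions: the mean of `1/(z+x-p)` and `1/(z-x-p)` is `(z-p)/((z-p)²-x²)`. -/
theorem borelFun_sq {a p : ι → ℂ} {f : ℂ → ℂ} {x z : ℂ} (h1 : ∀ i, z + x - p i ≠ 0)
    (h2 : ∀ i, z - x - p i ≠ 0) :
    borelFun a p f (x ^ 2) z = (poleDatum a p f (z + x) + poleDatum a p f (z - x)) / 2 := by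
  have h : ∀ i, a i * (z - p i) / ((z - p i) ^ 2 - x ^ 2) =
      (a i / (z + x - p i) + a i / (z - x - p i)) / 2 := by
    intro i
    have e1 := h1 i
    have e2 := h2 i
    rw [show (z - p i) ^ 2 - x ^ 2 = (z + x - p i) * (z - x - p i) by ring]
    field_simp
    ring
  rw [borelFun, evenPart_sq, poleDatum, poleDatum, Finset.sum_congr rfl fun i _ => h i,
    ← Finset.sum_div, Finset.sum_add_distrib]
  ring

theorem differentiableAt_borelFun {a p : ι → ℂ} {f : ℂ → ℂ} (hf : Differentiable ℂ f) {s z : ℂ}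
    (h : ∀ i, (z - p i) ^ 2 - s ≠ 0) :
    DifferentiableAt ℂ (Function.uncurry (borelFun a p f)) (s, z) := by
  refine (DifferentiableAt.add ?_ (differentiable_evenPart hf (s, z)) : DifferentiableAt ℂ
    ((fun q : ℂ × ℂ => ∑ i, a i * (q.2 - p i) / ((q.2 - p i) ^ 2 - q.1)) +
      Function.uncurry (evenPart f)) (s, z))
  refine DifferentiableAt.fun_sum fun i _ => ?_
  have h1 : DifferentiableAt ℂ (fun q : ℂ × ℂ => ((q.2 - p i) ^ 2 - q.1)⁻¹) (s, z) :=
    DifferentiableAt.inv (by fun_prop) (h i)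
  simp only [div_eq_mul_inv]
  exact DifferentiableAt.mul (by fun_prop) h1

theorem differentiableOn_poleDatum (a : ι → ℂ) {p : ι → ℂ} {f : ℂ → ℂ} (hf : Differentiable ℂ f)
    {ρ : ℝ} (hρ : ∀ i, ρ ≤ ‖p i‖) : DifferentiableOn ℂ (poleDatum a p f) (Metric.ball 0 ρ) := by
  intro x hx
  refine DifferentiableAt.differentiableWithinAt (DifferentiableAt.add ?_ (hf x))
  refine DifferentiableAt.fun_sum fun i _ => DifferentiableAt.div (by fun_prop) (by fun_prop) ?_
  rw [sub_ne_zero]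
  rintro rfl
  rw [mem_ball_zero_iff] at hx
  linarith [hρ i]

theorem differentiableOn_iteratedDeriv {f : ℂ → ℂ} {U : Set ℂ} (hU : IsOpen U)
    (hf : DifferentiableOn ℂ f U) (n : ℕ) : DifferentiableOn ℂ (iteratedDeriv n f) U := by
  induction n with
  | zero => simpa using hf
  | succ n ih => rw [iteratedDeriv_succ]; exact ih.deriv hU

theorem factorial_two_mul_le (n : ℕ) :
    ((2 * n).factorial : ℝ) ≤ 4 ^ n * (n.factorial : ℝ) * n.factorial := by
  have h1 := Nat.choose_mul_factorial_mul_factorial (n := 2 * n) (k := n) (by omega)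
  have h2 := Nat.choose_le_two_pow (2 * n) n
  rw [pow_mul, show 2 * n - n = n by omega] at *
  rw [← h1]
  exact_mod_cast Nat.mul_le_mul_right _ (Nat.mul_le_mul_right _ h2)

/-- Cauchy's estimates on discs of radius `ρ` bound the derivative of order `2n` by `M
(2n)!/ρ^(2n)`, and `(2n)! ≤ 4ⁿ (n!)²`. -/
theorem gevreyOne_formalSolution {φ : ℂ → ℂ} {ρ : ℝ} (hρ : 0 < ρ)
    (hφ : DifferentiableOn ℂ φ (Metric.ball 0 (3 * ρ))) {ρ' : ℝ} (hρ' : ρ' ≤ ρ) :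
    GevreyOne (formalSolution φ) ρ' := by
  refine ⟨fun n => ?_, ?_⟩
  · refine ((differentiableOn_iteratedDeriv Metric.isOpen_ball hφ (2 * n)).mono
      (Metric.ball_subset_ball (by linarith))).div_const _
  obtain ⟨M, hM⟩ := (isCompact_closedBall (0 : ℂ) (2 * ρ)).exists_bound_of_continuousOn
    (hφ.continuousOn.mono (Metric.closedBall_subset_ball (by linarith)))
  have hM0 : 0 ≤ M := (norm_nonneg _).trans (hM 0 (by simp; positivity))
  refine ⟨M + 1, 4 / ρ ^ 2, by linarith, by positivity, fun n z hz => ?_⟩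
  rw [mem_ball_zero_iff] at hz
  have hsub : Metric.closedBall z ρ ⊆ Metric.closedBall 0 (2 * ρ) := by
    apply Metric.closedBall_subset_closedBall'
    rw [dist_zero_right]; linarith
  have h1 := Complex.norm_iteratedDeriv_le_of_forall_mem_sphere_norm_le (f := φ) (c := z)
    (C := M + 1) (2 * n) hρ
    ((hφ.mono (hsub.trans (Metric.closedBall_subset_ball (by linarith)))).diffContOnCl_ball
      subset_rfl)
    (fun y hy => (hM y (hsub (Metric.sphere_subset_closedBall hy))).trans (by linarith))
  have hn : (0 : ℝ) < n.factorial := by positivity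
  rw [formalSolution, norm_div, Complex.norm_natCast, div_le_iff₀ hn]
  refine h1.trans ?_
  rw [div_le_iff₀ (by positivity)]
  have e : (M + 1) * (4 / ρ ^ 2) ^ n * (n.factorial : ℝ) * (n.factorial : ℝ) * ρ ^ (2 * n) =
      (4 ^ n * (n.factorial : ℝ) * n.factorial) * (M + 1) := by
    rw [pow_mul, div_pow]; field_simp
  rw [e]
  gcongr
  exact factorial_two_mul_le n

/-- The weight cancels `n!` and leaves the even Taylor coefficients of `φ` at `z`. Averaging the
expansions at `z + x` and `z - x` removes the odd ones. -/
theorem hasSum_formalSolution {φ : ℂ → ℂ} {ρ : ℝ}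
    (hφ : DifferentiableOn ℂ φ (Metric.ball 0 (3 * ρ))) {x z : ℂ} (hx : ‖x‖ < ρ) (hz : ‖z‖ < ρ) :
    HasSum (fun n : ℕ => formalSolution φ n z * (n.factorial : ℂ) / ((2 * n).factorial : ℂ) *
      (x ^ 2) ^ n) ((φ (z + x) + φ (z - x)) / 2) := by
  have hsub : Metric.ball z ρ ⊆ Metric.ball 0 (3 * ρ) := by
    apply Metric.ball_subset_ball'
    rw [dist_zero_right]; linarith [norm_nonneg x]
  have h1 := Complex.hasSum_taylorSeries_on_ball (hφ.mono hsub) (z := z + x) (by simpa using hx)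
  have h2 := Complex.hasSum_taylorSeries_on_ball (hφ.mono hsub) (z := z - x) (by simpa using hx)
  have h3 := (h1.add h2).div_const 2
  have hinj : Function.Injective fun n : ℕ => 2 * n := fun a b h => by simpa using h
  rw [← hinj.hasSum_iff] at h3
  · convert! h3 using 2 with n
    simp only [Function.comp, formalSolution, smul_eq_mul, add_sub_cancel_left,
      sub_sub_cancel_left, pow_mul, neg_sq]
    have : (n.factorial : ℂ) ≠ 0 := by exact_mod_cast n.factorial_ne_zero
    have : ((2 * n).factorial : ℂ) ≠ 0 := by exact_mod_cast (2 * n).factorial_ne_zero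
    field_simp
    ring
  · intro k hk
    have hodd : Odd k := by
      rw [← Nat.not_even_iff_odd]
      rintro ⟨j, rfl⟩
      exact hk ⟨j, by dsimp only; ring⟩
    simp only [add_sub_cancel_left, sub_sub_cancel_left, hodd.neg_pow, smul_eq_mul]
    ring

/-- The factor `3` leaves room for `z` and a displacement `√s`, each shorter than `ρ`, without
reaching a pole. -/
theorem borelFun_near_zero (a : ι → ℂ) {p : ι → ℂ} {f : ℂ → ℂ} (hf : Differentiable ℂ f)
    (hp : ∀ i, p i ≠ 0) : ∃ ρ > 0, (∀ i, 3 * ρ ≤ ‖p i‖) ∧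
      (∀ ρ' ≤ ρ, GevreyOne (formalSolution (poleDatum a p f)) ρ') ∧
      ∀ s ∈ Metric.ball (0 : ℂ) (ρ ^ 2), ∀ z ∈ Metric.ball (0 : ℂ) ρ,
        HasSum (fun n : ℕ => formalSolution (poleDatum a p f) n z * (n.factorial : ℂ) /
          ((2 * n).factorial : ℂ) * s ^ n) (borelFun a p f s z) := by
  have hev : ∀ᶠ ρ in 𝓝[>] (0 : ℝ), ∀ i, 3 * ρ ≤ ‖p i‖ := by
    rw [eventually_all]
    intro i
    have h : ∀ᶠ ρ in 𝓝 (0 : ℝ), 3 * ρ < ‖p i‖ :=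
      (continuous_const.mul continuous_id).continuousAt.eventually
        (gt_mem_nhds (by simpa using hp i))
    exact (h.filter_mono nhdsWithin_le_nhds).mono fun _ h => le_of_lt h
  obtain ⟨ρ, hρp, hρ⟩ := (hev.and self_mem_nhdsWithin).exists
  have hρ : 0 < ρ := hρ
  have hd := differentiableOn_poleDatum a hf hρp
  refine ⟨ρ, hρ, hρp, fun ρ' h => gevreyOne_formalSolution hρ hd h, fun s hs z hz => ?_⟩
  obtain ⟨x, rfl⟩ := exists_sq_eq s
  rw [mem_ball_zero_iff] at hs hz
  have hx : ‖x‖ < ρ := by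
    rw [norm_pow] at hs
    exact lt_of_pow_lt_pow_left₀ 2 hρ.le hs
  have hne : ∀ y : ℂ, ‖y‖ < ρ → ∀ i, z + y - p i ≠ 0 := by
    intro y hy i h0
    rw [sub_eq_zero] at h0
    have := hρp i
    rw [← h0] at this
    linarith [norm_add_le z y]
  rw [borelFun_sq (hne x hx) (fun i => by simpa [sub_eq_add_neg] using hne (-x) (by simpa) i)]
  exact hasSum_formalSolution hd hx hz

/-! ### Poles relative to a ray: summable and singular directions. -/

/-- The position of `p` with respect to the line through `0` of direction `ψ / 2`. -/
noncomputable def side (p : ℂ) (ψ : ℝ) : ℝ := (p * Complex.exp (-(Complex.I * ψ / 2))).im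

theorem continuous_side (p : ℂ) : Continuous (side p) := by
  unfold side; fun_prop

theorem norm_exp_neg_I_mul_half (ψ : ℝ) : ‖Complex.exp (-(Complex.I * ψ / 2))‖ = 1 := by
  rw [Complex.exp_neg, norm_inv, norm_exp_I_mul_half, inv_one]

/-- A rotation by `-ψ/2` makes the line horizontal, and distances dominate imaginary parts. The
bound is uniform along the whole line, both signs of `y` included. -/
theorem abs_side_sub_le (p z : ℂ) (y ψ : ℝ) :
    |side p ψ| - ‖z‖ ≤ ‖z + y * Complex.exp (Complex.I * ψ / 2) - p‖ := by
  set e := Complex.exp (-(Complex.I * ψ / 2)) with he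
  have h0 : Complex.exp (Complex.I * ψ / 2) * e = 1 := by rw [he, ← Complex.exp_add]; simp
  have h1 : ((p - (z + y * Complex.exp (Complex.I * ψ / 2))) * e).im = side p ψ - (z * e).im := by
    have : (p - (z + y * Complex.exp (Complex.I * ψ / 2))) * e = p * e - z * e - y := by
      linear_combination -(y : ℂ) * h0
    rw [this]; simp [side]
    rfl
  have hen : ‖e‖ = 1 := norm_exp_neg_I_mul_half ψ
  have h2 := Complex.abs_im_le_norm ((p - (z + y * Complex.exp (Complex.I * ψ / 2))) * e)
  rw [h1, norm_mul, hen, mul_one, norm_sub_rev] at h2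
  have h3 := Complex.abs_im_le_norm (z * e)
  rw [norm_mul, hen, mul_one] at h3
  linarith [abs_sub_abs_le_abs_sub (side p ψ) (z * e).im]

theorem exists_side_margin {p : ι → ℂ} {d : ℝ} (hd : ∀ i, side (p i) d ≠ 0) :
    ∃ κ > 0, ∃ ε > 0, ∀ ψ ∈ Ioo (d - ε / 2) (d + ε / 2), ∀ i, κ ≤ |side (p i) ψ| := by
  have h1 : ∀ᶠ κ in 𝓝[>] (0 : ℝ), ∀ i, κ < |side (p i) d| := by
    rw [eventually_all]
    intro i
    exact (gt_mem_nhds (abs_pos.2 (hd i))).filter_mono nhdsWithin_le_nhds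
  obtain ⟨κ, h2, hκ⟩ := (h1.and self_mem_nhdsWithin).exists
  have h3 : ∀ᶠ ψ in 𝓝 d, ∀ i, κ < |side (p i) ψ| := by
    rw [eventually_all]
    intro i
    exact (continuous_side (p i)).abs.continuousAt.eventually (lt_mem_nhds (h2 i))
  obtain ⟨r, hr, h4⟩ := Metric.eventually_nhds_iff_ball.1 h3
  refine ⟨κ, hκ, r, hr, fun ψ hψ i => (h4 ψ ?_ i).le⟩
  rw [Real.ball_eq_Ioo]
  exact ⟨by linarith [hψ.1], by linarith [hψ.2]⟩

/-- When every pole keeps a positive distance from the lines of directions near `d/2`, the rational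
part is bounded on the Borel sector. The growth of order two of `f` becomes order one in `s`, since
`|√s|² = |s|`. -/
theorem isBorelTransform_borelFun (a : ι → ℂ) {p : ι → ℂ} {f : ℂ → ℂ} (hf : EntireGrowthTwo f)
    (hp : ∀ i, p i ≠ 0) {d : ℝ} (hd : ∀ i, side (p i) d ≠ 0) :
    ∃ ε > 0, ∃ ρ > 0, GevreyOne (formalSolution (poleDatum a p f)) ρ ∧
      IsBorelTransform (formalSolution (poleDatum a p f)) d ε ρ (borelFun a p f) := by
  obtain ⟨ρ₀, hρ₀, h3p, hG, hS⟩ := borelFun_near_zero a hf.1 hp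
  obtain ⟨κ, hκ, ε, hε, hside⟩ := exists_side_margin hd
  obtain ⟨hfd, C₁, C₂, hC1, hC2, hfb⟩ := hf
  set ρ := min ρ₀ (κ / 2) with hρdef
  have hρ : 0 < ρ := lt_min hρ₀ (by linarith)
  have hρ1 : ρ ≤ ρ₀ := min_le_left _ _
  have hρ2 : ρ ≤ κ / 2 := min_le_right _ _
  have hlow : ∀ s ∈ borelSector d ε, ∀ z ∈ Metric.ball (0 : ℂ) ρ, ∀ i,
      (κ / 2) ^ 2 ≤ ‖(z - p i) ^ 2 - s‖ := by
    rintro s ⟨R, hR, ψ, hψ, rfl⟩ z hz i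
    rw [mem_ball_zero_iff] at hz
    have e1 := abs_side_sub_le (p i) z (Real.sqrt R) ψ
    have e2 := abs_side_sub_le (p i) z (-Real.sqrt R) ψ
    have e3 := hside ψ hψ i
    -- The denominator is the product of `z + √s - p` and `z - √s - p`; each has modulus at least
    -- `κ/2`.
    rw [← pt_sq hR.le, show (z - p i) ^ 2 - pt R ψ ^ 2 =
      (z + (Real.sqrt R : ℝ) * Complex.exp (Complex.I * ψ / 2) - p i) *
      (z + ((-Real.sqrt R : ℝ) : ℂ) * Complex.exp (Complex.I * ψ / 2) - p i) by
        rw [pt]; push_cast; ring, norm_mul, pow_two]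
    apply mul_le_mul <;> linarith [norm_nonneg (z + (Real.sqrt R : ℝ) * Complex.exp (Complex.I * ψ / 2) - p i)]
  have hdiff : Holo (borelFun a p f) (Metric.ball 0 (ρ₀ ^ 2) ∪ borelSector d ε) ρ := by
    rintro ⟨s, z⟩ ⟨hs, hz⟩
    refine (differentiableAt_borelFun hfd fun i => ?_).differentiableWithinAt
    rcases hs with hs | hs
    · intro h0
      rw [sub_eq_zero] at h0
      rw [mem_ball_zero_iff] at hs hz
      simp only at hs hz
      rw [← h0, norm_pow] at hs
      have h1 := lt_of_pow_lt_pow_left₀ 2 hρ₀.le hs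
      have h2 := norm_sub_norm_le (p i) z
      rw [norm_sub_rev] at h2
      linarith [h3p i]
    · intro h0
      have := hlow s hs z hz i
      rw [h0, norm_zero] at this
      nlinarith
  refine ⟨ε, hε, ρ, hρ, hG ρ hρ1, ⟨ρ₀ ^ 2, by positivity, hdiff, fun s hs z hz =>
    hS s hs z (Metric.ball_subset_ball hρ1 hz)⟩, fun ε' _ hε' => ?_⟩
  set K := ∑ i, ‖a i‖ * (ρ + ‖p i‖) / (κ / 2) ^ 2 with hK
  have hK0 : 0 ≤ K := Finset.sum_nonneg fun i _ => by positivity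
  refine ⟨K + C₁ * Real.exp (2 * C₂ * ρ ^ 2), 2 * C₂, by positivity, by positivity,
    fun s hs z hz => ?_⟩
  have hsum : ‖∑ i, a i * (z - p i) / ((z - p i) ^ 2 - s)‖ ≤ K := by
    refine (norm_sum_le _ _).trans (Finset.sum_le_sum fun i _ => ?_)
    rw [norm_div, norm_mul]
    have h1 : ‖z - p i‖ ≤ ρ + ‖p i‖ :=
      (norm_sub_le _ _).trans (by linarith [mem_ball_zero_iff.1 hz])
    have h2 := hlow s (borelSector_mono d hε'.le hs) z hz i
    gcongr
  have hev : ‖evenPart f s z‖ ≤ C₁ * Real.exp (2 * C₂ * ρ ^ 2) * Real.exp (2 * C₂ * ‖s‖) := by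
    obtain ⟨x, rfl⟩ := exists_sq_eq s
    have hb : ∀ y : ℂ, ‖y‖ = ‖x‖ →
        ‖f (z + y)‖ ≤ C₁ * Real.exp (2 * C₂ * ρ ^ 2) * Real.exp (2 * C₂ * ‖x ^ 2‖) := by
      intro y hy
      refine (hfb _).trans ?_
      rw [mul_assoc, ← Real.exp_add]
      refine mul_le_mul_of_nonneg_left (Real.exp_le_exp.2 ?_) hC1.le
      have h1 : ‖z + y‖ ≤ ρ + ‖x‖ := (norm_add_le _ _).trans
        (by rw [hy]; linarith [mem_ball_zero_iff.1 hz])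
      have h2 : ‖z + y‖ ^ 2 ≤ 2 * ρ ^ 2 + 2 * ‖x‖ ^ 2 := by
        have : ‖z + y‖ ^ 2 ≤ (ρ + ‖x‖) ^ 2 := by gcongr
        nlinarith [sq_nonneg (ρ - ‖x‖)]
      rw [norm_pow]
      nlinarith
    rw [evenPart_sq, norm_div, Complex.norm_two, div_le_iff₀ two_pos]
    have h1 := hb x rfl
    have h2 := hb (-x) (norm_neg x)
    rw [← sub_eq_add_neg] at h2
    exact (norm_add_le _ _).trans (by linarith)
  have h1 : 1 ≤ Real.exp (2 * C₂ * ‖s‖) := Real.one_le_exp (by positivity)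
  calc ‖borelFun a p f s z‖ ≤ K + C₁ * Real.exp (2 * C₂ * ρ ^ 2) * Real.exp (2 * C₂ * ‖s‖) :=
        (norm_add_le _ _).trans (add_le_add hsum hev)
    _ ≤ K * Real.exp (2 * C₂ * ‖s‖) + C₁ * Real.exp (2 * C₂ * ρ ^ 2) * Real.exp (2 * C₂ * ‖s‖) := by
        gcongr; exact le_mul_of_one_le_right hK0 h1
    _ = _ := by ring

theorem summableIn_of_side_ne_zero (a : ι → ℂ) {p : ι → ℂ} {f : ℂ → ℂ} (hf : EntireGrowthTwo f)
    (hp : ∀ i, p i ≠ 0) {d : ℝ} (hd : ∀ i, side (p i) d ≠ 0) :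
    SummableIn (formalSolution (poleDatum a p f)) d := by
  obtain ⟨ε, hε, ρ, hρ, hG, hB⟩ := isBorelTransform_borelFun a hf hp hd
  exact ⟨ε, ρ, hε, hρ, hG, _, hB⟩

theorem differentiableOn_fst_of_holo {g : ℂ → ℂ → ℂ} {S : Set ℂ} {ρ : ℝ} (hg : Holo g S ρ) {z : ℂ}
    (hz : z ∈ Metric.ball (0 : ℂ) ρ) : DifferentiableOn ℂ (fun s => g s z) S :=
  DifferentiableOn.comp (g := Function.uncurry g) (f := fun s => (s, z)) hg (by fun_prop)
    fun s hs => ⟨hs, hz⟩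

theorem differentiableOn_snd_of_holo {g : ℂ → ℂ → ℂ} {S : Set ℂ} {ρ : ℝ} (hg : Holo g S ρ) {s : ℂ}
    (hs : s ∈ S) : DifferentiableOn ℂ (g s) (Metric.ball 0 ρ) :=
  DifferentiableOn.comp (g := Function.uncurry g) (f := fun z => (s, z)) hg (by fun_prop)
    fun z hz => ⟨hs, hz⟩

/-- The identity theorem for the Borel transform. -/
theorem IsBorelTransform.eqOn_ray {c : ℕ → ℂ → ℂ} {d ε ρ ε' ρ' : ℝ} {g g' : ℂ → ℂ → ℂ}
    (hε : 0 < ε) (hε' : 0 < ε') (hg : IsBorelTransform c d ε ρ g)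
    (hg' : IsBorelTransform c d ε' ρ' g') {z : ℂ} (hz : z ∈ Metric.ball (0 : ℂ) ρ)
    (hz' : z ∈ Metric.ball (0 : ℂ) ρ') {R : ℝ} (hR : 0 < R) :
    g (R * Complex.exp (Complex.I * d)) z = g' (R * Complex.exp (Complex.I * d)) z := by
  obtain ⟨η, hη, hh, hs⟩ := hg.continuation
  obtain ⟨η', hη', hh', hs'⟩ := hg'.continuation
  set U := Metric.ball (0 : ℂ) (min η η') ∪ borelSector d (min ε ε') with hU
  have hη0 : 0 < min η η' := lt_min hη hη'
  have hUo : IsOpen U := isOpen_ball_union_borelSector _ _ _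
  have h1 : AnalyticOnNhd ℂ (fun s => g s z) U :=
    ((differentiableOn_fst_of_holo hh hz).mono (union_subset_union
      (Metric.ball_subset_ball (min_le_left _ _)) (borelSector_mono d (min_le_left _ _)))).analyticOnNhd hUo
  have h2 : AnalyticOnNhd ℂ (fun s => g' s z) U :=
    ((differentiableOn_fst_of_holo hh' hz').mono (union_subset_union
      (Metric.ball_subset_ball (min_le_right _ _)) (borelSector_mono d (min_le_right _ _)))).analyticOnNhd hUo
  refine h1.eqOn_of_preconnected_of_eventuallyEq h2
    (isPreconnected_ball_union_borelSector d (lt_min hε hε') hη0) (z₀ := 0)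
    (Or.inl (Metric.mem_ball_self hη0)) ?_ (Or.inr (ray_mem_borelSector d (lt_min hε hε') hR))
  filter_upwards [Metric.ball_mem_nhds (0 : ℂ) hη0] with s hs0
  exact (hs s (Metric.ball_subset_ball (min_le_left _ _) hs0) z hz).unique
    (hs' s (Metric.ball_subset_ball (min_le_right _ _) hs0) z hz')

/-- The two half-lines of direction `±exp(id/2)` have the same square, so it does not matter on
which of them the pole lies. -/
theorem sq_eq_of_side_eq_zero {p : ℂ} (hp : p ≠ 0) {d : ℝ} (h : side p d = 0) :
    ∃ R : ℝ, 0 < R ∧ p ^ 2 = R * Complex.exp (Complex.I * d) := by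
  set x := p * Complex.exp (-(Complex.I * d / 2)) with hx
  have hxr : x = (x.re : ℂ) := Complex.ext (by simp) (by have h' : x.im = 0 := h; simpa using h')
  have hx0 : x ≠ 0 := mul_ne_zero hp (Complex.exp_ne_zero _)
  have hpx : p = x.re * Complex.exp (Complex.I * d / 2) := by
    rw [← hxr, hx, mul_assoc, ← Complex.exp_add]; simp
  refine ⟨x.re ^ 2, ?_, ?_⟩
  · have : x.re ≠ 0 := by rintro h0; rw [h0] at hxr; exact hx0 (by simpa using hxr)
    positivity
  · nth_rw 1 [hpx]
    rw [mul_pow, ← Complex.exp_nat_mul]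
    push_cast
    congr 2; ring

/-- Work at `z = 0` and clear denominators: with `Q(s) = ∏ (p_j² - s)`, any continuation `g`
satisfies `Q g = H` with `H` entire, by the identity theorem. At `s = p_i²` the left side vanishes,
while the right side is `-a_i p_i ∏ (p_j² - p_i²)` over `j ≠ i`, which is nonzero. Only the
continuation is contradicted; growth plays no role. -/
theorem not_summableIn_of_side_eq_zero {a p : ι → ℂ} {f : ℂ → ℂ}
    (hf : Differentiable ℂ f) (hp : ∀ i, p i ≠ 0) (ha : ∀ i, a i ≠ 0)
    (hinj : ∀ i j, p i ^ 2 = p j ^ 2 → i = j) {d : ℝ} {i : ι} (hd : side (p i) d = 0) :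
    ¬ SummableIn (formalSolution (poleDatum a p f)) d := by
  classical
  rintro ⟨ε, ρ, hε, hρ, -, g, hg⟩
  obtain ⟨ρ₀, hρ₀, h3p, -, hS⟩ := borelFun_near_zero a hf hp
  obtain ⟨η, hη, hh, hs⟩ := hg.continuation
  set U := Metric.ball (0 : ℂ) η ∪ borelSector d ε with hU
  have hUo : IsOpen U := isOpen_ball_union_borelSector _ _ _
  have h0 : (0 : ℂ) ∈ Metric.ball (0 : ℂ) ρ := Metric.mem_ball_self hρ
  set Q : ℂ → ℂ := fun s => ∏ j, (p j ^ 2 - s) with hQ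
  set H : ℂ → ℂ := fun s => (∑ k, a k * (-p k) * ∏ j ∈ Finset.univ.erase k, (p j ^ 2 - s)) +
    Q s * evenPart f s 0 with hH
  have hQd : Differentiable ℂ Q := by
    rw [hQ]; fun_prop
  have hHd : Differentiable ℂ H := by
    have he : Differentiable ℂ fun s => evenPart f s 0 :=
      (differentiable_evenPart hf).comp (g := Function.uncurry (evenPart f))
        (f := fun s => (s, (0 : ℂ))) (by fun_prop)
    rw [hH]; fun_prop
  have h1 : AnalyticOnNhd ℂ (fun s => Q s * g s 0) U :=
    (hQd.differentiableOn.mul (differentiableOn_fst_of_holo hh h0)).analyticOnNhd hUo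
  have h2 : AnalyticOnNhd ℂ H U := hHd.differentiableOn.analyticOnNhd hUo
  obtain ⟨R, hR, hpR⟩ := sq_eq_of_side_eq_zero (hp i) hd
  have hmem : p i ^ 2 ∈ U := by
    rw [hpR]; exact Or.inr (ray_mem_borelSector d hε hR)
  have key := h1.eqOn_of_preconnected_of_eventuallyEq h2
    (isPreconnected_ball_union_borelSector d hε hη) (z₀ := 0)
    (Or.inl (Metric.mem_ball_self hη)) (by
      have hη0 : 0 < min η (ρ₀ ^ 2) := lt_min hη (by positivity)
      filter_upwards [Metric.ball_mem_nhds (0 : ℂ) hη0] with s hs0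
      have e1 := (hs s (Metric.ball_subset_ball (min_le_left _ _) hs0) 0 h0).unique
        (hS s (Metric.ball_subset_ball (min_le_right _ _) hs0) 0 (Metric.mem_ball_self hρ₀))
      have hne : ∀ j, p j ^ 2 - s ≠ 0 := by
        intro j h
        rw [sub_eq_zero] at h
        have := Metric.ball_subset_ball (min_le_right _ _) hs0
        rw [mem_ball_zero_iff, ← h, norm_pow] at this
        have := lt_of_pow_lt_pow_left₀ 2 hρ₀.le this
        linarith [h3p j]
      simp only [hH, e1, borelFun, zero_sub, neg_sq, mul_add, Finset.mul_sum]
      congr 1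
      refine Finset.sum_congr rfl fun k _ => ?_
      simp only [hQ]
      rw [← Finset.mul_prod_erase Finset.univ _ (Finset.mem_univ k)]
      have := hne k
      field_simp) hmem
  have hQ0 : Q (p i ^ 2) = 0 := Finset.prod_eq_zero (Finset.mem_univ i) (by simp)
  simp only [hH, hQ0, zero_mul, add_zero] at key
  rw [Finset.sum_eq_single i] at key
  · have hprod : ∏ j ∈ Finset.univ.erase i, (p j ^ 2 - p i ^ 2) ≠ 0 := by
      rw [Finset.prod_ne_zero_iff]
      intro j hj h
      exact (Finset.mem_erase.1 hj).1 (hinj j i (sub_eq_zero.1 h))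
    exact mul_ne_zero (mul_ne_zero (ha i) (neg_ne_zero.2 (hp i))) hprod key.symm
  · intro k _ hk
    rw [Finset.prod_eq_zero (i := i) (Finset.mem_erase.2 ⟨Ne.symm hk, Finset.mem_univ i⟩)
      (by simp), mul_zero]
  · simp

/-! ### The kernel of the Ecalle operator -/

/-- The functional equation of `Γ`, descended from `Γ(1/2) = √π`; the form is the one in which the
factorials of the kernel series cancel. -/
theorem Gamma_half_sub_nat (k : ℕ) :
    Complex.Gamma (1 / 2 - k) * ((2 * k).factorial : ℂ) =
      (Real.sqrt π : ℂ) * (-4) ^ k * (k.factorial : ℂ) := by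
  induction k with
  | zero =>
    simp only [Nat.cast_zero, sub_zero, mul_zero, Nat.factorial_zero, pow_zero, mul_one,
      Nat.cast_one]
    rw [show (1 / 2 : ℂ) = ((1 / 2 : ℝ) : ℂ) by push_cast; rfl, Complex.Gamma_ofReal,
      Real.Gamma_one_half_eq]
  | succ k ih =>
    have hk : (1 / 2 - (k + 1 : ℕ) : ℂ) ≠ 0 := by
      intro h
      have h2 := congrArg Complex.re h
      simp only [Complex.sub_re, Complex.natCast_re, Complex.zero_re] at h2
      norm_num at h2
      have : (0 : ℝ) ≤ k := k.cast_nonneg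
      linarith
    have h1 := Complex.Gamma_add_one _ hk
    rw [show (1 / 2 - (k + 1 : ℕ) + 1 : ℂ) = 1 / 2 - k by push_cast; ring] at h1
    rw [h1] at ih
    rw [show 2 * (k + 1) = 2 * k + 1 + 1 by ring, Nat.factorial_succ, Nat.factorial_succ,
      Nat.factorial_succ, pow_succ]
    push_cast at ih ⊢
    linear_combination (-4 * ((k : ℂ) + 1)) * ih

/-- Odd terms vanish because `Γ` has a pole there, and the even terms form an exponential series in
`-τ²/4`. -/
theorem kernelC_two (τ : ℂ) :
    kernelC 2 τ = (Real.sqrt π : ℂ)⁻¹ * Complex.exp (-τ ^ 2 / 4) := by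
  refine HasSum.tsum_eq ?_
  have hinj : Function.Injective fun n : ℕ => 2 * n := fun a b h => by simpa using h
  rw [← hinj.hasSum_iff]
  · have h := (NormedSpace.expSeries_div_hasSum_exp (𝔸 := ℂ) (-τ ^ 2 / 4)).mul_left
      (Real.sqrt π : ℂ)⁻¹
    rw [← Complex.exp_eq_exp_ℂ] at h
    convert! h using 2 with k
    simp only [Function.comp]
    have hG := Gamma_half_sub_nat k
    have hs : (Real.sqrt π : ℂ) ≠ 0 := by
      have : 0 < Real.sqrt π := by positivity
      exact_mod_cast this.ne'
    have hk : (k.factorial : ℂ) ≠ 0 := by exact_mod_cast k.factorial_ne_zero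
    rw [show (1 - ((2 * k : ℕ) + 1) / ((2 : ℝ) : ℂ) : ℂ) = 1 / 2 - k by push_cast; ring,
      mul_comm ((2 * k).factorial : ℂ), hG, pow_mul, neg_sq,
      show -τ ^ 2 / 4 = τ ^ 2 / (-4) by ring, div_pow]
    have h4 : ((-4 : ℂ)) ^ k ≠ 0 := pow_ne_zero _ (by norm_num)
    field_simp
  · intro n hn
    have hodd : Odd n := by
      rw [← Nat.not_even_iff_odd]
      rintro ⟨j, rfl⟩
      exact hn ⟨j, by dsimp only; ring⟩
    obtain ⟨k, rfl⟩ := hodd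
    -- The default values `Γ = 0` at a pole and `x / 0 = 0` give the correct value `0` of the
    -- reciprocal Gamma function.
    rw [show (1 - ((2 * k + 1 : ℕ) + 1) / ((2 : ℝ) : ℂ) : ℂ) = -k by push_cast; ring,
      Complex.Gamma_neg_nat_eq_zero, mul_zero, div_zero]

theorem sqrt_four_mul_pi : (Real.sqrt (4 * π) : ℂ) = 2 * (Real.sqrt π : ℂ) := by
  rw [Real.sqrt_mul (by norm_num), show (4 : ℝ) = 2 ^ 2 by norm_num, Real.sqrt_sq (by norm_num)]
  push_cast; rfl

theorem exp_half_sq (θ : ℝ) :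
    Complex.exp (Complex.I * θ / 2) ^ 2 = Complex.exp (Complex.I * θ) := by
  rw [← Complex.exp_nat_mul]; congr 1; push_cast; ring

/-- The kernel being Gaussian, the two integrals agree termwise; `1/2` from the even part and `1/√π`
from the kernel combine to `1/√(4π)`. -/
theorem ecalle_eq_heatIntegral {φ g : ℂ → ℂ} {θ : ℝ} {z : ℂ} (w : ℂ)
    (hg : ∀ y : ℝ, 0 < y → g ((y : ℂ) ^ 2 * Complex.exp (Complex.I * θ)) =
      (φ (z + y * Complex.exp (Complex.I * θ / 2)) +
        φ (z - y * Complex.exp (Complex.I * θ / 2))) / 2) :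
    ecalle g θ w = heatIntegral φ θ w z := by
  rw [ecalle, heatIntegral, sqrt_four_mul_pi]
  have h : ∫ y in Ioi (0 : ℝ), g ((y : ℂ) ^ 2 * Complex.exp (Complex.I * θ)) *
      kernelC 2 ((y : ℂ) * Complex.exp (Complex.I * θ / 2) / w) =
      ∫ y in Ioi (0 : ℝ), (2 * (Real.sqrt π : ℂ))⁻¹ * heatIntegrand φ θ w z y := by
    refine setIntegral_congr_fun measurableSet_Ioi fun y hy => ?_
    rw [hg y hy, kernelC_two, heatIntegrand, mul_inv, div_pow, neg_div, neg_div, div_div,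
      mul_comm (w ^ 2) 4]
    ring
  rw [h, integral_const_mul, mul_inv]
  ring

/-! ### Borel sums of the formal solution -/

/-- The `1`-sum of the formal solution; `σ i` tells on which side of `p i` the path of integration
runs. -/
noncomputable def stokesSum (a p : ι → ℂ) (f : ℂ → ℂ) (σ : ι → ℝ) (w z : ℂ) : ℂ :=
  (∑ i, a i * poleFlow (σ i) (p i) w z) + heatFlow f w z

/-- The extra rotation by `(ψ-θ)/2` replaces the direction of `t` by that of the path. The sign is
then decided by the side of the pole for `θ`, and the rotation is the one used in
`plasma_asymptotics`. -/
theorem im_pole_arg (σ : ℝ) (p z : ℂ) (R ψ θ : ℝ) :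
    (σ * (p - z) / pt R ψ * Complex.exp (Complex.I * (ψ - θ : ℝ) / 2)).im =
      σ * (side p θ - (z * Complex.exp (-(Complex.I * θ / 2))).im) / Real.sqrt R := by
  have h : σ * (p - z) / pt R ψ * Complex.exp (Complex.I * (ψ - θ : ℝ) / 2) =
      ((σ / Real.sqrt R : ℝ) : ℂ) * (p * Complex.exp (-(Complex.I * θ / 2)) -
        z * Complex.exp (-(Complex.I * θ / 2))) := by
    rw [pt, show Complex.I * (ψ - θ : ℝ) / 2 = Complex.I * ψ / 2 + -(Complex.I * θ / 2) by
      push_cast; ring, Complex.exp_add]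
    have := Complex.exp_ne_zero (Complex.I * ψ / 2)
    push_cast
    field_simp
  rw [h, Complex.im_ofReal_mul, Complex.sub_im, side]
  ring

theorem le_im_pole_arg {σ κ : ℝ} (hσ : σ = 1 ∨ σ = -1) {p : ℂ} {θ : ℝ} (hκ : κ ≤ σ * side p θ)
    (z : ℂ) (R ψ : ℝ) :
    (κ - ‖z‖) / Real.sqrt R ≤
      (σ * (p - z) / pt R ψ * Complex.exp (Complex.I * (ψ - θ : ℝ) / 2)).im := by
  rw [im_pole_arg]
  gcongr
  have h := Complex.abs_im_le_norm (z * Complex.exp (-(Complex.I * θ / 2)))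
  rw [norm_mul, norm_exp_neg_I_mul_half, mul_one, abs_le] at h
  rcases hσ with rfl | rfl <;> linarith

theorem integral_even_add {h : ℝ → ℂ} (hh : Integrable h) :
    ∫ x in Ioi (0 : ℝ), (h x + h (-x)) = ∫ x, h x := by
  have h1 : IntegrableOn (fun x => h (-x)) (Ioi 0) := hh.comp_neg.integrableOn
  have h2 := integral_comp_neg_Iic 0 (fun x => h (-x))
  simp only [neg_neg, neg_zero] at h2
  rw [integral_add hh.integrableOn h1, ← h2, add_comm]
  exact intervalIntegral.integral_Iic_add_Ioi hh.integrableOn hh.integrableOn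

theorem integrable_exp_div_sub {ζ : ℂ} (hζ : ζ.im ≠ 0) :
    Integrable (fun x : ℝ => Complex.exp (-(x : ℂ) ^ 2 / 4) / (x - ζ)) := by
  have hne : ∀ x : ℝ, |ζ.im| ≤ ‖(x : ℂ) - ζ‖ := by
    intro x
    have := Complex.abs_im_le_norm ((x : ℂ) - ζ)
    simpa using this
  have hp : 0 < |ζ.im| := abs_pos.2 hζ
  refine ((integrable_exp_neg_mul_sq (b := 1 / 4) (by norm_num)).div_const |ζ.im|).mono' ?_
    (Eventually.of_forall fun x => ?_)
  · refine (Continuous.div (by fun_prop) (by fun_prop) fun x h0 => ?_).aestronglyMeasurable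
    have := hne x
    rw [h0, norm_zero] at this
    linarith
  · rw [norm_div, norm_exp_neg_sq_div_four]
    gcongr
    exact hne x

/-- When `arg t` is the direction of the path, `s = w x` is a real rescaling. The symmetric
integrand then unfolds to an integral over the whole line, in which each pole gives a Cauchy
integral of a Gaussian. -/
theorem heatIntegral_ray {a p : ι → ℂ} {f : ℂ → ℂ} {σ : ι → ℝ} (hσ : ∀ i, σ i = 1 ∨ σ i = -1)
    {R θ : ℝ} (hR : 0 < R) {z : ℂ} (hpos : ∀ i, 0 < (σ i * (p i - z) / pt R θ).im)
    (hint : Integrable (fun x : ℝ => Complex.exp (-(x : ℂ) ^ 2 / 4) * f (z + pt R θ * x))) :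
    heatIntegral (poleDatum a p f) θ (pt R θ) z = stokesSum a p f σ (pt R θ) z := by
  set w := pt R θ with hw
  have hw0 : w ≠ 0 := pt_ne_zero hR θ
  have hRs : 0 < Real.sqrt R := Real.sqrt_pos.2 hR
  have hRs' : (Real.sqrt R : ℂ) ≠ 0 := by exact_mod_cast hRs.ne'
  set e := Complex.exp (Complex.I * θ / 2) with he
  have hwe : w = Real.sqrt R * e := rfl
  have hsub := integral_comp_mul_left_Ioi (heatIntegrand (poleDatum a p f) θ w z) 0 hRs
  rw [mul_zero] at hsub
  have hpt : ∀ x : ℝ, heatIntegrand (poleDatum a p f) θ w z (Real.sqrt R * x) =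
      Complex.exp (-(x : ℂ) ^ 2 / 4) * poleDatum a p f (z + w * x) +
      Complex.exp (-((-x : ℝ) : ℂ) ^ 2 / 4) * poleDatum a p f (z + w * ((-x : ℝ) : ℂ)) := by
    intro x
    rw [heatIntegrand, ← he]
    have e1 : ((Real.sqrt R * x : ℝ) : ℂ) * e = w * x := by rw [hwe]; push_cast; ring
    have e2 : -(w * x) ^ 2 / (4 * w ^ 2) = -(x : ℂ) ^ 2 / 4 := by field_simp
    rw [e1, e2]
    push_cast
    rw [neg_sq, mul_neg, ← sub_eq_add_neg]
    ring
  have him : ∀ i, 0 < (σ i * ((p i - z) / w) : ℂ).im := fun i => by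
    rw [← mul_div_assoc]; exact hpos i
  have hterm : ∀ i, (fun x : ℝ => Complex.exp (-(x : ℂ) ^ 2 / 4) * (a i / (z + w * x - p i))) =
      fun x : ℝ => (a i / w) * (Complex.exp (-(x : ℂ) ^ 2 / 4) / (x - (p i - z) / w)) := by
    intro i
    ext x
    rw [show z + w * x - p i = w * (x - (p i - z) / w) by field_simp; ring, ← div_div]
    ring
  have himne : ∀ i, ((p i - z) / w).im ≠ 0 := by
    intro i h0
    have := him i
    rw [Complex.im_ofReal_mul, h0, mul_zero] at this
    exact lt_irrefl _ this
  have hti : ∀ i, Integrable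
      (fun x : ℝ => Complex.exp (-(x : ℂ) ^ 2 / 4) * (a i / (z + w * x - p i))) := by
    intro i
    rw [hterm i]
    exact (integrable_exp_div_sub (himne i)).const_mul _
  have hsplit : (fun x : ℝ => Complex.exp (-(x : ℂ) ^ 2 / 4) * poleDatum a p f (z + w * x)) =
      fun x : ℝ => (∑ i, Complex.exp (-(x : ℂ) ^ 2 / 4) * (a i / (z + w * x - p i))) +
        Complex.exp (-(x : ℂ) ^ 2 / 4) * f (z + w * x) := by
    ext x
    rw [poleDatum, mul_add, Finset.mul_sum]
  have hsi := integrable_finsetSum Finset.univ fun i _ => hti i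
  have hh : Integrable (fun x : ℝ => Complex.exp (-(x : ℂ) ^ 2 / 4) *
      poleDatum a p f (z + w * x)) := by
    rw [hsplit]; exact hsi.add hint
  have hI : ∫ y in Ioi (0 : ℝ), heatIntegrand (poleDatum a p f) θ w z y =
      Real.sqrt R * ∫ x : ℝ, Complex.exp (-(x : ℂ) ^ 2 / 4) * poleDatum a p f (z + w * x) := by
    rw [← integral_even_add hh, ← setIntegral_congr_fun measurableSet_Ioi fun x _ => hpt x, hsub,
      Complex.real_smul]
    push_cast
    rw [mul_inv_cancel_left₀ hRs']
  rw [heatIntegral, hI, hsplit, integral_add hsi hint,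
    integral_finsetSum _ fun i _ => hti i, stokesSum, heatFlow]
  have h4 := sqrt_four_pi_ne_zero
  have hs : ∀ i, ∫ x : ℝ, Complex.exp (-(x : ℂ) ^ 2 / 4) * (a i / (z + w * x - p i)) =
      (Real.sqrt (4 * π) : ℂ) * (a i * poleFlow (σ i) (p i) w z) := by
    intro i
    rw [hterm i, integral_const_mul, ← sign_mul_plasma_eq_cauchy (σ := σ i)
      (by rcases hσ i with h | h <;> rw [h] <;> simp) (him i), poleFlow, mul_div_assoc]
    ring
  rw [Finset.sum_congr rfl fun i _ => hs i, ← Finset.mul_sum, ← he]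
  have he0 : e ≠ 0 := Complex.exp_ne_zero _
  rw [hwe]
  field_simp

/-- Gaussian transforms are holomorphic. -/
theorem hasDerivAt_gaussTransform {Φ : ℝ → ℂ} (hΦ : Continuous Φ) {K C : ℝ}
    (hb : ∀ y, ‖Φ y‖ ≤ K * Real.exp (C * y ^ 2)) {v : ℂ} (hv : C < v.re) :
    IntegrableOn (fun y : ℝ => Φ y * Complex.exp (-v * y ^ 2)) (Ioi 0) ∧
    DifferentiableAt ℂ (fun v : ℂ => ∫ y in Ioi (0 : ℝ), Φ y * Complex.exp (-v * y ^ 2)) v := by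
  set b := (v.re - C) / 2 with hbdef
  have hb0 : 0 < b := by rw [hbdef]; linarith
  have hK : 0 ≤ K := by
    have := (norm_nonneg _).trans (hb 0)
    simpa using this
  have hbi : IntegrableOn (fun y : ℝ => K * Real.exp (-b * y ^ 2)) (Ioi 0) :=
    ((integrable_exp_neg_mul_sq hb0).const_mul K).integrableOn
  have hbound : ∀ (y : ℝ), ∀ x ∈ Metric.ball v b, ‖Φ y * Complex.exp (-x * y ^ 2)‖ ≤
      K * Real.exp (-b * y ^ 2) := by
    intro y x hx
    have h1 : C + b ≤ x.re := by
      have h2 := Complex.abs_re_le_norm (x - v)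
      rw [Complex.sub_re] at h2
      have h3 := mem_ball_iff_norm.1 hx
      have h4 := (abs_le.1 h2).1
      rw [hbdef] at *
      linarith
    rw [norm_mul, Complex.norm_exp, show (-x * (y : ℂ) ^ 2) = -x * ((y ^ 2 : ℝ) : ℂ) by push_cast; rfl,
      Complex.re_mul_ofReal, Complex.neg_re]
    calc _ ≤ K * Real.exp (C * y ^ 2) * Real.exp (-x.re * y ^ 2) := by gcongr; exact hb y
      _ = K * Real.exp (C * y ^ 2 + -x.re * y ^ 2) := by rw [Real.exp_add]; ring
      _ ≤ _ := by
        refine mul_le_mul_of_nonneg_left (Real.exp_le_exp.2 ?_) hK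
        nlinarith [sq_nonneg y]
  refine ⟨Integrable.mono' hbi (by fun_prop)
    (Eventually.of_forall fun y => hbound y v (Metric.mem_ball_self hb0)), ?_⟩
  refine (hasDerivAt_integral_of_bounded (F := fun v (y : ℝ) => Φ y * Complex.exp (-v * y ^ 2))
    (F' := fun v (y : ℝ) => Φ y * (Complex.exp (-v * y ^ 2) * -(y : ℂ) ^ 2)) hb0
    (fun x _ => by fun_prop) (by fun_prop)
    (Eventually.of_forall hbound) hbi
    (Eventually.of_forall fun y x _ => ?_)).2.differentiableAt
  have := (((hasDerivAt_id x).neg.mul_const ((y : ℂ) ^ 2)).cexp).const_mul (Φ y)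
  convert! this using 1
  simp

theorem heatIntegrand_eq (φ : ℂ → ℂ) (θ : ℝ) (w z : ℂ) (y : ℝ) : heatIntegrand φ θ w z y =
    (φ (z + y * Complex.exp (Complex.I * θ / 2)) + φ (z - y * Complex.exp (Complex.I * θ / 2))) *
      Complex.exp (-(Complex.exp (Complex.I * θ) / (4 * w ^ 2)) * y ^ 2) := by
  rw [heatIntegrand, mul_pow, exp_half_sq]
  congr 2
  ring

/-- The real part is `cos(θ-ψ)/(4R)` with `|θ-ψ| < π/2 - ε/2`. It is the Gaussian decay rate, which
becomes arbitrarily large as `r` shrinks. -/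
theorem re_exp_div_sector {ε r θ : ℝ} (hε : ε ∈ Ioo 0 π) {w : ℂ} (hw : w ∈ sector θ (π - ε) r) :
    Real.sin (ε / 2) / (4 * r) ≤ (Complex.exp (Complex.I * θ) / (4 * w ^ 2)).re := by
  obtain ⟨R, hR, ψ, hψ, rfl⟩ := hw
  have hR0 : (R : ℂ) ≠ 0 := by exact_mod_cast hR.1.ne'
  have h : Complex.exp (Complex.I * θ) / (4 * pt R ψ ^ 2) =
      ((1 / (4 * R) : ℝ) : ℂ) * Complex.exp ((θ - ψ : ℝ) * Complex.I) := by
    rw [pt_sq hR.1.le, show ((θ - ψ : ℝ) * Complex.I : ℂ) = Complex.I * θ + -(Complex.I * ψ) by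
      push_cast; ring, Complex.exp_add, Complex.exp_neg]
    have := Complex.exp_ne_zero (Complex.I * ψ)
    push_cast
    field_simp
  rw [h, Complex.re_ofReal_mul, Complex.exp_ofReal_mul_I_re]
  have hcos : Real.sin (ε / 2) ≤ Real.cos (θ - ψ) := by
    rw [← Real.cos_pi_div_two_sub, ← Real.cos_abs (θ - ψ)]
    have h3 : |θ - ψ| ≤ π / 2 - ε / 2 := by
      rw [abs_le]; constructor <;> linarith [hψ.1, hψ.2]
    exact Real.cos_le_cos_of_nonneg_of_le_pi (abs_nonneg _) (by linarith [hε.1, Real.pi_pos]) h3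
  have hs : 0 < Real.sin (ε / 2) :=
    Real.sin_pos_of_pos_of_lt_pi (by linarith [hε.1]) (by linarith [hε.2, Real.pi_pos])
  have h5 := hR.1
  have h6 := hR.2
  rw [div_eq_mul_inv, mul_comm, one_div]
  gcongr

theorem differentiableAt_stokesSum {a p : ι → ℂ} {f : ℂ → ℂ} {w z : ℂ} (σ : ι → ℝ) (hw : w ≠ 0)
    (hf : DifferentiableAt ℂ (Function.uncurry (heatFlow f)) (w, z)) :
    DifferentiableAt ℂ (Function.uncurry (stokesSum a p f σ)) (w, z) := by
  refine (DifferentiableAt.add ?_ hf : DifferentiableAt ℂ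
    ((fun q : ℂ × ℂ => ∑ i, a i * poleFlow (σ i) (p i) q.1 q.2) +
      Function.uncurry (heatFlow f)) (w, z))
  exact DifferentiableAt.fun_sum fun i _ => (differentiableAt_poleFlow hw (p i) z).const_mul (a i)

theorem tendsto_pt_punctured {R₀ : ℝ} (hR₀ : 0 < R₀) (θ : ℝ) :
    Tendsto (fun R => pt R θ) (𝓝[≠] R₀) (𝓝[≠] (pt R₀ θ)) := by
  refine tendsto_nhdsWithin_iff.2 ⟨?_, ?_⟩
  · have : Continuous fun R => pt R θ := by unfold pt; fun_prop
    exact this.continuousAt.tendsto.mono_left nhdsWithin_le_nhds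
  · have h1 : ∀ᶠ R in 𝓝[≠] R₀, 0 < R := (lt_mem_nhds hR₀).filter_mono nhdsWithin_le_nhds
    filter_upwards [h1, self_mem_nhdsWithin] with R hR hne h
    apply hne
    have := congrArg (fun w => ‖w‖ ^ 2) h
    simpa [norm_pt_sq hR.le, norm_pt_sq hR₀.le] using this

/-- On a sector around the direction `θ` the `1`-sum is given by the heat integral in this
direction. -/
theorem stokesSum_eq_heatIntegral (a : ι → ℂ) {p : ι → ℂ} {f : ℂ → ℂ} (hf : EntireGrowthTwo f)
    {σ : ι → ℝ} (hσ : ∀ i, σ i = 1 ∨ σ i = -1) {θ : ℝ} (hθ : ∀ i, 0 < σ i * side (p i) θ)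
    {ε : ℝ} (hε : 0 < ε) : ∃ r > 0, ∃ ρ > 0, ∀ w ∈ sector θ (π - ε) r,
      ∀ z ∈ Metric.ball (0 : ℂ) ρ,
        IntegrableOn (heatIntegrand (poleDatum a p f) θ w z) (Ioi 0) ∧
        stokesSum a p f σ w z = heatIntegral (poleDatum a p f) θ w z := by
  wlog hεπ : ε < π generalizing ε
  -- For `ε ≥ π` the sector is contained in the one for `π/2`.
  · obtain ⟨r, hr, ρ, hρ, h⟩ := this (ε := π / 2) (by positivity) (by linarith [Real.pi_pos])
    exact ⟨r, hr, ρ, hρ, fun w hw => h w (sector_mono θ (by linarith [Real.pi_pos]) le_rfl hw)⟩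
  obtain ⟨r₁, hr₁, hflow⟩ := heatFlow_regular hf
  have hside : ∀ i, side (p i) θ ≠ 0 := fun i h0 => by
    have := hθ i; rw [h0, mul_zero] at this; exact lt_irrefl _ this
  obtain ⟨κ, hκ, ε₁, hε₁, hmargin⟩ := exists_side_margin hside
  have hκi : ∀ i, κ ≤ |side (p i) θ| := hmargin θ ⟨by linarith, by linarith⟩
  have hκσ : ∀ i, κ ≤ σ i * side (p i) θ := by
    intro i
    have h1 : |σ i| = 1 := by rcases hσ i with h | h <;> rw [h] <;> simp
    have := hκi i
    rwa [← one_mul |side (p i) θ|, ← h1, ← abs_mul, abs_of_pos (hθ i)] at this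
  obtain ⟨hfd, C₁, C₂, hC1, hC2, hfb⟩ := hf
  have hsin : 0 < Real.sin (ε / 2) :=
    Real.sin_pos_of_pos_of_lt_pi (by linarith) (by linarith [Real.pi_pos])
  -- This makes the decay rate at least `2 C₂ + 1`, more than the growth rate `2 C₂` of the datum
  -- along the path.
  set r := min r₁ (Real.sin (ε / 2) / (4 * (2 * C₂ + 1))) with hrdef
  have hr : 0 < r := lt_min hr₁ (by positivity)
  refine ⟨r, hr, κ / 2, half_pos hκ, ?_⟩
  suffices H : ∀ z ∈ Metric.ball (0 : ℂ) (κ / 2), ∀ w ∈ sector θ (π - ε) r,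
      IntegrableOn (heatIntegrand (poleDatum a p f) θ w z) (Ioi 0) ∧
      stokesSum a p f σ w z = heatIntegral (poleDatum a p f) θ w z from
    fun w hw z hz => H z hz w hw
  intro z hz
  rw [mem_ball_zero_iff] at hz
  set e := Complex.exp (Complex.I * θ / 2) with he
  have hen : ‖e‖ = 1 := norm_exp_I_mul_half θ
  have hlow : ∀ (i : ι) (y : ℝ), κ / 2 ≤ ‖z + y * e - p i‖ := by
    intro i y
    have := abs_side_sub_le (p i) z y θ
    linarith [hκi i]
  have hne : ∀ (i : ι) (y : ℝ), z + y * e - p i ≠ 0 := by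
    intro i y h0
    have := hlow i y
    rw [h0, norm_zero] at this
    linarith
  have hcont1 : Continuous fun y : ℝ => poleDatum a p f (z + y * e) := by
    unfold poleDatum
    have := hfd.continuous
    refine Continuous.add (continuous_finsetSum _ fun i _ => ?_) (by fun_prop)
    exact Continuous.div (by fun_prop) (by fun_prop) (hne i)
  set Φ : ℝ → ℂ := fun y => poleDatum a p f (z + y * e) + poleDatum a p f (z - y * e) with hΦ
  have hneg : ∀ y : ℝ, poleDatum a p f (z - y * e) =
      poleDatum a p f (z + ((-y : ℝ) : ℂ) * e) := by
    intro y; congr 1; push_cast; ring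
  have hΦc : Continuous Φ := by
    rw [hΦ]
    simp_rw [hneg]
    exact hcont1.add (hcont1.comp continuous_neg)
  set K := (∑ i, ‖a i‖ / (κ / 2)) + C₁ * Real.exp (2 * C₂ * (κ / 2) ^ 2) with hK
  have hS0 : 0 ≤ ∑ i, ‖a i‖ / (κ / 2) := Finset.sum_nonneg fun i _ => by positivity
  have hφb : ∀ y : ℝ, ‖poleDatum a p f (z + y * e)‖ ≤ K * Real.exp (2 * C₂ * y ^ 2) := by
    intro y
    have h1 : 1 ≤ Real.exp (2 * C₂ * y ^ 2) := Real.one_le_exp (by positivity)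
    have h2 : ‖∑ i, a i / (z + y * e - p i)‖ ≤ ∑ i, ‖a i‖ / (κ / 2) := by
      refine (norm_sum_le _ _).trans (Finset.sum_le_sum fun i _ => ?_)
      rw [norm_div]
      gcongr
      exact hlow i y
    have h3 : ‖f (z + y * e)‖ ≤
        C₁ * Real.exp (2 * C₂ * (κ / 2) ^ 2) * Real.exp (2 * C₂ * y ^ 2) := by
      refine (hfb _).trans ?_
      rw [mul_assoc, ← Real.exp_add]
      refine mul_le_mul_of_nonneg_left (Real.exp_le_exp.2 ?_) hC1.le
      have h4 : ‖z + y * e‖ ≤ κ / 2 + |y| := by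
        refine (norm_add_le _ _).trans ?_
        rw [norm_mul, hen, mul_one, Complex.norm_real, Real.norm_eq_abs]
        linarith
      have h5 : ‖z + y * e‖ ^ 2 ≤ 2 * (κ / 2) ^ 2 + 2 * y ^ 2 := by
        have : ‖z + y * e‖ ^ 2 ≤ (κ / 2 + |y|) ^ 2 := by gcongr
        rw [← sq_abs y]
        nlinarith [sq_nonneg (κ / 2 - |y|)]
      nlinarith
    rw [poleDatum, hK, add_mul]
    refine (norm_add_le _ _).trans (add_le_add (h2.trans ?_) h3)
    exact le_mul_of_one_le_right hS0 h1
  have hΦb : ∀ y, ‖Φ y‖ ≤ (2 * K) * Real.exp ((2 * C₂) * y ^ 2) := by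
    intro y
    have h1 := hφb y
    have h2 := hφb (-y)
    rw [← hneg, neg_sq] at h2
    exact (norm_add_le _ _).trans (by linarith)
  have hv : ∀ w ∈ sector θ (π - ε) r, 2 * C₂ < (Complex.exp (Complex.I * θ) / (4 * w ^ 2)).re := by
    intro w hw
    have h1 := re_exp_div_sector ⟨hε, hεπ⟩ hw
    have h2 : r ≤ Real.sin (ε / 2) / (4 * (2 * C₂ + 1)) := min_le_right _ _
    rw [le_div_iff₀ (by positivity)] at h2
    have h3 : 2 * C₂ + 1 ≤ Real.sin (ε / 2) / (4 * r) := by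
      rw [le_div_iff₀ (by positivity)]; linarith
    linarith
  have hint : ∀ w, heatIntegrand (poleDatum a p f) θ w z = fun y : ℝ =>
      Φ y * Complex.exp (-(Complex.exp (Complex.I * θ) / (4 * w ^ 2)) * y ^ 2) := by
    intro w; ext y; exact heatIntegrand_eq _ _ _ _ _
  have hopen : IsOpen (sector θ (π - ε) r) := isOpen_arcSector _ _ _
  have hA : AnalyticOnNhd ℂ (fun w => stokesSum a p f σ w z) (sector θ (π - ε) r) := by
    refine DifferentiableOn.analyticOnNhd (fun w hw => ?_) hopen
    have h1 := differentiableAt_stokesSum (a := a) (p := p) σ (ne_zero_of_mem_arcSector hw)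
      (hflow w ((norm_sq_lt_of_mem_arcSector hw).trans_le (min_le_left _ _)) z).1
    exact (h1.comp (f := fun w => (w, z)) w (by fun_prop)).differentiableWithinAt
  have hB : AnalyticOnNhd ℂ (fun w => heatIntegral (poleDatum a p f) θ w z)
      (sector θ (π - ε) r) := by
    refine DifferentiableOn.analyticOnNhd (fun w hw => ?_) hopen
    have hw0 : w ≠ 0 := ne_zero_of_mem_arcSector hw
    have h1 := (hasDerivAt_gaussTransform hΦc hΦb (hv w hw)).2
    have h2 : DifferentiableAt ℂ (fun w : ℂ => Complex.exp (Complex.I * θ) / (4 * w ^ 2)) w :=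
      DifferentiableAt.div (by fun_prop) (by fun_prop) (by simpa using hw0)
    have h3 := h1.comp w h2
    have h4 : DifferentiableAt ℂ (fun w : ℂ => ((Real.sqrt (4 * π) : ℂ) * w)⁻¹) w :=
      DifferentiableAt.inv (by fun_prop) (mul_ne_zero sqrt_four_pi_ne_zero hw0)
    refine (h4.mul (h3.const_mul (Complex.exp (Complex.I * θ / 2)))).differentiableWithinAt.congr_of_eventuallyEq ?_ ?_
    · refine Eventually.of_forall fun w => ?_
      simp only [heatIntegral, hint w]
      rfl
    · simp only [heatIntegral, hint w]
      rfl
  have hray : ∀ R ∈ Ioo 0 r, stokesSum a p f σ (pt R θ) z =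
      heatIntegral (poleDatum a p f) θ (pt R θ) z := by
    intro R hR
    refine (heatIntegral_ray hσ hR.1 (fun i => ?_) ?_).symm
    · have h1 := le_im_pole_arg (hσ i) (hκσ i) z R θ
      have h2 : 0 < (κ - ‖z‖) / Real.sqrt R := div_pos (by linarith) (Real.sqrt_pos.2 hR.1)
      have h3 := h2.trans_le h1
      simpa using h3
    · refine (hflow _ ?_ z).2.2.2.2
      rw [norm_pt_sq hR.1.le]
      exact hR.2.trans_le (min_le_left _ _)
  have hr2 : r / 2 ∈ Ioo 0 r := ⟨by linarith, by linarith⟩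
  -- Both sides are holomorphic in `w` on the connected sector and agree on its bisecting ray, which
  -- accumulates at an interior point; the identity theorem does the rest.
  have hfreq : ∃ᶠ w in 𝓝[≠] (pt (r / 2) θ), stokesSum a p f σ w z =
      heatIntegral (poleDatum a p f) θ w z := by
    refine (tendsto_pt_punctured hr2.1 θ).frequently (Eventually.frequently ?_)
    have : ∀ᶠ R in 𝓝[≠] (r / 2), R ∈ Ioo 0 r :=
      Eventually.filter_mono nhdsWithin_le_nhds (Ioo_mem_nhds hr2.1 hr2.2)
    exact this.mono hray
  have heq := hA.eqOn_of_preconnected_of_frequently_eq hB (isPreconnected_arcSector _ _ _)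
    (pt_mem_sector (by linarith) hr2) hfreq
  intro w hw
  refine ⟨?_, heq hw⟩
  rw [hint w]
  exact (hasDerivAt_gaussTransform hΦc hΦb (hv w hw)).1

/-- On the ray the Borel transform is the even part of the datum, so the Ecalle transform is the
heat integral, which `stokesSum` equals. All that remains is to shrink the radii and openings to
common values. -/
theorem isOneSum_stokesSum (a : ι → ℂ) {p : ι → ℂ} {f : ℂ → ℂ} (hf : EntireGrowthTwo f)
    (hp : ∀ i, p i ≠ 0) {σ : ι → ℝ} (hσ : ∀ i, σ i = 1 ∨ σ i = -1) {θ : ℝ}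
    (hθ : ∀ i, 0 < σ i * side (p i) θ) :
    IsOneSum (formalSolution (poleDatum a p f)) θ (stokesSum a p f σ) := by
  have hside : ∀ i, side (p i) θ ≠ 0 := fun i h0 => by
    have := hθ i; rw [h0, mul_zero] at this; exact lt_irrefl _ this
  obtain ⟨ε, hε, ρ, hρ, hG, hB⟩ := isBorelTransform_borelFun a hf hp hside
  obtain ⟨κ, hκ, ε₁, hε₁, hmargin⟩ := exists_side_margin hside
  obtain ⟨r, hr, ρ', hρ', heq⟩ :=
    stokesSum_eq_heatIntegral a hf hσ hθ (ε := π / 2) (by positivity)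
  set ε₂ := min ε (π / 2) with hε₂
  set ρ₂ := min ρ (min ρ' κ) with hρ₂
  have hρ2 : 0 < ρ₂ := lt_min hρ (lt_min hρ' hκ)
  have hsub : Metric.ball (0 : ℂ) ρ₂ ⊆ Metric.ball 0 ρ :=
    Metric.ball_subset_ball (min_le_left _ _)
  have hε2 : 0 < ε₂ := lt_min hε (by positivity)
  refine ⟨ε₂, ρ₂, r, hε2, hρ2, hr, ⟨fun n => (hG.1 n).mono hsub, ?_⟩,
    borelFun a p f, ⟨?_, ?_⟩, ?_⟩
  · obtain ⟨A, B, hA, hB', h⟩ := hG.2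
    exact ⟨A, B, hA, hB', fun n z hz => h n z (hsub hz)⟩
  · obtain ⟨η, hη, hh, hs⟩ := hB.continuation
    exact ⟨η, hη, hh.mono (prod_mono (union_subset_union_right _
      (borelSector_mono θ (min_le_left _ _))) hsub), fun s hs' z hz => hs s hs' z (hsub hz)⟩
  · intro ε' h0 h1
    obtain ⟨c₁, c₂, hc1, hc2, h⟩ := hB.growth ε' h0 (h1.trans_le (min_le_left _ _))
    exact ⟨c₁, c₂, hc1, hc2, fun s hs z hz => h s hs z (hsub hz)⟩
  · intro w hw z hz
    have hz2 : ‖z‖ < min ρ' κ := (mem_ball_zero_iff.1 hz).trans_le (min_le_right _ _)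
    rw [(heq w (sector_mono θ (by linarith [min_le_right ε (π / 2)]) le_rfl hw) z
      (mem_ball_zero_iff.2 (hz2.trans_le (min_le_left _ _)))).2]
    refine (ecalle_eq_heatIntegral w fun y _ => ?_).symm
    have hne : ∀ (i : ι) (y : ℝ), z + y * Complex.exp (Complex.I * θ / 2) - p i ≠ 0 := by
      intro i y h0
      have h1 := abs_side_sub_le (p i) z y θ
      rw [h0, norm_zero] at h1
      linarith [hmargin θ ⟨by linarith, by linarith⟩ i, hz2.trans_le (min_le_right ρ' κ)]
    rw [← borelFun_sq (fun i => hne i y) (fun i => by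
      have := hne i (-y)
      rw [Complex.ofReal_neg, neg_mul, ← sub_eq_add_neg] at this
      exact this), mul_pow, exp_half_sq]

/-! ### Borel sums are actual solutions -/

theorem stokesSum_heat {a p : ι → ℂ} {f : ℂ → ℂ} {σ : ι → ℝ} (hσ : ∀ i, σ i = 1 ∨ σ i = -1)
    {w : ℂ} (hw : w ≠ 0)
    (h1 : ∀ z, HasDerivAt (heatFlow f w) (heatFlow (deriv f) w z) z)
    (h2 : ∀ z, HasDerivAt (heatFlow (deriv f) w) (heatFlow (deriv (deriv f)) w z) z) (z : ℂ)
    (h3 : HasDerivAt (fun w => heatFlow f w z) (2 * w * heatFlow (deriv (deriv f)) w z) w) :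
    (2 * w)⁻¹ * deriv (fun w' => stokesSum a p f σ w' z) w =
      iteratedDeriv 2 (stokesSum a p f σ w) z := by
  have hs : ∀ i, ((σ i : ℂ)) ^ 2 = 1 := by
    intro i; rcases hσ i with h | h <;> rw [h] <;> simp
  have e1 : deriv (fun w' => stokesSum a p f σ w' z) w =
      (∑ i, a i * (2 * w * poleFlowDeriv2 (σ i) (p i) w z)) +
        2 * w * heatFlow (deriv (deriv f)) w z :=
    ((HasDerivAt.fun_sum fun i _ =>
      (hasDerivAt_poleFlow_fst hw (p i) z).const_mul (a i)).add h3).deriv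
  have e2 : deriv (stokesSum a p f σ w) = fun z =>
      (∑ i, a i * poleFlowDeriv (σ i) (p i) w z) + heatFlow (deriv f) w z := by
    ext z
    exact ((HasDerivAt.fun_sum fun i _ =>
      (hasDerivAt_poleFlow_snd (hs i) hw (p i) z).const_mul (a i)).add (h1 z)).deriv
  have e3 : deriv (deriv (stokesSum a p f σ w)) z =
      (∑ i, a i * poleFlowDeriv2 (σ i) (p i) w z) + heatFlow (deriv (deriv f)) w z := by
    rw [e2]
    exact ((HasDerivAt.fun_sum fun i _ =>
      (hasDerivAt_poleFlowDeriv hw (p i) z).const_mul (a i)).add (h2 z)).deriv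
  rw [iteratedDeriv_succ, iteratedDeriv_one, e3, e1, mul_add, Finset.mul_sum]
  congr 1
  · refine Finset.sum_congr rfl fun i _ => ?_
    field_simp
  · field_simp

/-- Here `cos² β - sin² β = cos 2β > 0`. The angle `β` will be half of a difference `ψ - θ` smaller
than `π/2`. -/
theorem abs_im_lt_re_exp {β : ℝ} (hβ : |β| < π / 4) :
    |(Complex.exp (β * Complex.I)).im| < (Complex.exp (β * Complex.I)).re := by
  rw [Complex.exp_ofReal_mul_I_re, Complex.exp_ofReal_mul_I_im]
  have h := abs_lt.1 hβ
  have hπ := Real.pi_pos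
  have h1 : 0 < Real.cos β := Real.cos_pos_of_mem_Ioo ⟨by linarith, by linarith⟩
  have h2 : 0 < Real.cos (2 * β) := Real.cos_pos_of_mem_Ioo ⟨by linarith, by linarith⟩
  rw [Real.cos_two_mul'] at h2
  exact abs_lt_of_sq_lt_sq (by linarith) h1.le

/-- The difference is `(ζ plasma ζ + 1)/(p - z)` with `ζ = σ(p-z)/w`. As `|ζ|` and the lower bound
for the imaginary part both scale like `R^(-1/2)`, the asymptotics of `plasma` give an error of
order `R = |t|`. -/
theorem norm_poleFlow_sub_le {σ κ : ℝ} (hσ : σ = 1 ∨ σ = -1) {p z : ℂ} {R ψ θ : ℝ} (hR : 0 < R)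
    (hψ : |ψ - θ| < π / 2) (hκ : κ ≤ σ * side p θ) (hz : ‖z‖ < κ) (hzp : z ≠ p) :
    ‖poleFlow σ p (pt R ψ) z - 1 / (z - p)‖ ≤ 2 / (κ - ‖z‖) ^ 3 * R := by
  set c := Complex.exp (Complex.I * (ψ - θ : ℝ) / 2) with hc
  set w := pt R ψ with hw
  set ζ : ℂ := σ * (p - z) / w with hζ
  have hRs : 0 < Real.sqrt R := Real.sqrt_pos.2 hR
  have hw0 : w ≠ 0 := pt_ne_zero hR ψ
  have hpz : p - z ≠ 0 := sub_ne_zero.2 hzp.symm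
  have hzp' : z - p ≠ 0 := sub_ne_zero.2 hzp
  have him : (κ - ‖z‖) / Real.sqrt R ≤ (ζ * c).im := le_im_pole_arg hσ hκ z R ψ
  have hpos : 0 < (κ - ‖z‖) / Real.sqrt R := div_pos (by linarith) hRs
  have hc' : c = Complex.exp (((ψ - θ) / 2 : ℝ) * Complex.I) := by
    rw [hc]; congr 1; push_cast; ring
  have hcre : |c.im| < c.re := by
    rw [hc']
    apply abs_im_lt_re_exp
    rw [abs_div, abs_two]
    linarith
  have key := plasma_asymptotics (ζ := ζ) (c := c) (norm_exp_I_mul_half _) hcre (hpos.trans_le him)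
  have hζn : ‖ζ‖ = ‖p - z‖ / Real.sqrt R := by
    have : ‖(σ : ℂ)‖ = 1 := by rcases hσ with h | h <;> rw [h] <;> simp
    rw [hζ, norm_div, norm_mul, this, one_mul, hw, norm_pt]
  have heq : poleFlow σ p w z - 1 / (z - p) = (ζ * plasma ζ + 1) / (p - z) := by
    rw [poleFlow, ← hζ, show (σ : ℂ) / w = ζ / (p - z) by rw [hζ]; field_simp]
    rw [← neg_sub p z]
    field_simp
    ring
  have hpz' : 0 < ‖p - z‖ := norm_pos_iff.2 hpz
  rw [heq, norm_div, div_le_iff₀ hpz']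
  refine key.trans ?_
  have hR3 : Real.sqrt R ^ 2 = R := Real.sq_sqrt hR.le
  calc 2 * ‖ζ‖ / (ζ * c).im ^ 3 ≤ 2 * ‖ζ‖ / ((κ - ‖z‖) / Real.sqrt R) ^ 3 := by gcongr
    _ = 2 / (κ - ‖z‖) ^ 3 * R * ‖p - z‖ := by
      have : κ - ‖z‖ ≠ 0 := by linarith
      have h : 2 * (‖p - z‖ / Real.sqrt R) / ((κ - ‖z‖) / Real.sqrt R) ^ 3 =
          2 / (κ - ‖z‖) ^ 3 * Real.sqrt R ^ 2 * ‖p - z‖ := by field_simp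
      rw [hζn, h, hR3]
    _ ≤ _ := le_rfl

/-- The path direction `θ` may vary with `w`, and only the margin `κ` must be common. This gives the
limit on a whole wide sector, which no single path direction would cover. -/
theorem tendsto_stokesSum {a p : ι → ℂ} {f : ℂ → ℂ} {σ : ι → ℝ} (hσ : ∀ i, σ i = 1 ∨ σ i = -1)
    {κ : ℝ} {S : Set ℂ} (hS : ∀ w ∈ S, ∃ R ψ θ : ℝ, 0 < R ∧ w = pt R ψ ∧ |ψ - θ| < π / 2 ∧
      ∀ i, κ ≤ σ i * side (p i) θ) {z : ℂ} (hz : ‖z‖ < κ) (hzp : ∀ i, z ≠ p i)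
    (hf : DifferentiableAt ℂ (Function.uncurry (heatFlow f)) (0, z)) :
    Tendsto (fun w => stokesSum a p f σ w z) (𝓝[S] 0) (𝓝 (poleDatum a p f z)) := by
  refine Tendsto.add (tendsto_finsetSum _ fun i _ => ?_) ?_
  · rw [← mul_one_div]
    refine Tendsto.const_mul _ ?_
    rw [tendsto_iff_norm_sub_tendsto_zero]
    refine squeeze_zero' (Eventually.of_forall fun _ => norm_nonneg _)
      (g := fun w : ℂ => 2 / (κ - ‖z‖) ^ 3 * ‖w‖ ^ 2) ?_ ?_
    · filter_upwards [self_mem_nhdsWithin] with w hw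
      obtain ⟨R, ψ, θ, hR, rfl, h1, h2⟩ := hS w hw
      rw [norm_pt_sq hR.le]
      exact norm_poleFlow_sub_le (hσ i) hR h1 (h2 i) hz (hzp i)
    · have : Continuous fun w : ℂ => 2 / (κ - ‖z‖) ^ 3 * ‖w‖ ^ 2 := by fun_prop
      have h := this.tendsto 0
      simp only [norm_zero, ne_eq, OfNat.ofNat_ne_zero, not_false_eq_true, zero_pow, mul_zero] at h
      exact h.mono_left nhdsWithin_le_nhds
  · have h1 : ContinuousAt (fun w => heatFlow f w z) 0 :=
      hf.continuousAt.comp (f := fun w : ℂ => (w, z)) (by fun_prop)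
    have h2 := h1.tendsto
    simp only [heatFlow_zero] at h2
    exact h2.mono_left nhdsWithin_le_nhds

/-! ### Differences of Borel sums -/

/-- The reflection identity of `plasma`; the factor `(σ-τ)/2`, equal to `0` or `±1`, treats all sign
changes at once. -/
theorem poleFlow_sub_poleFlow {σ τ : ℝ} (hσ : σ = 1 ∨ σ = -1) (hτ : τ = 1 ∨ τ = -1) (p w z : ℂ) :
    poleFlow σ p w z - poleFlow τ p w z = ((σ - τ) / 2 : ℝ) *
      (Complex.I * ((Real.sqrt π : ℂ) / w * Complex.exp (-(p - z) ^ 2 / (4 * w ^ 2)))) := by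
  have h := plasma_add_plasma_neg ((p - z) / w)
  rw [show -((p - z) / w) ^ 2 / 4 = -(p - z) ^ 2 / (4 * w ^ 2) by ring] at h
  have h1 : poleFlow ((1 : ℝ) : ℂ) p w z - poleFlow ((-1 : ℝ) : ℂ) p w z =
      Complex.I * ((Real.sqrt π : ℂ) / w * Complex.exp (-(p - z) ^ 2 / (4 * w ^ 2))) := by
    rw [poleFlow, poleFlow]
    push_cast
    rw [one_mul, show -1 * (p - z) / w = -((p - z) / w) by ring]
    linear_combination (1 / w) * h
  rcases hσ with rfl | rfl <;> rcases hτ with rfl | rfl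
  · simp
  · rw [h1]; norm_num
  · rw [← neg_sub, h1]; norm_num
  · simp

theorem stokesSum_sub_stokesSum (a p : ι → ℂ) (f : ℂ → ℂ) {σ τ : ι → ℝ}
    (hσ : ∀ i, σ i = 1 ∨ σ i = -1) (hτ : ∀ i, τ i = 1 ∨ τ i = -1) (w z : ℂ) :
    stokesSum a p f σ w z - stokesSum a p f τ w z =
      ∑ i, ((σ i - τ i) / 2 : ℝ) * (Complex.I * ((Real.sqrt π : ℂ) / w *
        (a i * Complex.exp (-(p i - z) ^ 2 / (4 * w ^ 2))))) := by
  rw [stokesSum, stokesSum, add_sub_add_right_eq_sub, ← Finset.sum_sub_distrib]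
  refine Finset.sum_congr rfl fun i _ => ?_
  rw [← mul_sub, poleFlow_sub_poleFlow (hσ i) (hτ i)]
  ring

/-- Exponentials with distinct exponents are linearly independent. -/
theorem exp_coeff_eq_zero {l b : ι → ℂ} (hl : Function.Injective l)
    (h : ∀ z : ℂ, ∑ i, b i * Complex.exp (l i * z) = 0) (i : ι) : b i = 0 := by
  -- The exponentials are characters of the additive group, so Dedekind's independence of characters
  -- applies once they are known to be distinct, which their derivatives at `0` show.
  let χ : ι → Multiplicative ℂ →* ℂ := fun i =>
    { toFun := fun z => Complex.exp (l i * z.toAdd)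
      map_one' := by simp
      map_mul' := fun x y => by simp [mul_add, Complex.exp_add] }
  have hχ : Function.Injective χ := by
    intro i j hij
    apply hl
    have h1 : (fun z : ℂ => Complex.exp (l i * z)) = fun z => Complex.exp (l j * z) := by
      ext z
      exact DFunLike.congr_fun hij (Multiplicative.ofAdd z)
    have hd : ∀ k, HasDerivAt (fun z : ℂ => Complex.exp (l k * z)) (l k) 0 := by
      intro k
      have := ((hasDerivAt_id (0 : ℂ)).const_mul (l k)).cexp
      simpa using this
    exact (hd i).unique (h1 ▸ hd j)
  have hli := (linearIndependent_monoidHom (Multiplicative ℂ) ℂ).comp χ hχ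
  rw [Fintype.linearIndependent_iff] at hli
  refine hli b ?_ i
  ext z
  simpa [χ] using h z.toAdd

/-- At a fixed `w` the difference is entire in `z`, so equality on a disc would hold everywhere.
Removing the common factor `exp(-z²/(4w²))` leaves exponentials with the distinct exponents `p_i
z/(2w²)`, whose coefficients must all vanish. -/
theorem stokesSum_ne {a p : ι → ℂ} {f : ℂ → ℂ} (ha : ∀ i, a i ≠ 0) (hp : Function.Injective p)
    {σ τ : ι → ℝ} (hσ : ∀ i, σ i = 1 ∨ σ i = -1) (hτ : ∀ i, τ i = 1 ∨ τ i = -1) (hne : σ ≠ τ)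
    {w : ℂ} (hw : w ≠ 0) {ρ : ℝ} (hρ : 0 < ρ) :
    ¬ ∀ z ∈ Metric.ball (0 : ℂ) ρ, stokesSum a p f σ w z = stokesSum a p f τ w z := by
  intro h
  set D : ℂ → ℂ := fun z => ∑ i, ((σ i - τ i) / 2 : ℝ) * (Complex.I * ((Real.sqrt π : ℂ) / w *
        (a i * Complex.exp (-(p i - z) ^ 2 / (4 * w ^ 2))))) with hD
  have hDd : Differentiable ℂ D := by rw [hD]; fun_prop
  have hD0 : D = 0 := by
    have h1 : AnalyticOnNhd ℂ D univ := hDd.differentiableOn.analyticOnNhd isOpen_univ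
    refine h1.eq_of_eventuallyEq (z₀ := 0) (fun _ _ => analyticAt_const) ?_
    filter_upwards [Metric.ball_mem_nhds (0 : ℂ) hρ] with z hz
    rw [hD]
    simp only [← stokesSum_sub_stokesSum a p f hσ hτ, h z hz, sub_self, Pi.zero_apply]
  have hl : Function.Injective fun i => p i / (2 * w ^ 2) := by
    intro i j hij
    apply hp
    have : (2 * w ^ 2 : ℂ) ≠ 0 := by simp [hw]
    simpa [div_left_inj' this] using hij
  have hb := exp_coeff_eq_zero (b := fun i => ((σ i - τ i) / 2 : ℝ) * (Complex.I *
    ((Real.sqrt π : ℂ) / w * (a i * Complex.exp (-(p i) ^ 2 / (4 * w ^ 2)))))) hl (fun z => by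
      have h1 := congrFun hD0 z
      simp only [hD, Pi.zero_apply] at h1
      have h2 : Complex.exp (z ^ 2 / (4 * w ^ 2)) * ∑ i, ((σ i - τ i) / 2 : ℝ) * (Complex.I *
        ((Real.sqrt π : ℂ) / w * (a i * Complex.exp (-(p i - z) ^ 2 / (4 * w ^ 2))))) = 0 := by
        rw [h1, mul_zero]
      rw [← h2, Finset.mul_sum]
      refine Finset.sum_congr rfl fun i _ => ?_
      have h3 : Complex.exp (-(p i) ^ 2 / (4 * w ^ 2)) * Complex.exp (p i / (2 * w ^ 2) * z) =
          Complex.exp (z ^ 2 / (4 * w ^ 2)) * Complex.exp (-(p i - z) ^ 2 / (4 * w ^ 2)) := by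
        rw [← Complex.exp_add, ← Complex.exp_add]
        congr 1
        field_simp
        ring
      linear_combination (((σ i - τ i) / 2 : ℝ) * (Complex.I *
        ((Real.sqrt π : ℂ) / w * a i)) : ℂ) * h3)
  apply hne
  ext i
  have h1 := hb i
  have hsπ : (Real.sqrt π : ℂ) ≠ 0 := by
    have : 0 < Real.sqrt π := by positivity
    exact_mod_cast this.ne'
  have h2 : (Complex.I * ((Real.sqrt π : ℂ) / w *
      (a i * Complex.exp (-(p i) ^ 2 / (4 * w ^ 2))))) ≠ 0 :=
    mul_ne_zero Complex.I_ne_zero (mul_ne_zero (div_ne_zero hsπ hw)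
      (mul_ne_zero (ha i) (Complex.exp_ne_zero _)))
  have h3 := (mul_eq_zero.1 h1).resolve_right h2
  have h4 : (σ i - τ i) / 2 = 0 := by exact_mod_cast h3
  linarith

/-! ### Uniqueness of Borel sums -/

/-- The Ecalle transform sees the Borel transform only along the ray, where any two continuations
agree by `IsBorelTransform.eqOn_ray`. -/
theorem IsOneSum.eventually_eq {c : ℕ → ℂ → ℂ} {d : ℝ} {u v : ℂ → ℂ → ℂ} (hu : IsOneSum c d u)
    (hv : IsOneSum c d v) : ∃ α > 0, ∃ r > 0, ∃ ρ > 0, ∀ w ∈ sector d α r,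
      ∀ z ∈ Metric.ball (0 : ℂ) ρ, u w z = v w z := by
  obtain ⟨ε, ρ, r, hε, hρ, hr, -, g, hg, hug⟩ := hu
  obtain ⟨ε', ρ', r', hε', hρ', hr', -, g', hg', hvg⟩ := hv
  refine ⟨min ε ε', lt_min hε hε', min r r', lt_min hr hr', min ρ ρ', lt_min hρ hρ',
    fun w hw z hz => ?_⟩
  have hz1 := Metric.ball_subset_ball (min_le_left ρ ρ') hz
  have hz2 := Metric.ball_subset_ball (min_le_right ρ ρ') hz
  rw [hug w (sector_mono d (min_le_left _ _) (min_le_left _ _) hw) z hz1,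
    hvg w (sector_mono d (min_le_right _ _) (min_le_right _ _) hw) z hz2, ecalle, ecalle]
  congr 2
  refine setIntegral_congr_fun measurableSet_Ioi fun y hy => ?_
  have hy : 0 < y := hy
  have := hg.eqOn_ray hε hε' hg' hz1 hz2 (R := y ^ 2) (by positivity)
  push_cast at this
  simp only [this]

/-- The local equality spreads by two applications of the identity theorem: in `w` over the sector
for small `z`, then in `z` over the disc for each `w`. -/
theorem IsOneSum.eqOn {c : ℕ → ℂ → ℂ} {d d₀ α r ρ : ℝ} {u v : ℂ → ℂ → ℂ} (hu : IsOneSum c d u)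
    (hv : IsOneSum c d v) (hρ : 0 < ρ) (hd : (ray d ∩ sector d₀ α r).Nonempty)
    (hhu : Holo u (sector d₀ α r) ρ) (hhv : Holo v (sector d₀ α r) ρ) :
    ∀ w ∈ sector d₀ α r, ∀ z ∈ Metric.ball (0 : ℂ) ρ, u w z = v w z := by
  obtain ⟨α', hα', r', hr', ρ', hρ', heq⟩ := hu.eventually_eq hv
  have hopen : IsOpen (sector d₀ α r) := isOpen_arcSector _ _ _
  obtain ⟨w, ⟨R, hR, rfl⟩, R₀, hR₀, ψ, hψ, hRψ⟩ := hd
  have hRR : R = R₀ := by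
    have := congrArg (fun w => ‖w‖ ^ 2) hRψ
    simpa [norm_pt_sq hR.le, norm_pt_sq hR₀.1.le] using this
  subst hRR
  -- `d` itself need not lie in the angular interval of the sector; it agrees with `ψ` only modulo
  -- `4π`.
  have hexp : Complex.exp (Complex.I * d / 2) = Complex.exp (Complex.I * ψ / 2) := by
    have h : (Real.sqrt R : ℂ) ≠ 0 := by exact_mod_cast (Real.sqrt_pos.2 hR).ne'
    exact mul_left_cancel₀ h hRψ
  set R' := min R (r' / 2) with hR'
  have hR'0 : 0 < R' := lt_min hR (by linarith)
  have hmem : pt R' d ∈ sector d₀ α r :=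
    ⟨R', ⟨hR'0, (min_le_left _ _).trans_lt hR₀.2⟩, ψ, hψ, by rw [pt, pt, hexp]⟩
  have hmem' : pt R' d ∈ sector d α' r' :=
    pt_mem_sector hα' ⟨hR'0, (min_le_right _ _).trans_lt (by linarith)⟩
  have hstep : ∀ z ∈ Metric.ball (0 : ℂ) (min ρ ρ'), ∀ w ∈ sector d₀ α r, u w z = v w z := by
    intro z hz w hw
    have hz1 := Metric.ball_subset_ball (min_le_left ρ ρ') hz
    have hz2 := Metric.ball_subset_ball (min_le_right ρ ρ') hz
    refine ((differentiableOn_fst_of_holo hhu hz1).analyticOnNhd hopen).eqOn_of_preconnected_of_eventuallyEq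
      ((differentiableOn_fst_of_holo hhv hz1).analyticOnNhd hopen) (isPreconnected_arcSector _ _ _)
      hmem ?_ hw
    filter_upwards [(isOpen_arcSector _ _ _).mem_nhds hmem'] with w hw
    exact heq w hw z hz2
  intro w hw z hz
  refine ((differentiableOn_snd_of_holo hhu hw).analyticOnNhd Metric.isOpen_ball).eqOn_of_preconnected_of_eventuallyEq
    ((differentiableOn_snd_of_holo hhv hw).analyticOnNhd Metric.isOpen_ball)
    (convex_ball _ _).isPreconnected (Metric.mem_ball_self hρ) ?_ hz
  filter_upwards [Metric.ball_mem_nhds (0 : ℂ) (lt_min hρ hρ')] with z hz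
  exact hstep z hz w hw

/-! ### The singular directions -/

section Directions

variable {n : ℕ} [NeZero n] {δ : Fin n → ℝ}

theorem dir_mul_add (δ : Fin n → ℝ) (q : ℕ) {j : ℕ} (hj : j < n) :
    dir δ (n * q + j) = δ ⟨j, hj⟩ + 2 * π * q := by
  have h1 : (n * q + j) % n = j := by rw [Nat.mul_add_mod, Nat.mod_eq_of_lt hj]
  have h2 : (n * q + j) / n = q := by
    rw [Nat.mul_add_div (NeZero.pos n), Nat.div_eq_of_lt hj, add_zero]
  have h3 : Fin.ofNat n (n * q + j) = ⟨j, hj⟩ := Fin.ext h1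
  rw [dir, h2, h3]

theorem dir_coe (δ : Fin n → ℝ) (l : Fin n) : dir δ l = δ l := by
  simpa using dir_mul_add δ 0 l.2

theorem dir_coe_add (δ : Fin n → ℝ) (l : Fin n) : dir δ (l + n) = δ l + 2 * π := by
  have := dir_mul_add δ 1 l.2
  rw [mul_one, add_comm n] at this
  simpa using this

theorem dir_two_mul (δ : Fin n → ℝ) : dir δ (2 * n) = dir δ 0 + 4 * π := by
  have h1 := dir_mul_add δ 2 (NeZero.pos n)
  have h2 := dir_mul_add δ 0 (NeZero.pos n)
  rw [add_zero, mul_comm n] at h1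
  rw [mul_zero, add_zero] at h2
  rw [h1, h2]; push_cast; ring

theorem strictMono_dir (hmem : ∀ l, δ l ∈ Ico 0 (2 * π)) (hmono : StrictMono δ) :
    StrictMono (dir δ) := by
  refine strictMono_nat_of_lt_succ fun k => ?_
  have hn := NeZero.pos n
  have hk : k % n < n := Nat.mod_lt _ hn
  conv_lhs => rw [← Nat.div_add_mod k n]
  rw [dir_mul_add δ _ hk]
  by_cases h : k % n + 1 < n
  · have e : k + 1 = n * (k / n) + (k % n + 1) := by rw [← add_assoc, Nat.div_add_mod]
    rw [e, dir_mul_add δ _ h]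
    have : δ ⟨k % n, hk⟩ < δ ⟨k % n + 1, h⟩ := hmono (Fin.mk_lt_mk.2 (Nat.lt_succ_self _))
    linarith
  -- The wrap-around from `δ_{n-1}` to `δ_0 + 2π` increases because all `δ_l` lie in `[0, 2π)`.
  · have e : k + 1 = n * (k / n + 1) + 0 := by
      have := Nat.div_add_mod k n
      rw [mul_add]; omega
    rw [e, dir_mul_add δ _ hn]
    push_cast
    linarith [(hmem ⟨k % n, hk⟩).2, (hmem ⟨0, hn⟩).1]

/-- On which side of the poles of direction `δ_l` the path of integration runs for a direction
between `δ_k` and `δ_{k+1}`. -/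
noncomputable def sgn (n k l : ℕ) : ℝ := if l ≤ k ∧ k < l + n then -1 else 1

theorem sgn_eq (n k l : ℕ) : sgn n k l = 1 ∨ sgn n k l = -1 := by
  unfold sgn; split_ifs <;> simp

theorem sin_ge_of_mem_Icc {x y : ℝ} (hx0 : 0 ≤ x) (hy : y ∈ Icc x (π - x)) :
    Real.sin x ≤ Real.sin y := by
  rw [← Real.cos_pi_div_two_sub, ← Real.cos_pi_div_two_sub y, ← Real.cos_abs (π / 2 - y)]
  refine Real.cos_le_cos_of_nonneg_of_le_pi (abs_nonneg _) (by linarith [Real.pi_pos]) ?_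
  rw [abs_le]; constructor <;> linarith [hy.1, hy.2]

/-- Within the range considered, `sin((δ_l - θ)/2)` is negative exactly for `θ` between `δ_l` and
`δ_{l+n} = δ_l + 2π`, that is for `l ≤ k < l + n`. Staying `μ` away from the endpoints bounds it
away from zero. The last case, `k ≥ l + n`, is handled by a shift of the argument by `2π`. -/
theorem sin_le_sgn_mul_sin (hmem : ∀ l, δ l ∈ Ico 0 (2 * π)) (hmono : StrictMono δ) {k : ℕ}
    (hk : k < 2 * n) (l : Fin n) {μ θ : ℝ} (hμ : 0 ≤ μ)
    (hθ : θ ∈ Icc (dir δ k + μ) (dir δ (k + 1) - μ)) :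
    Real.sin (μ / 2) ≤ sgn n k l * Real.sin ((δ l - θ) / 2) := by
  have hm := (strictMono_dir hmem hmono).monotone
  have h0 := dir_coe δ l
  have h1 := dir_coe_add δ l
  have hμ2 : 0 ≤ μ / 2 := by linarith
  have h2 := hθ.1
  have h3 := hθ.2
  unfold sgn
  split_ifs with h
  · have e1 := hm h.1
    have e2 := hm (Nat.succ_le_of_lt h.2)
    simp only [Nat.succ_eq_add_one] at e2
    rw [neg_one_mul, ← Real.sin_neg]
    refine sin_ge_of_mem_Icc hμ2 ⟨by linarith, by linarith⟩
  · rw [one_mul]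
    by_cases hkl : k < l
    · have e1 := hm (Nat.succ_le_of_lt hkl)
      have e2 := hm (Nat.zero_le k)
      have e3 := dir_coe δ (0 : Fin n)
      rw [Fin.val_zero] at e3
      simp only [Nat.succ_eq_add_one] at e1
      refine sin_ge_of_mem_Icc hμ2 ⟨by linarith, by linarith [(hmem l).2, (hmem 0).1]⟩
    · have hln : l + n ≤ k := by
        by_contra h4
        exact h ⟨not_lt.1 hkl, not_le.1 h4⟩
      have e1 := hm hln
      have e2 := hm (Nat.succ_le_of_lt hk)
      have e3 := dir_two_mul δ
      have e4 := hm (Nat.zero_le l)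
      simp only [Nat.succ_eq_add_one] at e2
      rw [← Real.sin_add_two_pi ((δ l - θ) / 2)]
      refine sin_ge_of_mem_Icc hμ2 ⟨by linarith, by linarith⟩

theorem sgn_mul_sin_pos (hmem : ∀ l, δ l ∈ Ico 0 (2 * π)) (hmono : StrictMono δ) {k : ℕ}
    (hk : k < 2 * n) (l : Fin n) {θ : ℝ} (hθ : θ ∈ Ioo (dir δ k) (dir δ (k + 1))) :
    0 < sgn n k l * Real.sin ((δ l - θ) / 2) := by
  set μ := min 1 (min (θ - dir δ k) (dir δ (k + 1) - θ)) with hμ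
  have h0 : 0 < μ := lt_min one_pos (lt_min (by linarith [hθ.1]) (by linarith [hθ.2]))
  have h1 : μ ≤ 1 := min_le_left _ _
  have h2 : μ ≤ θ - dir δ k := (min_le_right _ _).trans (min_le_left _ _)
  have h3 : μ ≤ dir δ (k + 1) - θ := (min_le_right _ _).trans (min_le_right _ _)
  refine lt_of_lt_of_le ?_ (sin_le_sgn_mul_sin hmem hmono hk l h0.le
    ⟨by linarith, by linarith⟩)
  exact Real.sin_pos_of_pos_of_lt_pi (by linarith) (by linarith [Real.pi_gt_three])

theorem exists_dir_le_lt (δ : Fin n → ℝ) (ψ : ℝ) : ∃ k : Fin (2 * n), ∃ q : ℤ,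
    dir δ k ≤ ψ + 4 * π * q ∧ ψ + 4 * π * q < dir δ (k + 1) := by
  obtain ⟨q, hq, -⟩ := existsUnique_add_zsmul_mem_Ico (by positivity : 0 < 4 * π) ψ (dir δ 0)
  rw [show q • (4 * π) = 4 * π * q by rw [zsmul_eq_mul]; ring, ← dir_two_mul] at hq
  have hn := NeZero.pos n
  have hex : ∃ k : ℕ, ψ + 4 * π * q < dir δ (k + 1) :=
    ⟨2 * n - 1, by rw [Nat.sub_add_cancel (by omega)]; exact hq.2⟩
  classical
  have hle : Nat.find hex ≤ 2 * n - 1 :=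
    Nat.find_min' hex (by rw [Nat.sub_add_cancel (by omega)]; exact hq.2)
  refine ⟨⟨Nat.find hex, by omega⟩, q, ?_, Nat.find_spec hex⟩
  simp only
  rcases Nat.eq_zero_or_eq_succ_pred (Nat.find hex) with h | h
  · rw [h]; exact hq.1
  · rw [h]
    exact not_lt.1 (Nat.find_min hex (m := (Nat.find hex).pred) (by omega))

theorem val_sub_one (K : Fin (2 * n)) :
    ((K : ℕ) = 0 ∧ ((K - 1 : Fin (2 * n)) : ℕ) = 2 * n - 1) ∨
      (K : ℕ) = ((K - 1 : Fin (2 * n)) : ℕ) + 1 := by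
  have hn := NeZero.pos n
  have h1 : ((1 : Fin (2 * n)) : ℕ) = 1 := by
    rw [Fin.val_one']; exact Nat.mod_eq_of_lt (by omega)
  have hK := K.2
  rw [Fin.val_sub, h1]
  rcases Nat.eq_zero_or_pos (K : ℕ) with h | h
  · left
    refine ⟨h, ?_⟩
    rw [h, add_zero]; exact Nat.mod_eq_of_lt (by omega)
  · right
    rw [show 2 * n - 1 + (K : ℕ) = (K - 1) + 2 * n by omega, Nat.add_mod_right,
      Nat.mod_eq_of_lt (by omega)]
    omega

theorem exists_dir_sub_one (δ : Fin n → ℝ) (K : Fin (2 * n)) :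
    ∃ q : ℤ, dir δ (((K - 1 : Fin (2 * n)) : ℕ) + 1) = dir δ K + 4 * π * q := by
  have hn := NeZero.pos n
  rcases val_sub_one K with ⟨h1, h2⟩ | h
  · refine ⟨1, ?_⟩
    rw [h1, h2, Nat.sub_add_cancel (by omega), dir_two_mul]; simp
  · exact ⟨0, by rw [← h]; simp⟩

/-- Crossing `δ_l` flips only the sign of index `l`, from `1` to `-1`. For `l = 0` the predecessor
is `2n - 1`, where all signs are `1`. -/
theorem sgn_lo (l : Fin n) (l' : Fin n) :
    (sgn n (lo l : ℕ) l' - sgn n ((lo l - 1 : Fin (2 * n)) : ℕ) l') / 2 =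
      if l' = l then -1 else 0 := by
  have hl := l.2
  have hl' := l'.2
  have h0 : ((lo l : Fin (2 * n)) : ℕ) = l := rfl
  have h := val_sub_one (lo l)
  rw [h0] at h ⊢
  set x := ((lo l - 1 : Fin (2 * n)) : ℕ)
  simp only [Fin.ext_iff, sgn]
  split_ifs <;> first | (exfalso; omega) | norm_num

/-- Crossing `δ_l + 2π` restores the sign that `δ_l` had flipped, whence the opposite sign of the
second jump. -/
theorem sgn_hi (l : Fin n) (l' : Fin n) :
    (sgn n (hi l : ℕ) l' - sgn n ((hi l - 1 : Fin (2 * n)) : ℕ) l') / 2 =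
      if l' = l then 1 else 0 := by
  have hl := l.2
  have hl' := l'.2
  have h0 : ((hi l : Fin (2 * n)) : ℕ) = l + n := rfl
  have h := val_sub_one (hi l)
  rw [h0] at h ⊢
  set x := ((hi l - 1 : Fin (2 * n)) : ℕ)
  simp only [Fin.ext_iff, sgn]
  split_ifs <;> first | (exfalso; omega) | norm_num

theorem exists_sgn_ne {k k' : Fin (2 * n)} (h : k ≠ k') :
    ∃ l : Fin n, sgn n k l ≠ sgn n k' l := by
  have hn := NeZero.pos n
  wlog hlt : (k : ℕ) < k' generalizing k k'
  · obtain ⟨l, hl⟩ := this h.symm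
      (lt_of_le_of_ne (not_lt.1 hlt) fun e => h (Fin.ext e.symm))
    exact ⟨l, hl.symm⟩
  have hk' := k'.2
  -- For `k < k'` the witness is the pole direction `k'` if `k' < n`, the direction `0` if `k < n ≤
  -- k'`, and `k' - n` if both are at least `n`.
  by_cases h1 : (k' : ℕ) < n
  · refine ⟨⟨k', h1⟩, ?_⟩
    simp only [sgn]
    rw [if_neg (by omega), if_pos (by omega)]; norm_num
  · by_cases h2 : (k : ℕ) < n
    · refine ⟨⟨0, hn⟩, ?_⟩
      simp only [sgn]
      rw [if_pos (by omega), if_neg (by omega)]; norm_num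
    · refine ⟨⟨k' - n, by omega⟩, ?_⟩
      simp only [sgn]
      rw [if_pos (by omega), if_neg (by omega)]; norm_num

/-- Singular directions have period `2π`, rays on `W` period `4π`: each `δ_l` gives two rays, and
the parity of the multiple of `2π` selects `lo` or `hi`. -/
theorem range_ray_dir (δ : Fin n → ℝ) (s : ℝ) :
    {L | ∃ φ : ℝ, (∃ (l : Fin n) (q : ℤ), φ = δ l + 2 * π * q) ∧ L = ray (φ + s)} =
      range fun k : Fin (2 * n) => ray (dir δ k + s) := by
  ext L
  constructor
  · rintro ⟨φ, ⟨l, q, rfl⟩, rfl⟩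
    obtain ⟨j, rfl | rfl⟩ := Int.even_or_odd' q
    · refine ⟨lo l, ?_⟩
      change ray (dir δ l + s) = _
      rw [dir_coe, ← ray_add_int _ j]
      congr 1; push_cast; ring
    · refine ⟨hi l, ?_⟩
      change ray (dir δ (l + n) + s) = _
      rw [dir_coe_add, ← ray_add_int _ j]
      congr 1; push_cast; ring
  · rintro ⟨k, rfl⟩
    exact ⟨dir δ k, ⟨Fin.ofNat n k, ((k / n : ℕ) : ℤ), by rw [dir]; push_cast; rfl⟩, rfl⟩

end Directions

theorem side_eq_sin (p : ℂ) (ψ : ℝ) : side p ψ = ‖p‖ * Real.sin ((2 * p.arg - ψ) / 2) := by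
  have h : p * Complex.exp (-(Complex.I * ψ / 2)) =
      (‖p‖ : ℂ) * Complex.exp (((2 * p.arg - ψ) / 2 : ℝ) * Complex.I) := by
    nth_rw 1 [← Complex.norm_mul_exp_arg_mul_I p]
    rw [mul_assoc, ← Complex.exp_add]
    congr 2; push_cast; ring
  rw [side, h, Complex.im_ofReal_mul, Complex.exp_ofReal_mul_I_im]

theorem side_add_int (p : ℂ) (ψ : ℝ) (q : ℤ) : side p (ψ + 4 * π * q) = side p ψ := by
  rw [side, side, Complex.exp_neg, exp_half_add_int, ← Complex.exp_neg]

/-- An open arc of length `4π` would miss a ray, so a longer one, `(-4π, 4π)`, is used; it contains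
a full period `[0, 4π)`. -/
theorem puncturedDisc_eq_sector {r : ℝ} : puncturedDisc r = sector 0 (8 * π) r := by
  ext w
  constructor
  · rintro ⟨h1, h2⟩
    obtain ⟨ψ, hψ, hw⟩ := exists_pt_eq w 0
    exact ⟨‖w‖ ^ 2, ⟨by positivity, h2⟩, ψ,
      ⟨by linarith [hψ.1, Real.pi_pos], by linarith [hψ.2, Real.pi_pos]⟩, hw⟩
  · intro hw
    exact ⟨ne_zero_of_mem_arcSector hw, norm_sq_lt_of_mem_arcSector hw⟩

theorem arcSector_subset_puncturedDisc (a b r : ℝ) : arcSector a b r ⊆ puncturedDisc r :=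
  fun _ hw => ⟨ne_zero_of_mem_arcSector hw, norm_sq_lt_of_mem_arcSector hw⟩

/-! ### The family of Borel sums -/

section Family

variable {n : ℕ} {m : Fin n → ℕ}

/-- A doubly indexed family as a family indexed by pairs. -/
def flat (a : (l : Fin n) → Fin (m l) → ℂ) (i : (l : Fin n) × Fin (m l)) : ℂ := a i.1 i.2

/-- The sides of the poles on which the path of integration runs for a direction between `δ_k` and
`δ_{k+1}`. -/
noncomputable def pathSide (m : Fin n → ℕ) (k : ℕ) (i : (l : Fin n) × Fin (m l)) : ℝ := sgn n k i.1

theorem pathSide_eq (k : ℕ) (i : (l : Fin n) × Fin (m l)) :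
    pathSide m k i = 1 ∨ pathSide m k i = -1 := sgn_eq n k i.1

theorem meroDatum_eq_poleDatum (a p : (l : Fin n) → Fin (m l) → ℂ) (f : ℂ → ℂ) :
    meroDatum a p f = poleDatum (flat a) (flat p) f := by
  ext x
  rw [meroDatum, poleDatum, Fintype.sum_sigma]
  rfl

/-- The Borel sum in the directions between `δ_k` and `δ_{k+1}`. -/
noncomputable def familySum (a p : (l : Fin n) → Fin (m l) → ℂ) (f : ℂ → ℂ) (k : ℕ) :
    ℂ → ℂ → ℂ := stokesSum (flat a) (flat p) f (pathSide m k)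

theorem familySum_sub_eq_gaussSum (a p : (l : Fin n) → Fin (m l) → ℂ) (f : ℂ → ℂ) {k k' : ℕ}
    {l : Fin n} {s : ℝ} (h : ∀ l' : Fin n, (sgn n k l' - sgn n k' l') / 2 = if l' = l then s else 0)
    (w z : ℂ) :
    familySum a p f k w z - familySum a p f k' w z = s * Complex.I * gaussSum (a l) (p l) w z := by
  rw [familySum, familySum, stokesSum_sub_stokesSum _ _ _ (pathSide_eq k) (pathSide_eq k'),
    Fintype.sum_sigma, Finset.sum_eq_single l]
  · rw [gaussSum, Finset.mul_sum, Finset.mul_sum]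
    refine Finset.sum_congr rfl fun j _ => ?_
    simp only [pathSide, h l, if_true, flat]
    ring
  · intro l' _ hl'
    refine Finset.sum_eq_zero fun j _ => ?_
    simp only [pathSide, h l', if_neg hl']
    simp
  · simp

variable {a p : (l : Fin n) → Fin (m l) → ℂ} {f : ℂ → ℂ} {δ : Fin n → ℝ}

theorem side_flat (hδ : ∀ l j, δ l = 2 * Complex.arg (p l j)) (i : (l : Fin n) × Fin (m l))
    (θ : ℝ) : side (flat p i) θ = ‖flat p i‖ * Real.sin ((δ i.1 - θ) / 2) := by
  rw [side_eq_sin, hδ i.1 i.2]; rfl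

/-- Arguments in `[0, π)` exclude opposite points: both imaginary parts would vanish and both real
parts would be nonnegative. Equal poles then share `δ_l`, which determines `l`. -/
theorem flat_sq_injective (hinj : ∀ l, Function.Injective (p l)) (hp : ∀ l j, p l j ≠ 0)
    (hδ : ∀ l j, δ l = 2 * Complex.arg (p l j)) (hmem : ∀ l, δ l ∈ Ico 0 (2 * π))
    (hmono : StrictMono δ) (i j : (l : Fin n) × Fin (m l)) (h : flat p i ^ 2 = flat p j ^ 2) :
    i = j := by
  have harg : ∀ i : (l : Fin n) × Fin (m l), (flat p i).arg ∈ Ico 0 π := by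
    intro i
    have h1 := hmem i.1
    rw [hδ i.1 i.2] at h1
    exact ⟨by linarith [h1.1, show (flat p i).arg = (p i.1 i.2).arg from rfl],
      by linarith [h1.2, show (flat p i).arg = (p i.1 i.2).arg from rfl]⟩
  have heq : flat p i = flat p j := by
    rcases sq_eq_sq_iff_eq_or_eq_neg.1 h with h | h
    · exact h
    · exfalso
      have hj0 : flat p j ≠ 0 := hp j.1 j.2
      have hi := harg i
      have hj := harg j
      have h1 : 0 ≤ (flat p i).im := Complex.arg_nonneg_iff.1 hi.1
      have h2 : 0 ≤ (flat p j).im := Complex.arg_nonneg_iff.1 hj.1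
      rw [h, Complex.neg_im] at h1
      have h3 : (flat p j).im = 0 := by linarith
      have h4 : ∀ x : ℂ, x.arg ∈ Ico 0 π → x.im = 0 → 0 ≤ x.re := by
        intro x hx hx0
        by_contra hneg
        exact hx.2.ne (Complex.arg_eq_pi_iff.2 ⟨not_le.1 hneg, hx0⟩)
      have h5 := h4 _ hj h3
      have h6 := h4 _ hi (by rw [h, Complex.neg_im, h3, neg_zero])
      rw [h, Complex.neg_re] at h6
      exact hj0 (Complex.ext (by rw [Complex.zero_re]; linarith) h3)
  have hl : i.1 = j.1 := by
    apply hmono.injective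
    rw [hδ i.1 i.2, hδ j.1 j.2]
    exact congrArg (fun x => 2 * Complex.arg x) heq
  obtain ⟨l, x⟩ := i
  obtain ⟨l', y⟩ := j
  simp only at hl
  subst hl
  have : x = y := hinj l heq
  rw [this]

theorem holo_familySum {r₁ r ρ : ℝ} (hflow : ∀ w : ℂ, ‖w‖ ^ 2 < r₁ →
    ∀ z : ℂ, DifferentiableAt ℂ (Function.uncurry (heatFlow f)) (w, z)) (hr : r ≤ r₁) (k : ℕ)
    {S : Set ℂ} (hS : S ⊆ puncturedDisc r) : Holo (familySum a p f k) S ρ := by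
  rintro ⟨w, z⟩ ⟨hw, -⟩
  exact (differentiableAt_stokesSum _ (hS hw).1
    (hflow w ((hS hw).2.trans_le hr) z)).differentiableWithinAt

/-! ### Singular directions and Stokes directions of the datum. -/

theorem sin_half_sub_eq_zero_iff (x d : ℝ) :
    Real.sin ((x - d) / 2) = 0 ↔ ∃ q : ℤ, d = x + 2 * π * q := by
  rw [Real.sin_eq_zero_iff]
  constructor
  · rintro ⟨q, hq⟩
    exact ⟨-q, by push_cast; linarith⟩
  · rintro ⟨q, rfl⟩
    exact ⟨-q, by push_cast; ring⟩

theorem eventually_sin_half_sub_ne_zero (x d : ℝ) :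
    ∀ᶠ θ in 𝓝[≠] d, Real.sin ((x - θ) / 2) ≠ 0 := by
  have hd : HasDerivAt (fun θ => Real.sin ((x - θ) / 2)) (Real.cos ((x - d) / 2) * (-1 / 2)) d :=
    (((hasDerivAt_id d).const_sub x).div_const 2).sin
  by_cases h : Real.sin ((x - d) / 2) = 0
  · apply hd.eventually_ne
    have : Real.cos ((x - d) / 2) ≠ 0 := by
      intro hc
      have := Real.sin_sq_add_cos_sq ((x - d) / 2)
      rw [h, hc] at this
      norm_num at this
    exact mul_ne_zero this (by norm_num)
  · exact (hd.continuousAt.eventually_ne h).filter_mono nhdsWithin_le_nhds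

theorem not_summableIn_iff (hm : ∀ l, 0 < m l) (ha : ∀ l j, a l j ≠ 0) (hp : ∀ l j, p l j ≠ 0)
    (hinj : ∀ l, Function.Injective (p l)) (hδ : ∀ l j, δ l = 2 * Complex.arg (p l j))
    (hmem : ∀ l, δ l ∈ Ico 0 (2 * π)) (hmono : StrictMono δ) (hf : EntireGrowthTwo f) (d : ℝ) :
    ¬ SummableIn (formalSolution (poleDatum (flat a) (flat p) f)) d ↔
      ∃ l : Fin n, Real.sin ((δ l - d) / 2) = 0 := by
  have hp' : ∀ i, flat p i ≠ 0 := fun i => hp i.1 i.2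
  constructor
  · intro h
    by_contra! hne
    have hside : ∀ i, side (flat p i) d ≠ 0 := fun i => by
      rw [side_flat hδ]
      exact mul_ne_zero (norm_ne_zero_iff.2 (hp i.1 i.2)) (hne i.1)
    exact h (summableIn_of_side_ne_zero (flat a) (p := flat p) hf hp' hside)
  · rintro ⟨l, hl⟩
    have hside : side (flat p ⟨l, ⟨0, hm l⟩⟩) d = 0 := by
      rw [side_flat hδ, hl, mul_zero]
    exact not_summableIn_of_side_eq_zero (a := flat a) (p := flat p) hf.1 hp'
      (fun i => ha i.1 i.2) (flat_sq_injective hinj hp hδ hmem hmono) hside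

theorem isStokesDirection_iff (hm : ∀ l, 0 < m l) (ha : ∀ l j, a l j ≠ 0) (hp : ∀ l j, p l j ≠ 0)
    (hinj : ∀ l, Function.Injective (p l)) (hδ : ∀ l j, δ l = 2 * Complex.arg (p l j))
    (hmem : ∀ l, δ l ∈ Ico 0 (2 * π)) (hmono : StrictMono δ) (hf : EntireGrowthTwo f) (d : ℝ) :
    IsStokesDirection (formalSolution (poleDatum (flat a) (flat p) f)) d ↔
      ∃ (l : Fin n) (q : ℤ), d = δ l + 2 * π * q := by
  have hiff := not_summableIn_iff hm ha hp hinj hδ hmem hmono hf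
  simp_rw [← sin_half_sub_eq_zero_iff]
  rw [IsStokesDirection, hiff, and_iff_left_iff_imp]
  intro _
  have hev : ∀ᶠ θ in 𝓝[≠] d, ∀ l, Real.sin ((δ l - θ) / 2) ≠ 0 :=
    eventually_all.2 fun l => eventually_sin_half_sub_ne_zero (δ l) d
  rw [eventually_nhdsWithin_iff] at hev
  obtain ⟨r, hr, h⟩ := Metric.eventually_nhds_iff_ball.1 hev
  refine ⟨r, hr, fun θ hθ hne => ?_⟩
  by_contra hs
  obtain ⟨l, hl⟩ := (hiff θ).1 hs
  exact h θ (by rwa [Real.ball_eq_Ioo]) hne l hl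

theorem oneSummable_formalSolution (hm : ∀ l, 0 < m l) (ha : ∀ l j, a l j ≠ 0)
    (hp : ∀ l j, p l j ≠ 0)
    (hinj : ∀ l, Function.Injective (p l)) (hδ : ∀ l j, δ l = 2 * Complex.arg (p l j))
    (hmem : ∀ l, δ l ∈ Ico 0 (2 * π)) (hmono : StrictMono δ) (hf : EntireGrowthTwo f) :
    OneSummable (formalSolution (poleDatum (flat a) (flat p) f)) := by
  refine (finite_range δ).subset ?_
  rintro d ⟨hd, hs⟩
  obtain ⟨l, hl⟩ := (not_summableIn_iff hm ha hp hinj hδ hmem hmono hf d).1 hs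
  obtain ⟨q, hq⟩ := (sin_half_sub_eq_zero_iff _ _).1 hl
  have h1 := hmem l
  have hπ := Real.pi_pos
  have hq1 : (q : ℝ) < 1 := by
    by_contra h
    nlinarith [hd.2, h1.1, not_lt.1 h]
  have hq2 : (-1 : ℝ) < q := by
    by_contra h
    nlinarith [hd.1, h1.2, not_lt.1 h]
  have hq0 : q = 0 := by
    have e1 : q < 1 := by exact_mod_cast hq1
    have e2 : -1 < q := by exact_mod_cast hq2
    omega
  exact ⟨l, by rw [hq, hq0]; simp⟩

/-! ### Maximality of the family and its jumps. -/

variable [NeZero n]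

theorem pathSide_mul_side_pos (hp : ∀ l j, p l j ≠ 0)
    (hδ : ∀ l j, δ l = 2 * Complex.arg (p l j)) (hmem : ∀ l, δ l ∈ Ico 0 (2 * π))
    (hmono : StrictMono δ) {k : Fin (2 * n)} {θ : ℝ}
    (hθ : ∃ q : ℤ, θ + 4 * π * q ∈ Ioo (dir δ k) (dir δ (k + 1))) (i : (l : Fin n) × Fin (m l)) :
    0 < pathSide m k i * side (flat p i) θ := by
  obtain ⟨q, hq⟩ := hθ
  rw [← side_add_int _ θ q, side_flat hδ, mul_left_comm]
  exact mul_pos (norm_pos_iff.2 (hp i.1 i.2)) (sgn_mul_sin_pos hmem hmono k.2 i.1 hq)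

/-- The sectors `V_k` cover the punctured disc. -/
theorem iUnion_V {ε : ℝ} (hε : ε < π) (r : ℝ) : ⋃ k, V δ ε r k = puncturedDisc r := by
  refine subset_antisymm (iUnion_subset fun k => arcSector_subset_puncturedDisc _ _ r) ?_
  rintro w ⟨h1, h2⟩
  obtain ⟨ψ, -, hw⟩ := exists_pt_eq w 0
  obtain ⟨k, q, h3, h4⟩ := exists_dir_le_lt δ ψ
  refine mem_iUnion.2 ⟨k, ‖w‖ ^ 2, ⟨by positivity, h2⟩, ψ + 4 * π * q,
    ⟨by linarith, by linarith⟩, ?_⟩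
  rw [pt_add_int]; exact hw

/-- The points of `V_k` lie in sectors bisected by directions that keep a distance from the
singular ones. -/
theorem exists_direction_of_mem_V {ε r : ℝ} (hε : 0 < ε) {k : Fin (2 * n)}
    (hgap : ε < dir δ (k + 1) - dir δ k) {w : ℂ} (hw : w ∈ V δ ε r k) :
    ∃ R ψ θ : ℝ, 0 < R ∧ w = pt R ψ ∧ |ψ - θ| < π / 2 ∧
      θ ∈ Icc (dir δ k + ε / 4) (dir δ (k + 1) - ε / 4) := by
  obtain ⟨R, hR, ψ, hψ, rfl⟩ := hw
  have hπ := Real.pi_pos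
  -- `θ` is `ψ` clamped to the interval shortened by `ε/4` at each end. The sector exceeds the
  -- interval by `π/2 - ε/2`, so the clamping moves `ψ` by less than `π/2 - ε/4`.
  refine ⟨R, ψ, max (dir δ k + ε / 4) (min ψ (dir δ (k + 1) - ε / 4)), hR.1, rfl, ?_,
    le_max_left _ _, max_le (by linarith) (min_le_right _ _)⟩
  have h1 := hψ.1
  have h2 := hψ.2
  rw [abs_lt]
  rcases max_cases (dir δ k + ε / 4) (min ψ (dir δ (k + 1) - ε / 4)) with ⟨h, h'⟩ | ⟨h, h'⟩ <;>
    rcases min_cases ψ (dir δ (k + 1) - ε / 4) with ⟨h3, h4⟩ | ⟨h3, h4⟩ <;> rw [h] <;>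
    constructor <;> linarith

/-- The gap condition gives the sectors openings greater than `π`, while `ε < π` makes them cover.
For maximality, a summable `d` lies strictly between two consecutive directions modulo `4π`, and
uniqueness of 1-sums identifies the given solution with the corresponding member. -/
theorem isMaximalFamily_familySum (hm : ∀ l, 0 < m l) (ha : ∀ l j, a l j ≠ 0)
    (hp : ∀ l j, p l j ≠ 0) (hinj : ∀ l, Function.Injective (p l))
    (hδ : ∀ l j, δ l = 2 * Complex.arg (p l j)) (hmem : ∀ l, δ l ∈ Ico 0 (2 * π))
    (hmono : StrictMono δ) (hf : EntireGrowthTwo f) {r₁ : ℝ}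
    (hflow : ∀ w : ℂ, ‖w‖ ^ 2 < r₁ →
      ∀ z : ℂ, DifferentiableAt ℂ (Function.uncurry (heatFlow f)) (w, z) ∧
        HasDerivAt (heatFlow f w) (heatFlow (deriv f) w z) z ∧
        HasDerivAt (heatFlow (deriv f) w) (heatFlow (deriv (deriv f)) w z) z ∧
        HasDerivAt (fun w => heatFlow f w z) (2 * w * heatFlow (deriv (deriv f)) w z) w ∧
        Integrable (fun x : ℝ => Complex.exp (-(x : ℂ) ^ 2 / 4) * f (z + w * x)))
    {ε r ρ ρ₁ : ℝ} (hε : 0 < ε) (hεπ : ε < π)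
    (hgap : ∀ k : Fin (2 * n), ε < dir δ (k + 1) - dir δ k) (hr : 0 < r) (hr₁ : r ≤ r₁)
    (hρ : 0 < ρ) (hρ₁ : ∀ i, ρ₁ ≤ ‖flat p i‖) (hρ₁0 : 0 < ρ₁)
    (hρ₂ : ρ ≤ ρ₁ * Real.sin (ε / 8)) :
    IsMaximalFamily (poleDatum (flat a) (flat p) f) (puncturedDisc r) ρ (V δ ε r)
      (fun k : Fin (2 * n) => familySum a p f k) where
  summable := oneSummable_formalSolution hm ha hp hinj hδ hmem hmono hf
  finite := inferInstance
  total_sector := ⟨0, 8 * π, r, by linarith [Real.pi_pos], hr, puncturedDisc_eq_sector⟩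
  sub k := arcSector_subset_puncturedDisc _ _ r
  is_sector k := by
    refine ⟨(dir δ k + dir δ (k + 1)) / 2, dir δ (k + 1) - dir δ k + π - ε, r,
      by linarith [hgap k], hr, ?_⟩
    rw [V, sector]
    congr 1 <;> ring
  cover := iUnion_V hεπ r
  solution k := by
    have hsin1 : Real.sin (ε / 8) ≤ 1 := Real.sin_le_one _
    have hsin0 : 0 ≤ Real.sin (ε / 8) :=
      (Real.sin_pos_of_pos_of_lt_pi (by linarith) (by linarith [Real.pi_pos])).le
    refine ⟨holo_familySum (fun w hw z => (hflow w hw z).1) hr₁ k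
      (arcSector_subset_puncturedDisc _ _ r), fun w hw z _ => ?_, fun z hz => ?_⟩
    · have hw' := arcSector_subset_puncturedDisc _ _ r hw
      have hw2 := hw'.2.trans_le hr₁
      exact stokesSum_heat (pathSide_eq k) hw'.1 (fun z => (hflow w hw2 z).2.1)
        (fun z => (hflow w hw2 z).2.2.1) z (hflow w hw2 z).2.2.2.1
    · rw [mem_ball_zero_iff] at hz
      have hr1 : 0 < r₁ := hr.trans_le hr₁
      -- Path directions keep the distance `ε/4` from the singular ones and sides involve
      -- half-angles, hence `ε/8`; `ρ₁` bounds the moduli of the poles from below.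
      refine tendsto_stokesSum (pathSide_eq k) (κ := ρ₁ * Real.sin (ε / 8)) (fun w hw => ?_)
        (hz.trans_le hρ₂) (fun i h => ?_) (hflow 0 (by simpa using hr1) z).1
      · obtain ⟨R, ψ, θ, hR, hw, hψ, hθ⟩ := exists_direction_of_mem_V hε (hgap k) hw
        refine ⟨R, ψ, θ, hR, hw, hψ, fun i => ?_⟩
        have h1 := sin_le_sgn_mul_sin hmem hmono k.2 i.1 (by linarith : 0 ≤ ε / 4) hθ
        rw [show ε / 4 / 2 = ε / 8 by ring] at h1
        rw [side_flat hδ, mul_left_comm]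
        exact mul_le_mul (hρ₁ i) h1 hsin0 (norm_nonneg _)
      · have h1 := hρ₁ i
        rw [← h] at h1
        nlinarith
  distinct k k' hne hV h := by
    obtain ⟨w, hw⟩ := hV
    refine stokesSum_ne (a := flat a) (p := flat p) (f := f) (fun i => ha i.1 i.2)
      (fun i j hij => flat_sq_injective hinj hp hδ hmem hmono i j (by rw [hij]))
      (pathSide_eq k) (pathSide_eq k') (fun heq => ?_) (ne_zero_of_mem_arcSector hw.1) hρ
      (fun z hz => h w hw z hz)
    obtain ⟨l, hl⟩ := exists_sgn_ne hne
    exact hl (congrFun heq ⟨l, ⟨0, hm l⟩⟩)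
  maximal := by
    rintro d₀ α r' Vt ut d hα hr' rfl hVt hut hsum hne hone
    obtain ⟨k, q, h1, h2⟩ := exists_dir_le_lt δ d
    -- The half-open interval found for `d` becomes open, since its left end is a singular direction
    -- while `d` is summable.
    have h1' : dir δ k ≠ d + 4 * π * q := by
      intro h
      refine (not_summableIn_iff hm ha hp hinj hδ hmem hmono hf d).2 ⟨Fin.ofNat n k, ?_⟩ hsum
      rw [sin_half_sub_eq_zero_iff]
      refine ⟨((k / n : ℕ) : ℤ) - 2 * q, ?_⟩
      rw [dir] at h
      rw [Int.cast_sub, Int.cast_natCast, Int.cast_mul, Int.cast_ofNat]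
      linarith
    have hd : ∃ q : ℤ, d + 4 * π * q ∈ Ioo (dir δ k) (dir δ (k + 1)) :=
      ⟨q, lt_of_le_of_ne h1 h1', h2⟩
    have hone' : IsOneSum (formalSolution (poleDatum (flat a) (flat p) f)) d (familySum a p f k) :=
      isOneSum_stokesSum (flat a) hf (fun i => hp i.1 i.2) (pathSide_eq k)
        (pathSide_mul_side_pos hp hδ hmem hmono hd)
    have heq := hone.eqOn hone' hρ hne hut.holo
      (holo_familySum (fun w hw z => (hflow w hw z).1) hr₁ k hVt)
    refine ⟨k, ?_, fun w hw z hz => heq w hw.1 z hz⟩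
    obtain ⟨w, ⟨R, hR, rfl⟩, hw⟩ := hne
    have hR2 := (hVt hw).2
    rw [norm_pt_sq hR.le] at hR2
    exact ⟨_, hw, R, ⟨hR, hR2⟩, d + 4 * π * q, ⟨by linarith, by linarith⟩,
      (pt_add_int R d q).symm⟩

/-- Directions just above `δ_K` lie in interval `K`, those just below in the preceding one. For `K =
0` the latter is the last interval, reached after adding `4π`; this is the integer `q`. -/
theorem isJump_familySum (hp : ∀ l j, p l j ≠ 0) (hδ : ∀ l j, δ l = 2 * Complex.arg (p l j))
    (hmem : ∀ l, δ l ∈ Ico 0 (2 * π)) (hmono : StrictMono δ) (hf : EntireGrowthTwo f)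
    (K : Fin (2 * n)) {φ : ℝ} (hφ : dir δ K = φ) {S : Set ℂ} {ρ : ℝ} {J : ℂ → ℂ → ℂ}
    (hholo : ∀ k : ℕ, Holo (familySum a p f k) S ρ)
    (hJ : ∀ w ∈ S, ∀ z ∈ Metric.ball (0 : ℂ) ρ, familySum a p f K w z -
      familySum a p f (K - 1 : Fin (2 * n)) w z = J w z) :
    IsJump (formalSolution (poleDatum (flat a) (flat p) f)) φ S ρ J := by
  subst hφ
  have hsm := strictMono_dir hmem hmono
  have h1 : dir δ K < dir δ (K + 1) := hsm (Nat.lt_succ_self _)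
  have h2 : dir δ (K - 1 : Fin (2 * n)) < dir δ (((K - 1 : Fin (2 * n)) : ℕ) + 1) :=
    hsm (Nat.lt_succ_self _)
  obtain ⟨q, hq⟩ := exists_dir_sub_one δ K
  have hone : ∀ (k : Fin (2 * n)) (θ : ℝ),
      (∃ q : ℤ, θ + 4 * π * q ∈ Ioo (dir δ k) (dir δ (k + 1))) →
      IsOneSum (formalSolution (poleDatum (flat a) (flat p) f)) θ (familySum a p f k) :=
    fun k θ hθ => isOneSum_stokesSum (flat a) hf (fun i => hp i.1 i.2) (pathSide_eq k)
        (pathSide_mul_side_pos hp hδ hmem hmono hθ)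
  set η := min (dir δ (K + 1) - dir δ K)
    (dir δ (((K - 1 : Fin (2 * n)) : ℕ) + 1) - dir δ (K - 1 : Fin (2 * n))) with hη
  have hη1 : η ≤ dir δ (K + 1) - dir δ K := min_le_left _ _
  have hη2 : η ≤ dir δ (((K - 1 : Fin (2 * n)) : ℕ) + 1) - dir δ (K - 1 : Fin (2 * n)) :=
    min_le_right _ _
  refine ⟨familySum a p f K, familySum a p f (K - 1 : Fin (2 * n)), hholo _, hholo _,
    ⟨η, lt_min (by linarith) (by linarith), fun θ hθ => hone K θ ⟨0, ?_⟩,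
      fun θ hθ => hone (K - 1) θ ⟨q, ?_⟩⟩, fun w hw z hz => (hJ w hw z hz).symm⟩
  · simp only [Int.cast_zero, mul_zero, add_zero]
    exact ⟨hθ.1, by linarith [hθ.2]⟩
  · exact ⟨by linarith [hθ.1], by linarith [hθ.2]⟩

end Family

end HeatStokes

/-! ### The corollary. -/

theorem corollary5p4 (n : ℕ) [NeZero n] (m : Fin n → ℕ) (hm : ∀ l, 0 < m l)
    (a p : (l : Fin n) → Fin (m l) → ℂ) (f : ℂ → ℂ) (δ : Fin n → ℝ)
    (ha : ∀ l j, a l j ≠ 0) (hp : ∀ l j, p l j ≠ 0) (hinj : ∀ l, Function.Injective (p l))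
    (hδ : ∀ l j, δ l = 2 * Complex.arg (p l j)) (hδ_mem : ∀ l, δ l ∈ Set.Ico 0 (2 * Real.pi))
    (hδ_mono : StrictMono δ) (hf : HeatStokes.EntireGrowthTwo f) :
    -- the Stokes lines and the anti-Stokes lines of the formal solution
    {L | HeatStokes.IsStokesLine (HeatStokes.formalSolution (HeatStokes.meroDatum a p f)) L} =
      Set.range (fun k : Fin (2 * n) => HeatStokes.ray (HeatStokes.dir δ k)) ∧
    {L | HeatStokes.IsAntiStokesLine (HeatStokes.formalSolution (HeatStokes.meroDatum a p f)) L} =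
      Set.range (fun k : Fin (2 * n) => HeatStokes.ray (HeatStokes.dir δ k + Real.pi / 2)) ∪
      Set.range (fun k : Fin (2 * n) => HeatStokes.ray (HeatStokes.dir δ k - Real.pi / 2)) ∧
    ∃ u : Fin (2 * n) → ℂ → ℂ → ℂ,
      -- `u k` is `u^θ`, the `1`-sum in the direction `θ`, for every `θ` between `δ_k` and `δ_{k+1}`
      (∀ (k : Fin (2 * n)) (θ : ℝ),
        (∃ q : ℤ, θ + 4 * Real.pi * q ∈
          Set.Ioo (HeatStokes.dir δ k) (HeatStokes.dir δ (k + 1))) →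
        HeatStokes.IsOneSum (HeatStokes.formalSolution (HeatStokes.meroDatum a p f)) θ (u k) ∧
        ∀ ε > 0, ∃ r > 0, ∃ ρ > 0, ∀ w ∈ HeatStokes.sector θ (Real.pi - ε) r,
          ∀ z ∈ Metric.ball (0 : ℂ) ρ,
            MeasureTheory.IntegrableOn
              (HeatStokes.heatIntegrand (HeatStokes.meroDatum a p f) θ w z) (Set.Ioi 0) ∧
            u k w z = HeatStokes.heatIntegral (HeatStokes.meroDatum a p f) θ w z) ∧
      ∀ ε > 0, ∃ r₀ > 0, ∃ ρ₀ > 0, ∀ r ∈ Set.Ioc 0 r₀, ∀ ρ ∈ Set.Ioc 0 ρ₀,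
        (∀ k, HeatStokes.Holo (u k) (HeatStokes.V δ ε r k) ρ) ∧
        -- the maximal family, for `ε` so small that the `V_k` have openings greater than `π`
        -- and cover `W_r`
        (ε < Real.pi →
          (∀ k : Fin (2 * n), ε < HeatStokes.dir δ (k + 1) - HeatStokes.dir δ k) →
          HeatStokes.IsMaximalFamily (HeatStokes.meroDatum a p f) (HeatStokes.puncturedDisc r) ρ
            (HeatStokes.V δ ε r) u) ∧
        -- the jumps; indices of `u` are modulo `2n`
        ∀ l : Fin n,
          (∀ w ∈ HeatStokes.sector (δ l) (Real.pi - ε) r, ∀ z ∈ Metric.ball (0 : ℂ) ρ,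
            u (HeatStokes.lo l) w z - u (HeatStokes.lo l - 1) w z =
              -Complex.I * HeatStokes.gaussSum (a l) (p l) w z) ∧
          HeatStokes.IsJump (HeatStokes.formalSolution (HeatStokes.meroDatum a p f)) (δ l)
            (HeatStokes.sector (δ l) (Real.pi - ε) r) ρ
            (fun w z => -Complex.I * HeatStokes.gaussSum (a l) (p l) w z) ∧
          (∀ w ∈ HeatStokes.sector (δ l + 2 * Real.pi) (Real.pi - ε) r,
            ∀ z ∈ Metric.ball (0 : ℂ) ρ,
            u (HeatStokes.hi l) w z - u (HeatStokes.hi l - 1) w z =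
              Complex.I * HeatStokes.gaussSum (a l) (p l) w z) ∧
          HeatStokes.IsJump (HeatStokes.formalSolution (HeatStokes.meroDatum a p f))
            (δ l + 2 * Real.pi) (HeatStokes.sector (δ l + 2 * Real.pi) (Real.pi - ε) r) ρ
            (fun w z => Complex.I * HeatStokes.gaussSum (a l) (p l) w z) := by
  have hbase := HeatStokes.isStokesDirection_iff hm ha hp hinj hδ hδ_mem hδ_mono hf
  have hp' : ∀ i, HeatStokes.flat p i ≠ 0 := fun i => hp i.1 i.2
  rw [HeatStokes.meroDatum_eq_poleDatum]
  refine ⟨?_, ?_, fun k => HeatStokes.familySum a p f k, fun k θ hθ => ?_, fun ε hε => ?_⟩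
  · have h := HeatStokes.range_ray_dir δ 0
    simp only [add_zero] at h
    rw [← h]
    ext L
    simp only [Set.mem_ofPred_eq, HeatStokes.IsStokesLine, hbase]
  · simp only [sub_eq_add_neg]
    rw [← HeatStokes.range_ray_dir δ (Real.pi / 2), ← HeatStokes.range_ray_dir δ (-(Real.pi / 2))]
    ext L
    simp only [Set.mem_ofPred_eq, Set.mem_union, HeatStokes.IsAntiStokesLine, hbase,
      sub_eq_add_neg, and_or_left, exists_or]
  · have hside := HeatStokes.pathSide_mul_side_pos hp hδ hδ_mem hδ_mono hθ
    exact ⟨HeatStokes.isOneSum_stokesSum (HeatStokes.flat a) hf hp' (HeatStokes.pathSide_eq k)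
      hside, fun ε hε => HeatStokes.stokesSum_eq_heatIntegral (HeatStokes.flat a) hf
        (HeatStokes.pathSide_eq k) hside hε⟩
  · obtain ⟨r₁, hr₁, hflow⟩ := HeatStokes.heatFlow_regular hf
    obtain ⟨ρ₁, hρ₁, hle, -⟩ :=
      HeatStokes.borelFun_near_zero (HeatStokes.flat a) (p := HeatStokes.flat p) hf.1 hp'
    have hsin : 0 < Real.sin (min ε Real.pi / 8) :=
      Real.sin_pos_of_pos_of_lt_pi (by have := lt_min hε Real.pi_pos; positivity)
        (by linarith [min_le_right ε Real.pi, Real.pi_pos])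
    -- The radius in `t` is that of the heat flow of `f`. Replacing `ε` by `min ε π` keeps the sine
    -- positive for every `ε`, and changes nothing where the maximal family is claimed, since there
    -- `ε < π`.
    refine ⟨r₁, hr₁, ρ₁ * Real.sin (min ε Real.pi / 8), mul_pos hρ₁ hsin, fun r hr ρ hρ => ?_⟩
    have hholo : ∀ (k : ℕ) (x y : ℝ),
        HeatStokes.Holo (HeatStokes.familySum a p f k) (HeatStokes.arcSector x y r) ρ :=
      fun k x y => HeatStokes.holo_familySum (fun w hw z => (hflow w hw z).1) hr.2 k
        (HeatStokes.arcSector_subset_puncturedDisc x y r)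
    have hlo : ∀ (l : Fin n) (w z : ℂ), HeatStokes.familySum a p f (HeatStokes.lo l) w z -
        HeatStokes.familySum a p f (HeatStokes.lo l - 1 : Fin (2 * n)) w z =
          -Complex.I * HeatStokes.gaussSum (a l) (p l) w z := fun l w z => by
      rw [HeatStokes.familySum_sub_eq_gaussSum a p f (HeatStokes.sgn_lo l)]
      simp
    have hhi : ∀ (l : Fin n) (w z : ℂ), HeatStokes.familySum a p f (HeatStokes.hi l) w z -
        HeatStokes.familySum a p f (HeatStokes.hi l - 1 : Fin (2 * n)) w z =
          Complex.I * HeatStokes.gaussSum (a l) (p l) w z := fun l w z => by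
      rw [HeatStokes.familySum_sub_eq_gaussSum a p f (HeatStokes.sgn_hi l)]
      simp
    refine ⟨fun k => hholo _ _ _, fun hεπ hgap => ?_, fun l => ⟨fun w _ z _ => hlo l w z,
      HeatStokes.isJump_familySum hp hδ hδ_mem hδ_mono hf (HeatStokes.lo l)
        (HeatStokes.dir_coe δ l) (fun k => hholo _ _ _) (fun w _ z _ => hlo l w z),
      fun w _ z _ => hhi l w z,
      HeatStokes.isJump_familySum hp hδ hδ_mem hδ_mono hf (HeatStokes.hi l)
        (HeatStokes.dir_coe_add δ l) (fun k => hholo _ _ _) (fun w _ z _ => hhi l w z)⟩⟩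
    refine HeatStokes.isMaximalFamily_familySum hm ha hp hinj hδ hδ_mem hδ_mono hf hflow hε hεπ
      hgap hr.1 hr.2 hρ.1 (fun i => by linarith [hle i]) hρ₁ ?_
    rw [← min_eq_left hεπ.le]
    exact hρ.2
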